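/- **Asymptotic normality of the multilabel global Fréchet regression estimator.** *Data.* Let $(\Omega,d)$ be a complete separable metric space with $d^2\le M$ for a constant $M$, and let $(X_i,Y_i,O_i)_{i\ge 1}$ be i.i.d. random variables, where $X_i\in\mathbb R^m$ is the predictor, $O_i\in\Omega$ is the response object and $Y_i\in\mathbb R^m$ is the vector that represents the response. Let $\mu_X,\mu_Y$ be the means of $X_1$ and $Y_1$, $\Sigma=\mathrm{Var}(X_1)$ and $\Sigma_{XY}=E[(X_1-\mu_X)(Y_1-\mu_Y)^T]$, and let $\overline X,\overline Y,\widehat\Sigma,\widehat\Sigma_{XY}$ be their sample versions (the matrices normalized by $n^{-1}$). For $x\in\mathbb R^m$ let $Z_i$ be either $X_i$ for all $i$, or $x$ for all $i$; the result holds for both choices. Put $$f_n(w)=\frac1n\sum_{i=1}^n\Big[1+(X_i-\overline X)^T\widehat\Sigma^{-1}(Z_i-\overline X)+(X_i-\overline X)^T\widehat\Sigma_{XY}^{-1}(Y_i-\overline Y)\Big]d^2(O_i,w),\qquad F(w)=E\big[s_1\,d^2(O_1,w)\big],$$ $$s_i=1+(X_i-\mu_X)^T\Sigma^{-1}(Z_i-\mu_X)+(X_i-\mu_X)^T\Sigma_{XY}^{-1}(Y_i-\mu_Y).$$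 Let $\widehat\zeta_\oplus(x)\in\Omega$ be a measurable map of the underlying probability space that, for all sufficiently large $n$, almost surely minimizes $f_n$ over $\Omega$, and let $\zeta=\zeta_\oplus(x)$ be a minimizer of $F$ over $\Omega$. *Regularity conditions.* 1. $E\|X_1\|^4<\infty$, $E\|Y_1\|^4<\infty$, and $\Sigma$, $\Sigma_{XY}$ are invertible. 2. $\zeta$ is well separated: for every $\varepsilon>0$ there is $\delta>0$ with $F(w)\ge F(\zeta)+\delta$ for all $w\in\Omega$ with $d(w,\zeta)\ge\varepsilon$. 3. Elements of $\Omega$ are given by coordinates in $\mathbb R^p$: there is a measurable map $\varphi:\Omega\to\mathbb R^p$ that restricts to a homeomorphism from an open neighbourhood of $\zeta$ onto an open subset of $\mathbb R^p$ (for $\Omega\subset\mathbb R^p$ whose metric topology agrees with the Euclidean one near the interior point $\zeta$, $\varphi$ is the inclusion). Differences of points, gradients $\nabla$ and Hessians $\nabla^2$ are taken in these coordinates. 4. There are an open neighbourhood $U$ of $\varphi(\zeta)$ inside that open subset and a measurable $L:\Omega\to\mathbb R$ such that, almost surely, $w\mapsto d^2(O_1,w)$ is $C^2$ on $U$ with first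 and second derivatives bounded there by $L(O_1)$ in norm, and $E\big[(1+\|X_1\|^2+\|Y_1\|^2)^2L(O_1)^2\big]<\infty$. 5. $H=\nabla^2F(\zeta)$ is invertible. *The matrix $\Sigma_\zeta$.* Put $x_i=X_i-\mu_X$, $y_i=Y_i-\mu_Y$, $z_i=Z_i-\mu_X$ and $g_i=\nabla d^2(O_i,\zeta)$, and let $\Sigma_\zeta$ be the covariance matrix of $\psi(X_1,Y_1,O_1)$, where, with $(X_2,Y_2,O_2)$ independent of $(X_1,Y_1,O_1)$, $$\psi(X_1,Y_1,O_1)=s_1g_1-E\Big[\Big(x_1^T\Sigma^{-1}z_2+x_2^T\Sigma^{-1}x_1+x_2^T\Sigma^{-1}(x_1x_1^T-\Sigma)\Sigma^{-1}z_2+x_1^T\Sigma_{XY}^{-1}y_2+x_2^T\Sigma_{XY}^{-1}y_1+x_2^T\Sigma_{XY}^{-1}(x_1y_1^T-\Sigma_{XY})\Sigma_{XY}^{-1}y_2\Big)g_2\,\Big|\,X_1,Y_1,O_1\Big].$$ *Conclusion.* $F$ is $C^2$ near $\zeta$, $H$ is positive definite, $\psi(X_1,Y_1,O_1)$ is square integrable,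 $\Sigma_\zeta$ is positive semidefinite, and as $n\to\infty$ $$\sqrt n\,\nabla f_n(\zeta)\xrightarrow{d}\mathcal N(0,\Sigma_\zeta),\qquad \sqrt n\,\big(\widehat\zeta_\oplus(x)-\zeta_\oplus(x)\big)\xrightarrow{d}\mathcal N\big(0,\,H^{-1}\Sigma_\zeta H^{-1}\big),$$ the difference in the last statement being $\varphi(\widehat\zeta_\oplus(x))-\varphi(\zeta_\oplus(x))$. -/

import Mathlib

open MeasureTheory ProbabilityTheory Filter Topology Matrix

noncomputable section

namespace FrechetRegression

/-- The regression weight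
`1 + (x - a)ᵀ S⁻¹ (z - a) + (x - a)ᵀ C⁻¹ (y - b)`
for locations `a`, `b`, a covariance matrix `S` and a cross-covariance matrix `C`. -/
def weight {m : ℕ} (S C : Matrix (Fin m) (Fin m) ℝ) (a b x z y : Fin m → ℝ) : ℝ :=
  1 + (x - a) ⬝ᵥ (S⁻¹ *ᵥ (z - a)) + (x - a) ⬝ᵥ (C⁻¹ *ᵥ (y - b))

/-- The derivative of `weight` with respect to the parameters `(S, C, a, b)`, at `(S, C, a, b)` with
`S` and `C` invertible, in the direction `(dS, dC, da, db)`. -/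
def weightDeriv {m : ℕ} (S C : Matrix (Fin m) (Fin m) ℝ) (a b : Fin m → ℝ)
    (dS dC : Matrix (Fin m) (Fin m) ℝ) (da db x z y : Fin m → ℝ) : ℝ :=
  - (da ⬝ᵥ (S⁻¹ *ᵥ (z - a))) - (x - a) ⬝ᵥ (S⁻¹ *ᵥ da)
    - (x - a) ⬝ᵥ ((S⁻¹ * dS * S⁻¹) *ᵥ (z - a))
    - da ⬝ᵥ (C⁻¹ *ᵥ (y - b)) - (x - a) ⬝ᵥ (C⁻¹ *ᵥ db)
    - (x - a) ⬝ᵥ ((C⁻¹ * dC * C⁻¹) *ᵥ (y - b))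

/-! ### Sample quantities (sample of size `n`, indexed by `i < n`) -/

/-- The sample mean. -/
def sampleMean {m : ℕ} (n : ℕ) (x : ℕ → Fin m → ℝ) : Fin m → ℝ :=
  (n : ℝ)⁻¹ • ∑ i ∈ Finset.range n, x i

/-- The sample (cross-)covariance matrix `n⁻¹ ∑ (xᵢ - x̄) (yᵢ - ȳ)ᵀ`. -/
def sampleCov {m : ℕ} (n : ℕ) (x y : ℕ → Fin m → ℝ) : Matrix (Fin m) (Fin m) ℝ :=
  (n : ℝ)⁻¹ • ∑ i ∈ Finset.range n,
    vecMulVec (x i - sampleMean n x) (y i - sampleMean n y)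

/-- The empirical objective
`w ↦ n⁻¹ ∑ [1 + (xᵢ - x̄)ᵀ Σ̂⁻¹ (zᵢ - x̄) + (xᵢ - x̄)ᵀ Σ̂_XY⁻¹ (yᵢ - ȳ)] d²(oᵢ, w)`, `zᵢ = η xᵢ`.
The factor `n⁻¹` does not change its minimizers. -/
def empObjective {m : ℕ} {Ω : Type*} [MetricSpace Ω] (η : (Fin m → ℝ) → (Fin m → ℝ)) (n : ℕ)
    (x y : ℕ → Fin m → ℝ) (o : ℕ → Ω) (w : Ω) : ℝ :=
  (n : ℝ)⁻¹ * ∑ i ∈ Finset.range n,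
    weight (sampleCov n x x) (sampleCov n x y) (sampleMean n x) (sampleMean n y)
      (x i) (η (x i)) (y i) * dist (o i) w ^ 2

/-! ### Population quantities -/

section Population

variable {𝒮 : Type*} [MeasurableSpace 𝒮] {m p : ℕ} {Ω : Type*} [MetricSpace Ω]

/-- The mean vector. -/
def popMean (P : Measure 𝒮) (X : 𝒮 → Fin m → ℝ) : Fin m → ℝ :=
  fun j => ∫ s, X s j ∂P

/-- The population (cross-)covariance matrix `E[(X - E X) (Y - E Y)ᵀ]`. -/
def popCov (P : Measure 𝒮) (X Y : 𝒮 → Fin m → ℝ) : Matrix (Fin m) (Fin m) ℝ :=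
  Matrix.of fun j k => covariance (fun s => X s j) (fun s => Y s k) P

/-- The population weight `s(x, z, y)`. -/
def popWeight (P : Measure 𝒮) (X Y : 𝒮 → Fin m → ℝ) (x z y : Fin m → ℝ) : ℝ :=
  weight (popCov P X X) (popCov P X Y) (popMean P X) (popMean P Y) x z y

/-- The population objective `w ↦ E[s(X, η X, Y) d²(O, w)]`. -/
def popObjective (P : Measure 𝒮) (η : (Fin m → ℝ) → (Fin m → ℝ))
    (X Y : 𝒮 → Fin m → ℝ) (O : 𝒮 → Ω) (w : Ω) : ℝ :=
  ∫ s, popWeight P X Y (X s) (η (X s)) (Y s) * dist (O s) w ^ 2 ∂P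

/-- A function on `Ω` read in the coordinates `φ`. -/
def inCoords (φ : OpenPartialHomeomorph Ω (EuclideanSpace ℝ (Fin p))) (f : Ω → ℝ) :
    EuclideanSpace ℝ (Fin p) → ℝ :=
  fun u => f (φ.symm u)

/-- The Hessian matrix of a function on `ℝᵖ`. -/
def hessian (f : EuclideanSpace ℝ (Fin p) → ℝ) (u : EuclideanSpace ℝ (Fin p)) :
    Matrix (Fin p) (Fin p) ℝ :=
  Matrix.of fun i j =>
    fderiv ℝ (fderiv ℝ f) u (EuclideanSpace.single i 1) (EuclideanSpace.single j 1)

/-- The gradient at `ζ`, in the coordinates `φ`, of `w ↦ d²(o, w)`. -/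
def distGrad (φ : OpenPartialHomeomorph Ω (EuclideanSpace ℝ (Fin p))) (ζ o : Ω) :
    EuclideanSpace ℝ (Fin p) :=
  gradient (inCoords φ fun w => dist o w ^ 2) (φ ζ)

/-- The contribution of one observation `s` to the gradient at `ζ` of the empirical objective:
`s(X, η X, Y) ∇d²(O, ζ)`, plus the linear effect on the gradient of estimating `μ_X`, `μ_Y`, `Σ`
and `Σ_XY` by their sample versions, whose own contributions are `X - μ_X`, `Y - μ_Y`,
`(X - μ_X)(X - μ_X)ᵀ - Σ` and `(X - μ_X)(Y - μ_Y)ᵀ - Σ_XY`. -/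
def score (P : Measure 𝒮) (η : (Fin m → ℝ) → (Fin m → ℝ)) (X Y : 𝒮 → Fin m → ℝ) (O : 𝒮 → Ω)
    (φ : OpenPartialHomeomorph Ω (EuclideanSpace ℝ (Fin p))) (ζ : Ω) (s : 𝒮) :
    EuclideanSpace ℝ (Fin p) :=
  popWeight P X Y (X s) (η (X s)) (Y s) • distGrad φ ζ (O s) +
    ∫ t, weightDeriv (popCov P X X) (popCov P X Y) (popMean P X) (popMean P Y)
        (vecMulVec (X s - popMean P X) (X s - popMean P X) - popCov P X X)
        (vecMulVec (X s - popMean P X) (Y s - popMean P Y) - popCov P X Y)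
        (X s - popMean P X) (Y s - popMean P Y)
        (X t) (η (X t)) (Y t) • distGrad φ ζ (O t) ∂P

/-- The (asymptotic) covariance matrix `Σ_ζ` of `√n ∇f(ζ)`. -/
def scoreCov (P : Measure 𝒮) (η : (Fin m → ℝ) → (Fin m → ℝ)) (X Y : 𝒮 → Fin m → ℝ) (O : 𝒮 → Ω)
    (φ : OpenPartialHomeomorph Ω (EuclideanSpace ℝ (Fin p))) (ζ : Ω) :
    Matrix (Fin p) (Fin p) ℝ :=
  Matrix.of fun i j =>
    covariance (fun s => score P η X Y O φ ζ s i) (fun s => score P η X Y O φ ζ s j) P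

end Population

end FrechetRegression

end

noncomputable section

/-! For fixed parameters the regression weight is a polynomial in the data, `∑ α, c α * q α`. The `q
α` are finitely many monomials in `x`, `z`, `y`, and each `c α` is a rational function of the
moments `v`, the means of `x xᵀ`, `x yᵀ`, `x`, `y` (`weight_eq_sum`, `momentCoef`). Estimating the
means and covariances makes the summands of the empirical objective dependent. That dependence
enters only through the scalars `c α` evaluated at an i.i.d. mean, and what they multiply are
ordinary i.i.d. averages.

Gradient. The gradient of the empirical objective at `ζ` is `Φ` of the mean of the i.i.d. vectors `V
i = (moments, (q α • g (O i))_α)`, where `Φ (v, T) = ∑ α, c α (v) • T α` (`meanScore`). At `E V` the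
value of `Φ` is the gradient of the population objective at its minimizer, hence zero. The delta
method gives a Gaussian limit with the covariance of `A (V - E V)`, where `A` is the derivative of
`Φ` at `E V`. This variable is the score, since differentiating the weight along a perturbation of
the moments produces `weightDeriv` (`score_eq_linearization`).

Consistency. Because `d²` is bounded, moving `o` a little moves `d²(o, v)` little, uniformly in `v`.
The responses can therefore be replaced by their nearest points in a finite set, and a law of large
numbers uniform over all of `Ω` follows from separability, without compactness
(`ae_uniform_mean_dist_sq`). Well-separation of `ζ` finishes the argument.

Linearization. On the ball of radius `r / (k + 1)` the second order Taylor remainder of `d²(O, ·)`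
is at most `R k O * ‖h‖ ^ 2`, with `R k ≤ 2 L` and `R k → 0`. Dominated convergence makes its
weighted mean small for large `k`. So almost surely the empirical objectives have, for all large
`n`, a common quadratic expansion with Hessian `H` (`weighted_mean_expansion`). Comparing the
minimizer with the point `-H⁻¹ G`, where `G` is the gradient, shows that they differ by `o(‖G‖)`
(`eventually_norm_argmin_sub_le`). As `√n G` is bounded in probability, Slutsky's theorem gives the
limit law. The weights may be negative, so `H` has no sign by itself; its positivity comes from
minimality together with invertibility. -/

namespace FrechetRegression

/-! ### Boundedness in probability, the delta method and the central limit theorem. -/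

section Probability

variable {𝒮 : Type*} [MeasurableSpace 𝒮] {P : Measure 𝒮}

/-- A sequence of real random variables that is bounded in probability. -/
def BddInProb (P : Measure 𝒮) (a : ℕ → 𝒮 → ℝ) : Prop :=
  ∀ ε : ENNReal, 0 < ε → ∃ M : ℝ, ∀ n, P {s | M < |a n s|} ≤ ε

lemma BddInProb.mono {a b : ℕ → 𝒮 → ℝ} (ha : BddInProb P a) (h : ∀ n s, |b n s| ≤ |a n s|) :
    BddInProb P b := fun ε hε => by
  obtain ⟨M, hM⟩ := ha ε hε
  exact ⟨M, fun n => (measure_mono fun s (hs : M < |b n s|) => hs.trans_le (h n s)).trans (hM n)⟩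

lemma BddInProb.zero : BddInProb P (fun _ _ => (0 : ℝ)) := fun ε _ => ⟨0, fun n => by simp⟩

lemma BddInProb.add {a b : ℕ → 𝒮 → ℝ} (ha : BddInProb P a) (hb : BddInProb P b) :
    BddInProb P (fun n s => a n s + b n s) := fun ε hε => by
  obtain ⟨M, hM⟩ := ha (ε / 2) (ENNReal.half_pos hε.ne')
  obtain ⟨M', hM'⟩ := hb (ε / 2) (ENNReal.half_pos hε.ne')
  refine ⟨M + M', fun n => ?_⟩
  calc P {s | M + M' < |a n s + b n s|}
      ≤ P ({s | M < |a n s|} ∪ {s | M' < |b n s|}) := measure_mono fun s hs => by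
        simp only [Set.mem_ofPred_eq, Set.mem_union] at hs ⊢
        by_contra! h
        linarith [abs_add_le (a n s) (b n s)]
    _ ≤ ε / 2 + ε / 2 := (measure_union_le _ _).trans (add_le_add (hM n) (hM' n))
    _ = ε := ENNReal.add_halves ε

lemma BddInProb.const_mul {a : ℕ → 𝒮 → ℝ} (ha : BddInProb P a) (c : ℝ) :
    BddInProb P (fun n s => c * a n s) := fun ε hε => by
  obtain ⟨M, hM⟩ := ha ε hε
  refine ⟨|c| * M, fun n => (measure_mono fun s hs => ?_).trans (hM n)⟩
  simp only [Set.mem_ofPred_eq, abs_mul] at hs ⊢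
  exact lt_of_mul_lt_mul_left hs (abs_nonneg c)

lemma BddInProb.sum {ι : Type*} (t : Finset ι) {a : ι → ℕ → 𝒮 → ℝ}
    (ha : ∀ i ∈ t, BddInProb P (a i)) : BddInProb P (fun n s => ∑ i ∈ t, a i n s) := by
  classical
  induction t using Finset.induction_on with
  | empty => simpa using BddInProb.zero
  | insert i t hi ih =>
    simp only [Finset.sum_insert hi]
    exact (ha i (by simp)).add (ih fun j hj => ha j (by simp [hj]))

/-- This is the rule that an almost surely negligible factor times a bounded in probability sequence
tends to zero in probability. Off the event that `|a n|` exceeds a large constant, a large `‖b n‖`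
violates the almost sure domination, and the probability of that tends to zero. -/
lemma tendstoInMeasure_zero_of_ae_le [IsFiniteMeasure P] {E : Type*} [NormedAddCommGroup E]
    {a : ℕ → 𝒮 → ℝ} {b : ℕ → 𝒮 → E}
    (ha : BddInProb P a) (hma : ∀ n, AEMeasurable (a n) P) (hmb : ∀ n, AEStronglyMeasurable (b n) P)
    (h : ∀ᵐ s ∂P, ∀ ε > 0, ∀ᶠ n in atTop, ‖b n s‖ ≤ ε * |a n s|) :
    TendstoInMeasure P b atTop 0 := by
  rw [tendstoInMeasure_iff_norm]
  intro ε hε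
  simp only [Pi.zero_apply, sub_zero]
  rw [ENNReal.tendsto_nhds_zero]
  intro δ hδ
  obtain ⟨M, hM⟩ := ha (δ / 2) (ENNReal.half_pos hδ.ne')
  -- The bound `M` may be nonpositive, while the relative tolerance `ε / (2 * M')` needs a positive
  -- denominator.
  set M' := max M 1
  have hM' : 0 < M' := by positivity
  have hlim : Tendsto (fun n => P {s | ε / (2 * M') * |a n s| < ‖b n s‖}) atTop (𝓝 0) := by
    -- The indicators of the exceptional events vanish eventually at almost every point; on a finite
    -- measure space this forces their measures to zero.
    have h1 : TendstoInMeasure P (fun n => {s | ε / (2 * M') * |a n s| < ‖b n s‖}.indicator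
        (fun _ => (1 : ℝ))) atTop (fun _ => 0) := by
      refine tendstoInMeasure_of_tendsto_ae (fun n => ?_) ?_
      · exact aestronglyMeasurable_const.indicator₀ (nullMeasurableSet_lt
          ((continuous_abs.measurable.comp_aemeasurable (hma n)).const_mul _)
              (hmb n).norm.aemeasurable)
      · filter_upwards [h] with s hs
        refine tendsto_const_nhds.congr' ?_
        filter_upwards [hs (ε / (2 * M')) (by positivity)] with n hn
        rw [Set.indicator_of_notMem]
        simpa using hn
    rw [tendstoInMeasure_iff_norm] at h1
    refine (h1 1 one_pos).congr fun n => congrArg P (Set.ext fun s => ?_)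
    by_cases hs : ε / (2 * M') * |a n s| < ‖b n s‖ <;> simp [hs]
  rw [ENNReal.tendsto_nhds_zero] at hlim
  filter_upwards [hlim (δ / 2) (ENNReal.half_pos hδ.ne')] with n hn
  calc P {s | ε ≤ ‖b n s‖}
      ≤ P ({s | M < |a n s|} ∪ {s | ε / (2 * M') * |a n s| < ‖b n s‖}) :=
          measure_mono fun s hs => by
        simp only [Set.mem_ofPred_eq, Set.mem_union] at hs ⊢
        by_contra! h
        have h1 : |a n s| ≤ M' := h.1.trans (le_max_left _ _)
        have : ‖b n s‖ ≤ ε / (2 * M') * M' := h.2.trans (by gcongr)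
        have h3 : ε / (2 * M') * M' = ε / 2 := by field_simp
        linarith
    _ ≤ δ / 2 + δ / 2 := (measure_union_le _ _).trans (add_le_add (hM n) hn)
    _ = δ := ENNReal.add_halves δ


/-- Chebyshev's inequality: the sum of `n` independent copies has variance `n * v`, exactly
compensated by the normalization. -/
lemma bddInProb_sqrt_mul_mean [IsProbabilityMeasure P] {ξ : ℕ → 𝒮 → ℝ} (hL2 : MemLp (ξ 0) 2 P)
    (hindep : iIndepFun ξ P) (hident : ∀ i, IdentDistrib (ξ i) (ξ 0) P P) :
    BddInProb P (fun n s => √(n : ℝ) * ((n : ℝ)⁻¹ * ∑ i ∈ Finset.range n, ξ i s - P[ξ 0])) := by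
  intro ε hε
  obtain ⟨δ, hδ, hδε⟩ : ∃ δ : ℝ, 0 < δ ∧ ENNReal.ofReal δ ≤ ε := by
    rcases eq_or_ne ε ⊤ with rfl | h
    · exact ⟨1, one_pos, le_top⟩
    · exact ⟨ε.toReal, ENNReal.toReal_pos hε.ne' h, (ENNReal.ofReal_toReal h).le⟩
  set v := Var[ξ 0; P]
  have hv : 0 ≤ v := variance_nonneg _ _
  have hall : ∀ i, MemLp (ξ i) 2 P := fun i => (hident i).memLp_iff.2 hL2
  -- Chebyshev bounds the probability by `v / M ^ 2`, which is then at most `δ`; the `+ 1` keeps `M`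
  -- positive when the variance vanishes.
  set M : ℝ := √((v + 1) / δ)
  have hM : 0 < M := Real.sqrt_pos.2 (by positivity)
  refine ⟨M, fun n => ?_⟩
  rcases Nat.eq_zero_or_pos n with rfl | hn
  · simp [hM.not_gt]
  have hn' : (0 : ℝ) < n := by exact_mod_cast hn
  have hvar : Var[∑ i ∈ Finset.range n, ξ i; P] = n * v := by
    rw [IndepFun.variance_sum (fun i _ => hall i) fun i _ j _ hij => hindep.indepFun hij]
    simp [fun i => (hident i).variance_eq, v]
  have hmean : ∫ s, (∑ i ∈ Finset.range n, ξ i) s ∂P = n * P[ξ 0] := by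
    simp only [Finset.sum_apply]
    rw [integral_finsetSum _ fun i _ => (hall i).integrable one_le_two]
    simp [fun i => (hident i).integral_eq]
  have hsq : (0 : ℝ) < √(n : ℝ) := Real.sqrt_pos.2 hn'
  calc P {s | M < |√(n : ℝ) * ((n : ℝ)⁻¹ * ∑ i ∈ Finset.range n, ξ i s - P[ξ 0])|}
      ≤ P {s | √(n : ℝ) * M ≤ |(∑ i ∈ Finset.range n, ξ i) s -
          ∫ t, (∑ i ∈ Finset.range n, ξ i) t ∂P|} := measure_mono fun s hs => by
        rw [Set.mem_ofPred_eq] at hs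
        rw [Set.mem_ofPred_eq, hmean, Finset.sum_apply]
        have h1 : √(n : ℝ) * ((n : ℝ)⁻¹ * ∑ i ∈ Finset.range n, ξ i s - P[ξ 0]) =
            (√(n : ℝ))⁻¹ * (∑ i ∈ Finset.range n, ξ i s - n * P[ξ 0]) := by
          have := Real.sq_sqrt hn'.le
          field_simp
          rw [this]
        rw [h1, abs_mul, abs_of_pos (inv_pos.2 hsq)] at hs
        rw [lt_inv_mul_iff₀ hsq] at hs
        exact hs.le
    _ ≤ ENNReal.ofReal (Var[∑ i ∈ Finset.range n, ξ i; P] / (√(n : ℝ) * M) ^ 2) :=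
        meas_ge_le_variance_div_sq (memLp_finsetSum' _ fun i _ => hall i) (by positivity)
    _ ≤ ENNReal.ofReal δ := by
        refine ENNReal.ofReal_le_ofReal ?_
        rw [hvar, mul_pow, Real.sq_sqrt hn'.le, Real.sq_sqrt (by positivity),
          div_le_iff₀ (by positivity)]
        field_simp
        linarith
    _ ≤ ε := hδε

variable {W : Type*} [NormedAddCommGroup W] [NormedSpace ℝ W] [FiniteDimensional ℝ W]
  [MeasurableSpace W] [BorelSpace W]

/-- In finite dimension the norm is dominated by the coordinates in a basis, which reduces the claim
to the scalar case. -/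
lemma bddInProb_norm_sqrt_smul_mean [IsProbabilityMeasure P] {V : ℕ → 𝒮 → W}
    (hL2 : MemLp (V 0) 2 P) (hindep : iIndepFun V P)
    (hident : ∀ i, IdentDistrib (V i) (V 0) P P) :
    BddInProb P (fun n s => ‖√(n : ℝ) • ((n : ℝ)⁻¹ • ∑ i ∈ Finset.range n, V i s - P[V 0])‖) := by
  let b := Module.finBasis ℝ W
  let c : Fin (Module.finrank ℝ W) → (W →L[ℝ] ℝ) :=
      fun j => LinearMap.toContinuousLinearMap (b.coord j)
  have key : ∀ j, BddInProb P (fun n s =>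
      |c j (√(n : ℝ) • ((n : ℝ)⁻¹ • ∑ i ∈ Finset.range n, V i s - P[V 0]))| * ‖b j‖) := by
    intro j
    have h1 : MemLp (fun s => c j (V 0 s)) 2 P := (c j).comp_memLp' hL2
    have := bddInProb_sqrt_mul_mean (ξ := fun i s => c j (V i s)) h1
      (hindep.comp (fun _ => c j) fun _ => (c j).measurable)
      (fun i => (hident i).comp (c j).measurable)
    refine ((this.const_mul ‖b j‖)).mono fun n s => le_of_eq ?_
    rw [(c j).integral_comp_comm (hL2.integrable one_le_two)]
    simp only [map_smul, map_sub, map_sum, smul_eq_mul, abs_mul, abs_abs, abs_norm]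
    ring
  refine (BddInProb.sum Finset.univ fun j _ => key j).mono fun n s => ?_
  set v := √(n : ℝ) • ((n : ℝ)⁻¹ • ∑ i ∈ Finset.range n, V i s - P[V 0])
  rw [abs_norm]
  calc ‖v‖ = ‖∑ j, c j v • b j‖ := by
        congr 1
        exact (b.sum_repr v).symm
    _ ≤ ∑ j, |c j v| * ‖b j‖ := (norm_sum_le _ _).trans (by simp [norm_smul])
    _ ≤ _ := le_abs_self _

lemma ae_tendsto_mean {W : Type*} [NormedAddCommGroup W] [NormedSpace ℝ W] [CompleteSpace W]
    [MeasurableSpace W] [BorelSpace W] {V : ℕ → 𝒮 → W}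
    (hint : Integrable (V 0) P) (hindep : iIndepFun V P)
    (hident : ∀ i, IdentDistrib (V i) (V 0) P P) :
    ∀ᵐ s ∂P, Tendsto (fun n : ℕ => (n : ℝ)⁻¹ • ∑ i ∈ Finset.range n, V i s) atTop (𝓝 P[V 0]) :=
  strong_law_ae V hint (fun _ _ hij => hindep.indepFun hij) hident

/-- The delta method, as an asymptotic linearization. -/
lemma tendstoInMeasure_delta [IsProbabilityMeasure P] {V : ℕ → 𝒮 → W}
    (hL2 : MemLp (V 0) 2 P) (hindep : iIndepFun V P)
    (hident : ∀ i, IdentDistrib (V i) (V 0) P P) {E : Type*} [NormedAddCommGroup E]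
    [NormedSpace ℝ E] {Φ : W → E} {A : W →L[ℝ] E} (hΦ : HasFDerivAt Φ A P[V 0])
    (hmeas : ∀ n : ℕ, AEStronglyMeasurable
      (fun s => Φ ((n : ℝ)⁻¹ • ∑ i ∈ Finset.range n, V i s)) P) :
    TendstoInMeasure P (fun (n : ℕ) s =>
      √(n : ℝ) • (Φ ((n : ℝ)⁻¹ • ∑ i ∈ Finset.range n, V i s) - Φ P[V 0]) -
        √(n : ℝ) • A ((n : ℝ)⁻¹ • ∑ i ∈ Finset.range n, V i s - P[V 0])) atTop 0 := by
  have := FiniteDimensional.proper ℝ W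
  have hV : ∀ i, AEMeasurable (V i) P := fun i => (hident i).aemeasurable_fst
  have hmean : ∀ n : ℕ, AEStronglyMeasurable
      (fun s => (n : ℝ)⁻¹ • ∑ i ∈ Finset.range n, V i s - P[V 0]) P := fun n =>
    (((Finset.aestronglyMeasurable_fun_sum _ fun i _ =>
        (hV i).aestronglyMeasurable).const_smul _).sub
      aestronglyMeasurable_const)
  refine tendstoInMeasure_zero_of_ae_le (bddInProb_norm_sqrt_smul_mean hL2 hindep hident)
    (fun n => ((hmean n).const_smul _).norm.aemeasurable) (fun n => ?_) ?_
  · exact (((hmeas n).sub aestronglyMeasurable_const).const_smul _).sub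
      ((A.continuous.comp_aestronglyMeasurable (hmean n)).const_smul _)
  · filter_upwards [ae_tendsto_mean (hL2.integrable one_le_two) hindep hident] with s hs ε hε
    have := (hasFDerivAt_iff_isLittleO.1 hΦ).def hε
    filter_upwards [hs.eventually this] with n hn
    rw [← smul_sub, norm_smul, abs_norm, norm_smul]
    calc _ ≤ ‖√(n : ℝ)‖ * (ε * _) := by gcongr
      _ = _ := by ring

/-- Multivariate central limit theorem. -/
lemma tendstoInDistribution_sqrt_smul_mean [IsProbabilityMeasure P] {p : ℕ}
    {ξ : ℕ → 𝒮 → EuclideanSpace ℝ (Fin p)} (hL2 : MemLp (ξ 0) 2 P) (hindep : iIndepFun ξ P)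
    (hident : ∀ i, IdentDistrib (ξ i) (ξ 0) P P) {S : Matrix (Fin p) (Fin p) ℝ}
    (hS : S.PosSemidef) (hSv : ∀ t : EuclideanSpace ℝ (Fin p),
      Var[fun s => inner ℝ (ξ 0 s) t; P] = t ⬝ᵥ S *ᵥ t) :
    TendstoInDistribution (fun (n : ℕ) s =>
        √(n : ℝ) • ((n : ℝ)⁻¹ • ∑ i ∈ Finset.range n, ξ i s - P[ξ 0]))
      atTop (id : EuclideanSpace ℝ (Fin p) → EuclideanSpace ℝ (Fin p)) (fun _ => P)
      (multivariateGaussian 0 S) where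
  forall_aemeasurable n := by
    have hξ : ∀ i, AEMeasurable (ξ i) P := fun i => (hident i).aemeasurable_fst
    fun_prop
  aemeasurable_limit := aemeasurable_id
  tendsto := by
    have hξ : ∀ i, AEMeasurable (ξ i) P := fun i => (hident i).aemeasurable_fst
    refine ProbabilityMeasure.tendsto_iff_tendsto_charFun.2 fun t ↦ ?_
    have hm : Measurable (fun v : EuclideanSpace ℝ (Fin p) => inner ℝ v t) := by fun_prop
    have h1 := tendstoInDistribution_inv_sqrt_mul_sum_sub (P := P) (X :=
        fun i s => inner ℝ (ξ i s) t)
      (Y := id) (P' := gaussianReal 0 Var[fun s => inner ℝ (ξ 0 s) t; P].toNNReal) HasLaw.id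
      (hL2.inner_const t) (hindep.comp (fun _ v => inner ℝ v t) fun _ => hm)
      (fun i => (hident i).comp hm)
    -- Cramér–Wold: the characteristic function at `t` is that of the projection on `t` at the point
    -- `1`, so the one-dimensional theorem suffices.
    have h2 := ProbabilityMeasure.tendsto_iff_tendsto_charFun.1 h1.tendsto 1
    simp only [ProbabilityMeasure.coe_mk, Measure.map_id] at h2 ⊢
    rw [charFun_multivariateGaussian hS]
    rw [charFun_gaussianReal] at h2
    -- With the convention that the inverse of zero is zero, the two normalizations agree also for
    -- the empty sample.
    have hsq : ∀ n : ℕ, √(n : ℝ) * (n : ℝ)⁻¹ = (√(n : ℝ))⁻¹ := fun n => by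
      rcases Nat.eq_zero_or_pos n with rfl | hn
      · simp
      · have hn' : (0 : ℝ) < n := by exact_mod_cast hn
        have := Real.sq_sqrt hn'.le
        field_simp
        exact this
    have hsq' : ∀ n : ℕ, √(n : ℝ) = (√(n : ℝ))⁻¹ * n := fun n => by
      rcases Nat.eq_zero_or_pos n with rfl | hn
      · simp
      · have hn' : (0 : ℝ) < n := by exact_mod_cast hn
        have := Real.sq_sqrt hn'.le
        field_simp
        exact this
    convert h2 using 2
    · rename_i n
      rw [charFun_apply, charFun_apply, integral_map (by fun_prop) (by fun_prop),
        integral_map (by fun_prop) (by fun_prop)]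
      refine integral_congr_ae (ae_of_all _ fun s => ?_)
      have h3 : inner ℝ (√(n : ℝ) • ((n : ℝ)⁻¹ • ∑ i ∈ Finset.range n, ξ i s - P[ξ 0])) t =
          (√(n : ℝ))⁻¹ * (∑ i ∈ Finset.range n, inner ℝ (ξ i s) t -
            n * ∫ s, inner ℝ (ξ 0 s) t ∂P) := by
        have h4 : ∫ s, inner ℝ (ξ 0 s) t ∂P = inner ℝ (P[ξ 0]) t := by
          simp_rw [real_inner_comm t]
          exact integral_inner (hL2.integrable one_le_two) t
        rw [h4, real_inner_smul_left, inner_sub_left, real_inner_smul_left, sum_inner,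
          mul_sub, mul_sub, ← mul_assoc, hsq, ← mul_assoc, ← hsq']
      simp [h3]
    · have hv : (0 : ℝ) ≤ t ⬝ᵥ S *ᵥ t := by rw [← hSv]; exact variance_nonneg _ _
      simp [hSv, Real.coe_toNNReal _ hv]

end Probability

/-! ### Linear images of Gaussian laws. -/

section Gaussian

lemma map_toEuclideanCLM_multivariateGaussian {p : ℕ} {S : Matrix (Fin p) (Fin p) ℝ}
    (hS : S.PosSemidef) (M : Matrix (Fin p) (Fin p) ℝ) :
    (multivariateGaussian 0 S).map (Matrix.toEuclideanCLM (𝕜 := ℝ) M) =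
      multivariateGaussian 0 (M * S * Mᵀ) := by
  have hS' : (M * S * Mᵀ).PosSemidef := by
    simpa using hS.mul_mul_conjTranspose_same M
  apply Measure.ext_of_charFun (E := EuclideanSpace ℝ (Fin p))
  ext t
  have hadj : ∀ x : EuclideanSpace ℝ (Fin p), inner ℝ (Matrix.toEuclideanCLM (𝕜 := ℝ) M x) t =
      inner ℝ x (Matrix.toEuclideanCLM (𝕜 := ℝ) Mᵀ t) := by
    intro x
    simp [PiLp.inner_apply, Matrix.ofLp_toEuclideanCLM, Matrix.mulVec, dotProduct,
      Finset.mul_sum, Finset.sum_mul]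
    rw [Finset.sum_comm]
    refine Finset.sum_congr rfl fun i _ => Finset.sum_congr rfl fun j _ => by ring
  rw [charFun_apply, integral_map (by fun_prop) (by fun_prop)]
  simp_rw [hadj]
  rw [← charFun_apply, charFun_multivariateGaussian hS, charFun_multivariateGaussian hS']
  have h1 : (Matrix.toEuclideanCLM (𝕜 := ℝ) Mᵀ t).ofLp ⬝ᵥ
      S *ᵥ (Matrix.toEuclideanCLM (𝕜 := ℝ) Mᵀ t).ofLp = t.ofLp ⬝ᵥ (M * S * Mᵀ) *ᵥ t.ofLp := by
    rw [Matrix.ofLp_toEuclideanCLM, ← Matrix.mulVec_mulVec, ← Matrix.mulVec_mulVec,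
      Matrix.dotProduct_mulVec t.ofLp M, ← Matrix.mulVec_transpose]
  rw [h1]
  simp

/-- Convergence in distribution sees only the law of the limit variable, so the limit may be
realized on another space. -/
lemma tendstoInDistribution_of_map_eq {ι E Ω₁ Ω₂ Ω₃ : Type*} [TopologicalSpace E]
    [MeasurableSpace E] [OpensMeasurableSpace E] [MeasurableSpace Ω₁] [MeasurableSpace Ω₂]
    [MeasurableSpace Ω₃] {P : Measure Ω₁} [IsProbabilityMeasure P] {μ : Measure Ω₂}
    [IsProbabilityMeasure μ] {ν : Measure Ω₃} [IsProbabilityMeasure ν] {X : ι → Ω₁ → E}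
    {l : Filter ι} {Z : Ω₂ → E} {Z' : Ω₃ → E} (h : TendstoInDistribution X l Z (fun _ => P) μ)
    (hZ' : AEMeasurable Z' ν) (hZ : μ.map Z = ν.map Z') :
    TendstoInDistribution X l Z' (fun _ => P) ν where
  forall_aemeasurable := h.forall_aemeasurable
  aemeasurable_limit := hZ'
  tendsto := by
    have h1 : (⟨μ.map Z, Measure.isProbabilityMeasure_map h.aemeasurable_limit⟩ :
        ProbabilityMeasure E) = ⟨ν.map Z', Measure.isProbabilityMeasure_map hZ'⟩ :=
      Subtype.ext hZ
    rw [← h1]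
    exact h.tendsto

end Gaussian

/-! ### Measurable versions of almost sure limits. -/

section MeasurableRep

variable {𝒮 Ω E : Type*} [MeasurableSpace 𝒮] [MeasurableSpace Ω] {P : Measure 𝒮}

/-- Derivatives of `d²(o, ·)` exist only for almost every response. Working under the law of `O`
turns such a limit into a measurable function of `o`, which can then be evaluated at every
observation. -/
lemma exists_measurable_rep_of_tendsto [TopologicalSpace E] [MeasurableSpace E]
    [BorelSpace E] [PolishSpace E] [Nonempty E] {O : 𝒮 → Ω} (hO : Measurable O)
    {f : ℕ → Ω → E} (hf : ∀ k, Measurable (f k)) {l : 𝒮 → E}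
    (h : ∀ᵐ s ∂P, Tendsto (fun k => f k (O s)) atTop (𝓝 (l s))) :
    ∃ g : Ω → E, Measurable g ∧ ∀ᵐ s ∂P, l s = g (O s) := by
  have hm : MeasurableSet {o | ∃ l, Tendsto (fun k => f k o) atTop (𝓝 l)} :=
    measurableSet_exists_tendsto hf
  have hae : ∀ᵐ o ∂(P.map O), ∃ l, Tendsto (fun k => f k o) atTop (𝓝 l) := by
    rw [ae_map_iff hO.aemeasurable hm]
    filter_upwards [h] with s hs using ⟨_, hs⟩
  obtain ⟨g, hg, hlim⟩ := measurable_limit_of_tendsto_metrizable_ae (fun k =>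
      (hf k).aemeasurable) hae
  refine ⟨g, hg, ?_⟩
  filter_upwards [h, ae_of_ae_map hO.aemeasurable hlim] with s h1 h2
  exact tendsto_nhds_unique h1 h2

end MeasurableRep

/-! ### Differentiation under the integral sign. -/

section ParametricIntegral

variable {𝒮 : Type*} [MeasurableSpace 𝒮] {P : Measure 𝒮} {p : ℕ}
  {G : Type*} [NormedAddCommGroup G] [NormedSpace ℝ G]

/-- Each directional derivative is a limit of measurable difference quotients, and in finite
dimension the derivative is recovered from its values on a basis. -/
lemma aestronglyMeasurable_fderiv {E : Type*} [NormedAddCommGroup E] [NormedSpace ℝ E]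
    [FiniteDimensional ℝ E] {F : E → 𝒮 → G}
    {U : Set E} (hU : IsOpen U) (hF : ∀ u ∈ U, AEStronglyMeasurable (F u) P)
    {u : E} (hu : u ∈ U) (hd : ∀ᵐ s ∂P, DifferentiableAt ℝ (F · s) u) :
    AEStronglyMeasurable (fun s => fderiv ℝ (F · s) u) P := by
  -- evaluate at each vector
  have hv : ∀ v : E, AEStronglyMeasurable (fun s => fderiv ℝ (F · s) u v) P := by
    intro v
    have hnhds : ∀ᶠ k : ℕ in atTop, u + (k + 1 : ℝ)⁻¹ • v ∈ U := by
      have : Tendsto (fun k : ℕ => u + (k + 1 : ℝ)⁻¹ • v) atTop (𝓝 u) := by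
        have h1 : Tendsto (fun k : ℕ => (k + 1 : ℝ)⁻¹) atTop (𝓝 0) := by
          simpa using tendsto_one_div_add_atTop_nhds_zero_nat (𝕜 := ℝ)
        simpa using (tendsto_const_nhds (x := u)).add (h1.smul_const v)
      exact this.eventually (hU.mem_nhds hu)
    obtain ⟨N, hN⟩ := eventually_atTop.1 hnhds
    -- The shift by `N` keeps every evaluation point inside `U`, where measurability is available.
    refine aestronglyMeasurable_of_tendsto_ae atTop (f := fun (k : ℕ) s =>
      ((k + N : ℕ) + 1 : ℝ) • (F (u + ((k + N : ℕ) + 1 : ℝ)⁻¹ • v) s - F u s)) (fun k => ?_) ?_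
    · exact ((hF _ (hN _ (by simp))).sub (hF u hu)).const_smul _
    · filter_upwards [hd] with s hs
      refine hs.hasFDerivAt.lim v (c := fun k : ℕ => ((k + N : ℕ) + 1 : ℝ)) ?_
      have h2 : Tendsto (fun k : ℕ => ((k + N : ℕ) : ℝ) + 1) atTop atTop :=
        tendsto_atTop_add_const_right _ _
          (tendsto_natCast_atTop_atTop.comp (tendsto_add_atTop_nat N))
      exact tendsto_norm_atTop_atTop.comp h2
  let b := Module.finBasis ℝ E
  let c : Fin (Module.finrank ℝ E) → (E →L[ℝ] ℝ) := fun j =>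
    LinearMap.toContinuousLinearMap (b.coord j)
  have hrep : ∀ A : E →L[ℝ] G, A = ∑ j, ContinuousLinearMap.smulRightL ℝ E G (c j) (A (b j)) := by
    intro A
    ext v
    conv_lhs => rw [← b.sum_repr v, map_sum]
    simp [c]
  have : (fun s => fderiv ℝ (F · s) u) = fun s => ∑ j,
      ContinuousLinearMap.smulRightL ℝ E G (c j) (fderiv ℝ (F · s) u (b j)) :=
    funext fun s => hrep _
  rw [this]
  exact Finset.aestronglyMeasurable_fun_sum _ fun j _ =>
    (ContinuousLinearMap.smulRightL ℝ E G (c j)).continuous.comp_aestronglyMeasurable (hv (b j))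

/-- Differentiation under the integral sign on an open set, with a continuous derivative. -/
lemma contDiffOn_one_integral {E : Type*} [NormedAddCommGroup E] [NormedSpace ℝ E]
    [FiniteDimensional ℝ E] {F : E → 𝒮 → G} {U : Set E} (hU : IsOpen U)
    (hF : ∀ u ∈ U, Integrable (F u) P) {b : 𝒮 → ℝ} (hb : Integrable b P)
    (hsm : ∀ᵐ s ∂P, ContDiffOn ℝ 1 (F · s) U ∧ ∀ u ∈ U, ‖fderiv ℝ (F · s) u‖ ≤ b s) :
    (∀ u ∈ U, Integrable (fun s => fderiv ℝ (F · s) u) P ∧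
      HasFDerivAt (fun u => ∫ s, F u s ∂P) (∫ s, fderiv ℝ (F · s) u ∂P) u) ∧
    ContinuousOn (fun u => ∫ s, fderiv ℝ (F · s) u ∂P) U := by
  have hmeas : ∀ u ∈ U, AEStronglyMeasurable (fun s => fderiv ℝ (F · s) u) P := fun u hu =>
    aestronglyMeasurable_fderiv hU (fun u hu => (hF u hu).aestronglyMeasurable) hu (by
      filter_upwards [hsm] with s hs
      exact (hs.1.contDiffAt (hU.mem_nhds hu)).differentiableAt one_ne_zero)
  refine ⟨fun u hu => ⟨hb.mono' (hmeas u hu) ?_, ?_⟩, ?_⟩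
  · filter_upwards [hsm] with s hs using hs.2 u hu
  · refine hasFDerivAt_integral_of_dominated_of_fderiv_le (hU.mem_nhds hu) (bound := b)
      (F' := fun u s => fderiv ℝ (F · s) u) ?_ (hF u hu) (hmeas u hu) ?_ hb ?_
    · filter_upwards [hU.mem_nhds hu] with v hv using (hF v hv).aestronglyMeasurable
    · filter_upwards [hsm] with s hs using hs.2
    · filter_upwards [hsm] with s hs v hv
      exact ((hs.1.contDiffAt (hU.mem_nhds hv)).differentiableAt one_ne_zero).hasFDerivAt
  · intro u hu
    refine ContinuousAt.continuousWithinAt ?_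
    refine continuousAt_of_dominated (bound := b) ?_ ?_ hb ?_
    · filter_upwards [hU.mem_nhds hu] with v hv using hmeas v hv
    · filter_upwards [hU.mem_nhds hu] with v hv
      filter_upwards [hsm] with s hs using hs.2 v hv
    · filter_upwards [hsm] with s hs
      exact (hs.1.continuousOn_fderiv_of_isOpen hU le_rfl).continuousAt (hU.mem_nhds hu)


set_option maxSynthPendingDepth 3 in
/-- Two-fold differentiation under the integral sign. -/
lemma contDiffOn_two_integral {E : Type*} [NormedAddCommGroup E] [NormedSpace ℝ E]
    [FiniteDimensional ℝ E] {F : E → 𝒮 → ℝ} {U : Set E} (hU : IsOpen U)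
    (hF : ∀ u ∈ U, Integrable (F u) P) {b : 𝒮 → ℝ} (hb : Integrable b P)
    (hsm : ∀ᵐ s ∂P, ContDiffOn ℝ 2 (F · s) U ∧ ∀ u ∈ U, ‖fderiv ℝ (F · s) u‖ ≤ b s ∧
      ‖fderiv ℝ (fderiv ℝ (F · s)) u‖ ≤ b s) :
    ContDiffOn ℝ 2 (fun u => ∫ s, F u s ∂P) U ∧ ∀ u ∈ U,
      Integrable (fun s => fderiv ℝ (F · s) u) P ∧
      fderiv ℝ (fun u => ∫ s, F u s ∂P) u = ∫ s, fderiv ℝ (F · s) u ∂P ∧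
      Integrable (fun s => fderiv ℝ (fderiv ℝ (F · s)) u) P ∧
      fderiv ℝ (fderiv ℝ (fun u => ∫ s, F u s ∂P)) u =
        ∫ s, fderiv ℝ (fderiv ℝ (F · s)) u ∂P := by
  obtain ⟨h1, h1'⟩ := contDiffOn_one_integral hU hF hb (by
    filter_upwards [hsm] with s hs
    exact ⟨hs.1.of_le (by norm_num), fun u hu => (hs.2 u hu).1⟩)
  obtain ⟨h2, h2'⟩ := contDiffOn_one_integral (F := fun u s => fderiv ℝ (F · s) u) hU
    (fun u hu => (h1 u hu).1) hb (by
    filter_upwards [hsm] with s hs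
    refine ⟨?_, fun u hu => (hs.2 u hu).2⟩
    have := hs.1
    rw [show (2 : WithTop ℕ∞) = 1 + 1 by norm_num, contDiffOn_succ_iff_fderiv_of_isOpen hU] at this
    exact this.2.2)
  have hd : ∀ u ∈ U, fderiv ℝ (fun u => ∫ s, F u s ∂P) u = ∫ s, fderiv ℝ (F · s) u ∂P :=
    fun u hu => (h1 u hu).2.fderiv
  have hdd : ∀ u ∈ U, HasFDerivAt (fderiv ℝ (fun u => ∫ s, F u s ∂P))
      (∫ s, fderiv ℝ (fderiv ℝ (F · s)) u ∂P) u := fun u hu =>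
    (h2 u hu).2.congr_of_eventuallyEq (by
      filter_upwards [hU.mem_nhds hu] with v hv using hd v hv)
  refine ⟨?_, fun u hu => ⟨(h1 u hu).1, hd u hu, (h2 u hu).1, (hdd u hu).fderiv⟩⟩
  rw [show (2 : WithTop ℕ∞) = 1 + 1 by norm_num, contDiffOn_succ_iff_fderiv_of_isOpen hU]
  refine ⟨fun u hu => (h1 u hu).2.differentiableAt.differentiableWithinAt, by simp, ?_⟩
  rw [show (1 : WithTop ℕ∞) = 0 + 1 by norm_num, contDiffOn_succ_iff_fderiv_of_isOpen hU]
  refine ⟨fun u hu => (hdd u hu).differentiableAt.differentiableWithinAt, by simp, ?_⟩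
  rw [contDiffOn_zero]
  exact h2'.congr fun u hu => (hdd u hu).fderiv

end ParametricIntegral

/-! ### Second order Taylor expansions and the second order condition. -/

section Taylor

variable {E : Type*} [NormedAddCommGroup E] [NormedSpace ℝ E]

/-- `B` is only required to approximate the increments of the gradient; it need be neither symmetric
nor the Hessian. The same lemma thus yields the small remainder near a point (`K = ε`) and the crude
bound on a whole ball (`K = 2 L`). -/
lemma norm_taylor_two_le {f : E → ℝ} {u₀ : E} {r K : ℝ}
    (hd : ∀ u ∈ Metric.ball u₀ r, DifferentiableAt ℝ f u) {B : E →L[ℝ] E →L[ℝ] ℝ}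
    (hK : ∀ u ∈ Metric.ball u₀ r, ‖fderiv ℝ f u - fderiv ℝ f u₀ - B (u - u₀)‖ ≤ K * ‖u - u₀‖)
    {h : E} (hh : ‖h‖ < r) :
    |f (u₀ + h) - f u₀ - fderiv ℝ f u₀ h - 2⁻¹ * B h h| ≤ K * ‖h‖ ^ 2 := by
  rcases eq_or_ne h 0 with rfl | hne
  · simp
  have hpos : 0 < ‖h‖ := norm_pos_iff.2 hne
  have hK0 : 0 ≤ K := by
    have := (norm_nonneg _).trans (hK (u₀ + h) (by simpa using hh))
    simp only [add_sub_cancel_left] at this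
    exact nonneg_of_mul_nonneg_left this hpos
  -- Along the segment, the derivative of this remainder is the approximation error of the gradient
  -- applied to `h`, hence at most `K * ‖h‖ ^ 2`; the mean value inequality concludes.
  let g : ℝ → ℝ := fun t => f (u₀ + t • h) - t * fderiv ℝ f u₀ h - 2⁻¹ * t ^ 2 * B h h
  have hmem : ∀ t ∈ Set.Icc (0 : ℝ) 1, u₀ + t • h ∈ Metric.ball u₀ r := by
    intro t ht
    rw [Metric.mem_ball, dist_eq_norm, add_sub_cancel_left, norm_smul, Real.norm_of_nonneg ht.1]
    nlinarith [ht.2]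
  have hg : ∀ t ∈ Set.Icc (0 : ℝ) 1, HasDerivWithinAt g
      ((fderiv ℝ f (u₀ + t • h) - fderiv ℝ f u₀ - B (u₀ + t • h - u₀)) h) (Set.Icc 0 1) t := by
    intro t ht
    have h1 : HasDerivAt (fun t : ℝ => u₀ + t • h) h t := by
      simpa using ((hasDerivAt_id t).smul_const h).const_add u₀
    have h2 := (hd _ (hmem t ht)).hasFDerivAt.comp_hasDerivAt t h1
    have h3 := (h2.sub ((hasDerivAt_id t).mul_const (fderiv ℝ f u₀ h))).sub
      ((((hasDerivAt_id t).pow 2).const_mul (2⁻¹ : ℝ)).mul_const (B h h))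
    refine (h3.congr_deriv ?_).hasDerivWithinAt
    simp
  have := (convex_Icc (0 : ℝ) 1).norm_image_sub_le_of_norm_hasDerivWithin_le (C := K * ‖h‖ ^ 2) hg
    (fun t ht => ?_) (Set.left_mem_Icc.2 zero_le_one) (Set.right_mem_Icc.2 zero_le_one)
  · have h5 : g 1 - g 0 = f (u₀ + h) - f u₀ - fderiv ℝ f u₀ h - 2⁻¹ * B h h := by
      simp [g]; ring
    rw [h5] at this
    simpa using this
  · refine (ContinuousLinearMap.le_opNorm _ _).trans ?_
    have h6 := hK _ (hmem t ht)
    have h7 : ‖u₀ + t • h - u₀‖ ≤ ‖h‖ := by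
      rw [add_sub_cancel_left, norm_smul, Real.norm_of_nonneg ht.1]
      nlinarith [ht.2]
    calc _ ≤ (K * ‖u₀ + t • h - u₀‖) * ‖h‖ := by gcongr
      _ ≤ (K * ‖h‖) * ‖h‖ := by gcongr
      _ = _ := by ring

/-- Second order expansion at a point of twice differentiability. -/
lemma eventually_taylor_two {f : E → ℝ} {u₀ : E} (hf : ContDiffAt ℝ 2 f u₀) {ε : ℝ} (hε : 0 < ε) :
    ∃ r > 0, ∀ h : E, ‖h‖ < r →
      |f (u₀ + h) - f u₀ - fderiv ℝ f u₀ h - 2⁻¹ * fderiv ℝ (fderiv ℝ f) u₀ h h| ≤ ε * ‖h‖ ^ 2 := by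
  have h2 : DifferentiableAt ℝ (fderiv ℝ f) u₀ :=
    (hf.fderiv_right (m := 1) (by norm_num)).differentiableAt one_ne_zero
  have h3 : ∀ᶠ u in 𝓝 u₀, DifferentiableAt ℝ f u := by
    have := hf.eventually (by simp)
    filter_upwards [this] with u hu using hu.differentiableAt two_ne_zero
  have h4 := (hasFDerivAt_iff_isLittleO.1 h2.hasFDerivAt).def hε
  obtain ⟨r, hr, hball⟩ := Metric.eventually_nhds_iff_ball.1 (h3.and h4)
  exact ⟨r, hr, fun h hh => norm_taylor_two_le (fun u hu => (hball u hu).1)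
    (fun u hu => (hball u hu).2) hh⟩

/-- The second order necessary condition at a minimum. -/
lemma fderiv_fderiv_nonneg_of_isLocalMin {f : E → ℝ} {u₀ : E} (hf : ContDiffAt ℝ 2 f u₀)
    (hmin : IsLocalMin f u₀) (h : E) : 0 ≤ fderiv ℝ (fderiv ℝ f) u₀ h h := by
  by_contra! hneg
  have hne : h ≠ 0 := by rintro rfl; simp at hneg
  have hpos : 0 < ‖h‖ := norm_pos_iff.2 hne
  set q := fderiv ℝ (fderiv ℝ f) u₀ h h
  -- This tolerance makes the error at `t • h` equal to half of the quadratic term `q t² / 2`, so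
  -- the value there falls below the minimum by at least `-q t² / 4`.
  obtain ⟨r, hr, hT⟩ := eventually_taylor_two hf (ε := -q / (4 * ‖h‖ ^ 2))
    (div_pos (by linarith) (by positivity))
  obtain ⟨r', hr', hmin'⟩ := Metric.eventually_nhds_iff_ball.1 hmin
  set t := min r r' / (2 * ‖h‖)
  have ht : 0 < t := by positivity
  have hth : ‖t • h‖ = min r r' / 2 := by
    rw [norm_smul, Real.norm_of_nonneg ht.le]; simp only [t]; field_simp
  have hlt : min r r' / 2 < min r r' := half_lt_self (by positivity)
  have h1 := hT (t • h) (by rw [hth]; exact hlt.trans_le (min_le_left _ _))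
  have h2 := hmin' (u₀ + t • h) (by
    rw [Metric.mem_ball, dist_eq_norm, add_sub_cancel_left, hth]
    exact hlt.trans_le (min_le_right _ _))
  rw [hmin.fderiv_eq_zero, norm_smul, mul_pow, Real.norm_of_nonneg ht.le] at h1
  simp only [_root_.zero_apply, map_smul, _root_.smul_apply, smul_eq_mul] at h1
  have h3 : -q / (4 * ‖h‖ ^ 2) * (t ^ 2 * ‖h‖ ^ 2) = -q * t ^ 2 / 4 := by field_simp
  rw [h3] at h1
  have h4 := (abs_le.1 h1).2
  have : 0 < t ^ 2 * (-q) := mul_pos (by positivity) (by linarith)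
  change _ - _ - 2⁻¹ * (t * (t * q)) ≤ _ at h4
  nlinarith

end Taylor

/-! ### Regularity of the matrix inverse, entry by entry. -/

section MatrixInverse

variable {E : Type*} [NormedAddCommGroup E] [NormedSpace ℝ E] {m : ℕ}

lemma differentiableAt_det {A : E → Matrix (Fin m) (Fin m) ℝ} {v : E}
    (hA : ∀ i j, DifferentiableAt ℝ (fun v => A v i j) v) :
    DifferentiableAt ℝ (fun v => (A v).det) v := by
  simp only [Matrix.det_apply']
  fun_prop

/-- By Cramer's rule the entries of the inverse are quotients of polynomials in the entries. -/
lemma differentiableAt_inv_apply {A : E → Matrix (Fin m) (Fin m) ℝ} {v : E}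
    (hA : ∀ i j, DifferentiableAt ℝ (fun v => A v i j) v) (hu : IsUnit (A v)) (i j : Fin m) :
    DifferentiableAt ℝ (fun v => (A v)⁻¹ i j) v := by
  have hadj : DifferentiableAt ℝ (fun v => (A v).adjugate i j) v := by
    simp only [Matrix.adjugate_apply]
    refine differentiableAt_det fun k l => ?_
    by_cases hk : k = j
    · subst hk; simp
    · simpa [Matrix.updateRow_ne hk] using hA k l
  have hdet : (A v).det ≠ 0 := ((Matrix.isUnit_iff_isUnit_det _).1 hu).ne_zero
  simp only [Matrix.inv_def, Ring.inverse_eq_inv', Matrix.smul_apply, smul_eq_mul]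
  exact ((differentiableAt_det hA).inv hdet).mul hadj

lemma measurable_det {α : Type*} [MeasurableSpace α] {A : α → Matrix (Fin m) (Fin m) ℝ}
    (hA : ∀ i j, Measurable (fun v => A v i j)) : Measurable (fun v => (A v).det) := by
  simp only [Matrix.det_apply']
  fun_prop

/-- No invertibility is needed: the inverse is the adjugate times the totalized reciprocal of the
determinant, and that reciprocal is measurable. This covers samples with a singular sample
covariance. -/
lemma measurable_inv_apply {α : Type*} [MeasurableSpace α] {A : α → Matrix (Fin m) (Fin m) ℝ}
    (hA : ∀ i j, Measurable (fun v => A v i j)) (i j : Fin m) :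
    Measurable (fun v => (A v)⁻¹ i j) := by
  have hadj : Measurable (fun v => (A v).adjugate i j) := by
    simp only [Matrix.adjugate_apply]
    refine measurable_det fun k l => ?_
    by_cases hk : k = j
    · subst hk; simp
    · simpa [Matrix.updateRow_ne hk] using hA k l
  simp only [Matrix.inv_def, Ring.inverse_eq_inv', Matrix.smul_apply, smul_eq_mul]
  exact (measurable_det hA).inv.mul hadj

lemma hasDerivAt_inv_apply {A : ℝ → Matrix (Fin m) (Fin m) ℝ} {A' : Matrix (Fin m) (Fin m) ℝ}
    {t : ℝ} (hA : ∀ i j, HasDerivAt (fun t => A t i j) (A' i j) t) (hu : IsUnit (A t))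
    (i j : Fin m) :
    HasDerivAt (fun t => (A t)⁻¹ i j) (-((A t)⁻¹ * A' * (A t)⁻¹) i j) t := by
  have hd : ∀ i j, DifferentiableAt ℝ (fun t => (A t)⁻¹ i j) t :=
    differentiableAt_inv_apply (fun i j => (hA i j).differentiableAt) hu
  set K' : Matrix (Fin m) (Fin m) ℝ := Matrix.of fun i j => deriv (fun t => (A t)⁻¹ i j) t
  have hdet : IsUnit (A t).det := (Matrix.isUnit_iff_isUnit_det _).1 hu
  have hev : ∀ᶠ s in 𝓝 t, A s * (A s)⁻¹ = 1 := by
    have := (differentiableAt_det fun i j => (hA i j).differentiableAt).continuousAt.eventually_ne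
      hdet.ne_zero
    filter_upwards [this] with s hs using Matrix.mul_nonsing_inv _ (isUnit_iff_ne_zero.2 hs)
  -- Differentiation of `A * A⁻¹ = 1`, which holds in a neighbourhood because the determinant stays
  -- nonzero.
  have hzero : A' * (A t)⁻¹ + A t * K' = 0 := by
    ext k l
    have h1 : HasDerivAt (fun s => ∑ j, A s k j * (A s)⁻¹ j l)
        (∑ j, (A' k j * (A t)⁻¹ j l + A t k j * K' j l)) t :=
      HasDerivAt.fun_sum fun j _ => (hA k j).mul (hd j l).hasDerivAt
    have h2 : (fun s => ∑ j, A s k j * (A s)⁻¹ j l) =ᶠ[𝓝 t] fun _ =>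
        (1 : Matrix (Fin m) (Fin m) ℝ) k l := by
      filter_upwards [hev] with s hs
      rw [← hs, Matrix.mul_apply]
    have h3 := (h1.congr_of_eventuallyEq h2.symm).unique (hasDerivAt_const t _)
    simpa [Matrix.mul_apply, Finset.sum_add_distrib] using h3
  have hK : K' = -((A t)⁻¹ * A' * (A t)⁻¹) := by
    have := congrArg (fun B => (A t)⁻¹ * B) hzero
    simp only [mul_add, mul_zero, ← mul_assoc, Matrix.nonsing_inv_mul _ hdet, one_mul] at this
    exact eq_neg_of_add_eq_zero_right this
  have := (hd i j).hasDerivAt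
  rwa [show deriv (fun t => (A t)⁻¹ i j) t = K' i j from rfl, hK] at this

end MatrixInverse

/-! ### The regression weight as a polynomial in the data. -/

section Weight

variable {m : ℕ}

lemma hasDerivAt_dotProduct_mulVec_inv {A : ℝ → Matrix (Fin m) (Fin m) ℝ}
    {A' : Matrix (Fin m) (Fin m) ℝ} {a b : ℝ → Fin m → ℝ} {a' b' : Fin m → ℝ} {t : ℝ}
    (hA : ∀ i j, HasDerivAt (fun t => A t i j) (A' i j) t) (hu : IsUnit (A t))
    (ha : ∀ i, HasDerivAt (fun t => a t i) (a' i) t)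
    (hb : ∀ i, HasDerivAt (fun t => b t i) (b' i) t) (x z : Fin m → ℝ) :
    HasDerivAt (fun t => (x - a t) ⬝ᵥ ((A t)⁻¹ *ᵥ (z - b t)))
      (-(a' ⬝ᵥ ((A t)⁻¹ *ᵥ (z - b t))) - (x - a t) ⬝ᵥ ((A t)⁻¹ *ᵥ b') -
        (x - a t) ⬝ᵥ (((A t)⁻¹ * A' * (A t)⁻¹) *ᵥ (z - b t))) t := by
  have h1 : HasDerivAt (fun t => ∑ i, (x i - a t i) * ∑ j, (A t)⁻¹ i j * (z j - b t j))
      (∑ i, (-a' i * (∑ j, (A t)⁻¹ i j * (z j - b t j)) + (x i - a t i) *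
        ∑ j, (-((A t)⁻¹ * A' * (A t)⁻¹) i j * (z j - b t j) + (A t)⁻¹ i j * (-b' j)))) t :=
    HasDerivAt.fun_sum fun i _ => ((ha i).const_sub (x i)).mul
      (HasDerivAt.fun_sum fun j _ => (hasDerivAt_inv_apply hA hu i j).mul ((hb j).const_sub (z j)))
  refine h1.congr_deriv ?_
  simp only [dotProduct, Matrix.mulVec, Pi.sub_apply]
  rw [← Finset.sum_neg_distrib, ← Finset.sum_sub_distrib, ← Finset.sum_sub_distrib]
  refine Finset.sum_congr rfl fun i _ => ?_
  rw [Finset.sum_add_distrib]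
  simp only [neg_mul, mul_neg, Finset.sum_neg_distrib]
  ring

lemma hasDerivAt_weight {S C : ℝ → Matrix (Fin m) (Fin m) ℝ} {dS dC : Matrix (Fin m) (Fin m) ℝ}
    {a b : ℝ → Fin m → ℝ} {da db : Fin m → ℝ} {t : ℝ}
    (hS : ∀ i j, HasDerivAt (fun t => S t i j) (dS i j) t) (hSu : IsUnit (S t))
    (hC : ∀ i j, HasDerivAt (fun t => C t i j) (dC i j) t) (hCu : IsUnit (C t))
    (ha : ∀ i, HasDerivAt (fun t => a t i) (da i) t)
    (hb : ∀ i, HasDerivAt (fun t => b t i) (db i) t) (x z y : Fin m → ℝ) :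
    HasDerivAt (fun t => weight (S t) (C t) (a t) (b t) x z y)
      (weightDeriv (S t) (C t) (a t) (b t) dS dC da db x z y) t := by
  refine (((hasDerivAt_dotProduct_mulVec_inv hS hSu ha ha x z).const_add 1).add
    (hasDerivAt_dotProduct_mulVec_inv hC hCu ha hb x y)).congr_deriv ?_
  simp only [weightDeriv]
  ring

/-- The vector `x` with a constant entry `1` adjoined. -/
def augment (x : Fin m → ℝ) : Option (Fin m) → ℝ := fun j => j.elim 1 x

/-- The monomials in `x`, `z`, `y` of which the regression weight is a linear combination. -/
def weightMonomial (x z y : Fin m → ℝ) (α : Bool × Option (Fin m) × Option (Fin m)) : ℝ :=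
  augment x α.2.1 * augment (bif α.1 then z else y) α.2.2

/-- The coefficients of `(x - a)ᵀ K (z - b)` as a polynomial in `x` and `z`. -/
def bilinCoef (K : Matrix (Fin m) (Fin m) ℝ) (a b : Fin m → ℝ) :
    Option (Fin m) → Option (Fin m) → ℝ
  | none, none => ∑ i, ∑ j, a i * K i j * b j
  | none, some j => -∑ i, a i * K i j
  | some i, none => -∑ j, K i j * b j
  | some i, some j => K i j

lemma sum_bilinCoef (K : Matrix (Fin m) (Fin m) ℝ) (a b x z : Fin m → ℝ) :
    ∑ j, ∑ k, bilinCoef K a b j k * (augment x j * augment z k) =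
      (x - a) ⬝ᵥ (K *ᵥ (z - b)) := by
  simp only [Fintype.sum_option, augment, bilinCoef, Option.elim, mul_one, one_mul, dotProduct,
    Matrix.mulVec, Pi.sub_apply]
  have h1 : ∑ j, (-∑ i, a i * K i j) * z j = -∑ i, ∑ j, a i * K i j * z j := by
    rw [Finset.sum_comm, ← Finset.sum_neg_distrib]
    refine Finset.sum_congr rfl fun j _ => ?_
    rw [neg_mul, Finset.sum_mul]
  rw [h1, ← Finset.sum_neg_distrib, ← Finset.sum_add_distrib, ← Finset.sum_add_distrib]
  refine Finset.sum_congr rfl fun i _ => ?_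
  have h2 : ∑ j, K i j * (x i * z j) = x i * ∑ j, K i j * z j := by
    rw [Finset.mul_sum]; exact Finset.sum_congr rfl fun j _ => by ring
  have h3 : ∀ w : Fin m → ℝ, ∑ j, a i * K i j * w j = a i * ∑ j, K i j * w j := fun w => by
    rw [Finset.mul_sum]; exact Finset.sum_congr rfl fun j _ => by ring
  simp only [h2, h3, mul_sub, Finset.sum_sub_distrib]
  ring

/-- The coefficients of the regression weight as a polynomial in `x`, `z`, `y`. -/
def weightCoef (S C : Matrix (Fin m) (Fin m) ℝ) (a b : Fin m → ℝ)
    (α : Bool × Option (Fin m) × Option (Fin m)) : ℝ :=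
  if α = (true, none, none) then 1 + bilinCoef S⁻¹ a a none none
  else bif α.1 then bilinCoef S⁻¹ a a α.2.1 α.2.2 else bilinCoef C⁻¹ a b α.2.1 α.2.2

/-- This separates parameters from data. Estimated parameters then affect only the finitely many
coefficients, while the monomials average by the law of large numbers. -/
lemma weight_eq_sum (S C : Matrix (Fin m) (Fin m) ℝ) (a b x z y : Fin m → ℝ) :
    weight S C a b x z y = ∑ α, weightCoef S C a b α * weightMonomial x z y α := by
  rw [weight, ← sum_bilinCoef, ← sum_bilinCoef]
  simp only [Fintype.sum_prod_type, Fintype.sum_bool, weightMonomial, weightCoef,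
    Fintype.sum_option]
  simp
  simp [augment]
  ring

lemma abs_augment_le (x : Fin m → ℝ) (j : Option (Fin m)) : |augment x j| ≤ 1 + ‖x‖ := by
  cases j with
  | none => simp [augment]
  | some j =>
    have := norm_le_pi_norm x j
    rw [Real.norm_eq_abs] at this
    simp only [augment, Option.elim]
    linarith

/-- The monomials have degree at most two, and `z` grows no faster than `x`; the resulting envelope
is the factor that appears in the moment condition on `L`. -/
lemma abs_weightMonomial_le {x z y : Fin m → ℝ} {c : ℝ} (hc : 0 ≤ c) (hz : ‖z‖ ≤ ‖x‖ + c)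
    (α : Bool × Option (Fin m) × Option (Fin m)) :
    |weightMonomial x z y α| ≤ 3 * (1 + c) * (1 + ‖x‖ ^ 2 + ‖y‖ ^ 2) := by
  have h1 := abs_augment_le x α.2.1
  have h2 : |augment (bif α.1 then z else y) α.2.2| ≤ (1 + c) * (1 + ‖x‖ + ‖y‖) := by
    have hx := norm_nonneg x
    have hy := norm_nonneg y
    refine (abs_augment_le _ _).trans ?_
    cases α.1 <;> simp <;> nlinarith
  rw [weightMonomial, abs_mul]
  calc _ ≤ (1 + ‖x‖) * ((1 + c) * (1 + ‖x‖ + ‖y‖)) := by gcongr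
    _ = (1 + c) * ((1 + ‖x‖) * (1 + ‖x‖ + ‖y‖)) := by ring
    _ ≤ (1 + c) * (3 * (1 + ‖x‖ ^ 2 + ‖y‖ ^ 2)) := by
      refine mul_le_mul_of_nonneg_left ?_ (by linarith)
      nlinarith [sq_nonneg (‖x‖ - 1), sq_nonneg (‖y‖ - 1), sq_nonneg (‖x‖ - ‖y‖),
        norm_nonneg x, norm_nonneg y]
    _ = _ := by ring

lemma differentiableAt_bilinCoef {E : Type*} [NormedAddCommGroup E] [NormedSpace ℝ E]
    {K : E → Matrix (Fin m) (Fin m) ℝ} {a b : E → Fin m → ℝ} {v : E}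
    (hK : ∀ i j, DifferentiableAt ℝ (fun v => K v i j) v)
    (ha : ∀ i, DifferentiableAt ℝ (fun v => a v i) v)
    (hb : ∀ i, DifferentiableAt ℝ (fun v => b v i) v) (j k : Option (Fin m)) :
    DifferentiableAt ℝ (fun v => bilinCoef (K v) (a v) (b v) j k) v := by
  cases j <;> cases k <;> simp only [bilinCoef] <;> fun_prop

lemma measurable_bilinCoef {E : Type*} [MeasurableSpace E]
    {K : E → Matrix (Fin m) (Fin m) ℝ} {a b : E → Fin m → ℝ}
    (hK : ∀ i j, Measurable (fun v => K v i j))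
    (ha : ∀ i, Measurable (fun v => a v i))
    (hb : ∀ i, Measurable (fun v => b v i)) (j k : Option (Fin m)) :
    Measurable (fun v => bilinCoef (K v) (a v) (b v) j k) := by
  cases j <;> cases k <;> simp only [bilinCoef] <;> fun_prop

lemma differentiableAt_weightCoef {E : Type*} [NormedAddCommGroup E] [NormedSpace ℝ E]
    {S C : E → Matrix (Fin m) (Fin m) ℝ} {a b : E → Fin m → ℝ} {v : E}
    (hS : ∀ i j, DifferentiableAt ℝ (fun v => S v i j) v) (hSu : IsUnit (S v))
    (hC : ∀ i j, DifferentiableAt ℝ (fun v => C v i j) v) (hCu : IsUnit (C v))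
    (ha : ∀ i, DifferentiableAt ℝ (fun v => a v i) v)
    (hb : ∀ i, DifferentiableAt ℝ (fun v => b v i) v)
    (α : Bool × Option (Fin m) × Option (Fin m)) :
    DifferentiableAt ℝ (fun v => weightCoef (S v) (C v) (a v) (b v) α) v := by
  have h1 := differentiableAt_bilinCoef (differentiableAt_inv_apply hS hSu) ha ha
  have h2 := differentiableAt_bilinCoef (differentiableAt_inv_apply hC hCu) ha hb
  unfold weightCoef
  split_ifs
  · exact (h1 _ _).const_add 1
  · cases α.1
    · exact h2 _ _
    · exact h1 _ _

lemma measurable_weightCoef {E : Type*} [MeasurableSpace E]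
    {S C : E → Matrix (Fin m) (Fin m) ℝ} {a b : E → Fin m → ℝ}
    (hS : ∀ i j, Measurable (fun v => S v i j)) (hC : ∀ i j, Measurable (fun v => C v i j))
    (ha : ∀ i, Measurable (fun v => a v i)) (hb : ∀ i, Measurable (fun v => b v i))
    (α : Bool × Option (Fin m) × Option (Fin m)) :
    Measurable (fun v => weightCoef (S v) (C v) (a v) (b v) α) := by
  have h1 := measurable_bilinCoef (measurable_inv_apply hS) ha ha
  have h2 := measurable_bilinCoef (measurable_inv_apply hC) ha hb
  unfold weightCoef
  split_ifs
  · exact (h1 _ _).const_add 1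
  · cases α.1
    · exact h2 _ _
    · exact h1 _ _

end Weight

/-! ### The weight coefficients as functions of first and second moments. -/

section Moments

variable {m : ℕ}

/-- The space of values of the first and second moments of a pair of vectors. -/
abbrev MomentSpace (m : ℕ) : Type :=
  (Fin m → Fin m → ℝ) × (Fin m → Fin m → ℝ) × (Fin m → ℝ) × (Fin m → ℝ)

/-- The products `x xᵀ`, `x yᵀ` together with `x` and `y`. -/
def moments (x y : Fin m → ℝ) : MomentSpace m :=
  (fun j k => x j * x k, fun j k => x j * y k, x, y)

/-- The covariance matrix with the given moments. -/
def momentCov (v : MomentSpace m) : Matrix (Fin m) (Fin m) ℝ :=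
  Matrix.of fun j k => v.1 j k - v.2.2.1 j * v.2.2.1 k

/-- The cross-covariance matrix with the given moments. -/
def momentCrossCov (v : MomentSpace m) : Matrix (Fin m) (Fin m) ℝ :=
  Matrix.of fun j k => v.2.1 j k - v.2.2.1 j * v.2.2.2 k

/-- The coefficients of the regression weight as a function of the moments. -/
def momentCoef (v : MomentSpace m) (α : Bool × Option (Fin m) × Option (Fin m)) : ℝ :=
  weightCoef (momentCov v) (momentCrossCov v) v.2.2.1 v.2.2.2 α

lemma differentiableAt_momentCoef {v : MomentSpace m} (hS : IsUnit (momentCov v))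
    (hC : IsUnit (momentCrossCov v)) (α : Bool × Option (Fin m) × Option (Fin m)) :
    DifferentiableAt ℝ (fun v : MomentSpace m => momentCoef v α) v := by
  refine differentiableAt_weightCoef (S := momentCov) (C := momentCrossCov) (a := fun v => v.2.2.1)
    (b := fun v => v.2.2.2) (fun i j => ?_) hS (fun i j => ?_) hC (fun i => ?_) (fun i => ?_) α
  · simp only [momentCov, Matrix.of_apply]; fun_prop
  · simp only [momentCrossCov, Matrix.of_apply]; fun_prop
  · fun_prop
  · fun_prop

lemma measurable_momentCoef (α : Bool × Option (Fin m) × Option (Fin m)) :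
    Measurable (fun v : MomentSpace m => momentCoef v α) := by
  refine measurable_weightCoef (S := momentCov) (C := momentCrossCov) (a := fun v => v.2.2.1)
    (b := fun v => v.2.2.2) (fun i j => ?_) (fun i j => ?_) (fun i => ?_) (fun i => ?_) α
  · simp only [momentCov, Matrix.of_apply]; fun_prop
  · simp only [momentCrossCov, Matrix.of_apply]; fun_prop
  · fun_prop
  · fun_prop

lemma measurable_moments : Measurable fun w : (Fin m → ℝ) × (Fin m → ℝ) => moments w.1 w.2 := by
  unfold moments
  fun_prop

lemma sampleCov_apply (n : ℕ) (x y : ℕ → Fin m → ℝ) (j k : Fin m) :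
    sampleCov n x y j k = (n : ℝ)⁻¹ * ∑ i ∈ Finset.range n, x i j * y i k -
      sampleMean n x j * sampleMean n y k := by
  rcases Nat.eq_zero_or_pos n with rfl | hn
  · simp [sampleCov, sampleMean]
  have hn' : (n : ℝ) ≠ 0 := by positivity
  have h1 : ∀ (x : ℕ → Fin m → ℝ) j, ∑ i ∈ Finset.range n, x i j = n * sampleMean n x j := by
    intro x j
    simp [sampleMean, hn']
  simp only [sampleCov, Matrix.smul_apply, Matrix.sum_apply, vecMulVec_apply, Pi.sub_apply,
    smul_eq_mul, sub_mul, mul_sub, Finset.sum_sub_distrib, ← Finset.mul_sum, ← Finset.sum_mul,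
    Finset.sum_const, Finset.card_range, nsmul_eq_mul]
  simp only [h1]
  field_simp
  ring

lemma mean_moments (n : ℕ) (x y : ℕ → Fin m → ℝ) :
    (n : ℝ)⁻¹ • ∑ i ∈ Finset.range n, moments (x i) (y i) =
      (fun j k => (n : ℝ)⁻¹ * ∑ i ∈ Finset.range n, x i j * x i k,
        fun j k => (n : ℝ)⁻¹ * ∑ i ∈ Finset.range n, x i j * y i k,
        sampleMean n x, sampleMean n y) := by
  refine Prod.ext ?_ (Prod.ext ?_ (Prod.ext ?_ ?_))
  · ext j k
    simp [moments, Prod.fst_sum, Finset.sum_apply]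
  · ext j k
    simp [moments, Prod.fst_sum, Prod.snd_sum, Finset.sum_apply]
  · simp [moments, Prod.fst_sum, Prod.snd_sum, sampleMean]
  · simp [moments, Prod.snd_sum, sampleMean]

/-- The estimated coefficients are a fixed function of an i.i.d. mean, because sample covariances
are sample moments minus products of sample means. -/
lemma momentCoef_mean (n : ℕ) (x y : ℕ → Fin m → ℝ) :
    momentCoef ((n : ℝ)⁻¹ • ∑ i ∈ Finset.range n, moments (x i) (y i)) =
      weightCoef (sampleCov n x x) (sampleCov n x y) (sampleMean n x) (sampleMean n y) := by
  have h1 : momentCov ((n : ℝ)⁻¹ • ∑ i ∈ Finset.range n, moments (x i) (y i)) =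
      sampleCov n x x := by
    ext j k
    rw [mean_moments, sampleCov_apply]
    simp [momentCov]
  have h2 : momentCrossCov ((n : ℝ)⁻¹ • ∑ i ∈ Finset.range n, moments (x i) (y i)) =
      sampleCov n x y := by
    ext j k
    rw [mean_moments, sampleCov_apply]
    simp [momentCrossCov]
  ext α
  rw [momentCoef, h1, h2, mean_moments]

/-- The effect of one observation on the coefficients of the weight. -/
lemma sum_fderiv_momentCoef {v : MomentSpace m} (hS : IsUnit (momentCov v))
    (hC : IsUnit (momentCrossCov v)) (x₀ y₀ x z y : Fin m → ℝ) :
    ∑ α, fderiv ℝ (fun v : MomentSpace m => momentCoef v α) v (moments x₀ y₀ - v) *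
        weightMonomial x z y α =
      weightDeriv (momentCov v) (momentCrossCov v) v.2.2.1 v.2.2.2
        (vecMulVec (x₀ - v.2.2.1) (x₀ - v.2.2.1) - momentCov v)
        (vecMulVec (x₀ - v.2.2.1) (y₀ - v.2.2.2) - momentCrossCov v)
        (x₀ - v.2.2.1) (y₀ - v.2.2.2) x z y := by
  set dv := moments x₀ y₀ - v
  -- The derivative along the line `v + t • dv` is computed twice, through the coefficients and
  -- through the weight; uniqueness of derivatives identifies the results.
  have hline : HasDerivAt (fun t : ℝ => v + t • dv) dv 0 := by
    simpa using ((hasDerivAt_id (0 : ℝ)).smul_const dv).const_add v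
  have h0 : v + (0 : ℝ) • dv = v := by simp
  have h1 : HasDerivAt (fun t : ℝ => ∑ α, momentCoef (v + t • dv) α * weightMonomial x z y α)
      (∑ α, fderiv ℝ (fun v : MomentSpace m =>
          momentCoef v α) v dv * weightMonomial x z y α) 0 := by
    refine HasDerivAt.fun_sum fun α _ => HasDerivAt.mul_const ?_ _
    have h2 := (differentiableAt_momentCoef hS hC α).hasFDerivAt
    rw [← h0] at h2
    have h3 := h2.comp_hasDerivAt (0 : ℝ) hline
    rw [h0] at h3
    exact h3
  have ha : ∀ i, HasDerivAt (fun t : ℝ => (v + t • dv).2.2.1 i) ((x₀ - v.2.2.1) i) 0 := fun i => by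
    have : HasDerivAt (fun t : ℝ => v.2.2.1 i + t * (x₀ i - v.2.2.1 i)) (x₀ i - v.2.2.1 i) 0 := by
      simpa using ((hasDerivAt_id (0 : ℝ)).mul_const (x₀ i - v.2.2.1 i)).const_add (v.2.2.1 i)
    exact this
  have hb : ∀ i, HasDerivAt (fun t : ℝ => (v + t • dv).2.2.2 i) ((y₀ - v.2.2.2) i) 0 := fun i => by
    have : HasDerivAt (fun t : ℝ => v.2.2.2 i + t * (y₀ i - v.2.2.2 i)) (y₀ i - v.2.2.2 i) 0 := by
      simpa using ((hasDerivAt_id (0 : ℝ)).mul_const (y₀ i - v.2.2.2 i)).const_add (v.2.2.2 i)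
    exact this
  have hM : ∀ i j, HasDerivAt (fun t : ℝ => (v + t • dv).1 i j) (x₀ i * x₀ j - v.1 i j) 0 :=
    fun i j => by
    have : HasDerivAt (fun t : ℝ => v.1 i j + t * (x₀ i * x₀ j - v.1 i j))
        (x₀ i * x₀ j - v.1 i j) 0 := by
      simpa using ((hasDerivAt_id (0 : ℝ)).mul_const (x₀ i * x₀ j - v.1 i j)).const_add (v.1 i j)
    exact this
  have hN : ∀ i j, HasDerivAt (fun t : ℝ => (v + t • dv).2.1 i j) (x₀ i * y₀ j - v.2.1 i j) 0 :=
    fun i j => by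
    have : HasDerivAt (fun t : ℝ => v.2.1 i j + t * (x₀ i * y₀ j - v.2.1 i j))
        (x₀ i * y₀ j - v.2.1 i j) 0 := by
      simpa using ((hasDerivAt_id (0 : ℝ)).mul_const (x₀ i * y₀ j - v.2.1 i j)).const_add
          (v.2.1 i j)
    exact this
  have h2 := hasDerivAt_weight (S := fun t : ℝ => momentCov (v + t • dv))
    (C := fun t : ℝ => momentCrossCov (v + t • dv)) (a := fun t : ℝ => (v + t • dv).2.2.1)
    (b := fun t : ℝ => (v + t • dv).2.2.2) (t := 0)
    (dS := vecMulVec (x₀ - v.2.2.1) (x₀ - v.2.2.1) - momentCov v)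
    (dC := vecMulVec (x₀ - v.2.2.1) (y₀ - v.2.2.2) - momentCrossCov v)
    (fun i j => ((hM i j).sub ((ha i).mul (ha j))).congr_deriv (by
      simp only [h0]; simp [momentCov, vecMulVec_apply]; ring)) (by rwa [h0])
    (fun i j => ((hN i j).sub ((ha i).mul (hb j))).congr_deriv (by
      simp only [h0]; simp [momentCrossCov, vecMulVec_apply]; ring)) (by rwa [h0])
    ha hb x z y
  simp only [h0] at h2
  refine h1.unique (h2.congr_of_eventuallyEq (Eventually.of_forall fun t => ?_))
  exact (weight_eq_sum _ _ _ _ _ _ _).symm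

lemma momentCov_integral {𝒮 : Type*} [MeasurableSpace 𝒮] {P : Measure 𝒮} [IsProbabilityMeasure P]
    {X Y : 𝒮 → Fin m → ℝ} (hX : MemLp X 2 P) (hY : MemLp Y 2 P) :
    Integrable (fun s => moments (X s) (Y s)) P ∧
    momentCov (∫ s, moments (X s) (Y s) ∂P) = popCov P X X ∧
    momentCrossCov (∫ s, moments (X s) (Y s) ∂P) = popCov P X Y ∧
    (∫ s, moments (X s) (Y s) ∂P).2.2.1 = popMean P X ∧
    (∫ s, moments (X s) (Y s) ∂P).2.2.2 = popMean P Y := by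
  have hXj : ∀ j, MemLp (fun s => X s j) 2 P := fun j => memLp_pi_iff.1 hX j
  have hYj : ∀ j, MemLp (fun s => Y s j) 2 P := fun j => memLp_pi_iff.1 hY j
  have hXX : ∀ j k, Integrable (fun s => X s j * X s k) P :=
      fun j k => (hXj j).integrable_mul (hXj k)
  have hXY : ∀ j k, Integrable (fun s => X s j * Y s k) P :=
      fun j k => (hXj j).integrable_mul (hYj k)
  have i1 : Integrable (fun s => fun j k => X s j * X s k) P :=
    Integrable.of_eval fun j => Integrable.of_eval fun k => hXX j k
  have i2 : Integrable (fun s => fun j k => X s j * Y s k) P :=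
    Integrable.of_eval fun j => Integrable.of_eval fun k => hXY j k
  have iX := hX.integrable one_le_two
  have iY := hY.integrable one_le_two
  have hint : ∫ s, moments (X s) (Y s) ∂P = (fun j k => ∫ s, X s j * X s k ∂P,
      fun j k => ∫ s, X s j * Y s k ∂P, popMean P X, popMean P Y) := by
    unfold moments
    rw [integral_pair i1 (i2.prodMk (iX.prodMk iY)), integral_pair i2 (iX.prodMk iY),
      integral_pair iX iY]
    refine Prod.ext ?_ (Prod.ext ?_ (Prod.ext ?_ ?_))
    · ext j k
      dsimp only
      rw [eval_integral (fun j => Integrable.of_eval fun k => hXX j k), eval_integral (hXX j)]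
    · ext j k
      dsimp only
      rw [eval_integral (fun j => Integrable.of_eval fun k => hXY j k), eval_integral (hXY j)]
    · ext j
      dsimp only
      rw [eval_integral fun j => (hXj j).integrable one_le_two]; rfl
    · ext j
      dsimp only
      rw [eval_integral fun j => (hYj j).integrable one_le_two]; rfl
  refine ⟨i1.prodMk (i2.prodMk (iX.prodMk iY)), ?_, ?_, ?_, ?_⟩
  · ext j k
    rw [hint]
    simp only [momentCov, popCov, Matrix.of_apply, popMean]
    rw [covariance_eq_sub (hXj j) (hXj k)]
    simp
  · ext j k
    rw [hint]
    simp only [momentCrossCov, popCov, Matrix.of_apply, popMean]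
    rw [covariance_eq_sub (hXj j) (hYj k)]
    simp
  · rw [hint]
  · rw [hint]

end Moments

/-! ### Measurable second order expansion of the squared distance at `ζ`. -/

section Expansion

variable {p : ℕ}

/-- The quadratic form of the matrix `B`. -/
def quadForm (B : Fin p → Fin p → ℝ) (h : EuclideanSpace ℝ (Fin p)) : ℝ :=
  ∑ i, ∑ j, h i * h j * B i j

lemma sum_single_smul (h : EuclideanSpace ℝ (Fin p)) :
    ∑ i, h i • EuclideanSpace.single i (1 : ℝ) = h := by
  have := (EuclideanSpace.basisFun (Fin p) ℝ).sum_repr h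
  simpa using this

lemma quadForm_eq_of_bilin (A : EuclideanSpace ℝ (Fin p) →L[ℝ] EuclideanSpace ℝ (Fin p) →L[ℝ] ℝ)
    (h : EuclideanSpace ℝ (Fin p)) :
    quadForm (fun i j => A (EuclideanSpace.single i 1) (EuclideanSpace.single j 1)) h = A h h := by
  have h1 : A h h = A (∑ i, h i • EuclideanSpace.single i (1 : ℝ))
      (∑ i, h i • EuclideanSpace.single i (1 : ℝ)) := by rw [sum_single_smul]
  rw [h1]
  simp only [map_smul, map_sum, _root_.sum_apply, _root_.smul_apply, smul_eq_mul, quadForm,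
    mul_assoc, Finset.mul_sum]
  rw [Finset.sum_comm]
  exact Finset.sum_congr rfl fun i _ => Finset.sum_congr rfl fun j _ => by ring

lemma continuous_quadForm (B : Fin p → Fin p → ℝ) : Continuous (quadForm B) := by
  unfold quadForm
  fun_prop

lemma inner_gradient_left {f : EuclideanSpace ℝ (Fin p) → ℝ} (u h : EuclideanSpace ℝ (Fin p)) :
    inner ℝ (gradient f u) h = fderiv ℝ f u h := by
  simp [gradient]

lemma norm_gradient (f : EuclideanSpace ℝ (Fin p) → ℝ) (u : EuclideanSpace ℝ (Fin p)) :
    ‖gradient f u‖ = ‖fderiv ℝ f u‖ := by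
  simp [gradient]

/-- In the symmetric second difference the first order terms cancel. It exhibits the Hessian as a
limit of functions measurable in the response. -/
lemma tendsto_second_difference {E : Type*} [NormedAddCommGroup E] [NormedSpace ℝ E]
    {f : E → ℝ} {u₀ : E} (hf : ContDiffAt ℝ 2 f u₀) (h : E) :
    Tendsto (fun k : ℕ => (k + 1 : ℝ) ^ 2 * (f (u₀ + (k + 1 : ℝ)⁻¹ • h) +
      f (u₀ + (k + 1 : ℝ)⁻¹ • (-h)) - 2 * f u₀)) atTop
      (𝓝 (fderiv ℝ (fderiv ℝ f) u₀ h h)) := by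
  rw [Metric.tendsto_nhds]
  intro ε hε
  -- The two Taylor errors add up to `δ * (2 * ‖h‖ ^ 2)` after rescaling; the `+ 1` makes this less
  -- than `ε` also for `h = 0`.
  set δ := ε / (2 * ‖h‖ ^ 2 + 1)
  have hδ : 0 < δ := by positivity
  obtain ⟨r, hr, hT⟩ := eventually_taylor_two hf hδ
  have h1 : Tendsto (fun k : ℕ => ‖(k + 1 : ℝ)⁻¹ • h‖) atTop (𝓝 0) := by
    have h1 : Tendsto (fun k : ℕ => (k + 1 : ℝ)⁻¹) atTop (𝓝 0) := by
      simpa using tendsto_one_div_add_atTop_nhds_zero_nat (𝕜 := ℝ)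
    simpa using (h1.smul_const h).norm
  filter_upwards [h1.eventually_lt_const hr] with k hk
  have hk' : (0 : ℝ) < k + 1 := by positivity
  have e1 := hT _ hk
  have e2 := hT ((k + 1 : ℝ)⁻¹ • (-h)) (by simpa using hk)
  simp only [norm_smul, norm_inv, map_smul, map_neg, _root_.smul_apply, _root_.neg_apply,
    smul_eq_mul, norm_neg, Real.norm_of_nonneg hk'.le] at e1 e2
  set q := fderiv ℝ (fderiv ℝ f) u₀ h h
  set d := fderiv ℝ f u₀ h
  set f1 := f (u₀ + (k + 1 : ℝ)⁻¹ • h)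
  set f2 := f (u₀ + (k + 1 : ℝ)⁻¹ • (-h))
  rw [Real.dist_eq]
  have e3 : |f1 + f2 - 2 * f u₀ - ((k + 1 : ℝ)⁻¹) ^ 2 * q| ≤
      2 * (δ * (((k + 1 : ℝ)⁻¹) * ‖h‖) ^ 2) := by
    rw [abs_le] at e1 e2 ⊢
    constructor <;> nlinarith [e1.1, e1.2, e2.1, e2.2]
  have e4 : (k + 1 : ℝ) ^ 2 * (f1 + f2 - 2 * f u₀) - q =
      (k + 1 : ℝ) ^ 2 * (f1 + f2 - 2 * f u₀ - ((k + 1 : ℝ)⁻¹) ^ 2 * q) := by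
    field_simp
  rw [e4, abs_mul, abs_of_pos (by positivity)]
  calc _ ≤ (k + 1 : ℝ) ^ 2 * (2 * (δ * (((k + 1 : ℝ)⁻¹) * ‖h‖) ^ 2)) := by gcongr
    _ = δ * (2 * ‖h‖ ^ 2) := by field_simp
    _ < δ * (2 * ‖h‖ ^ 2 + 1) := by gcongr; linarith
    _ = ε := by simp only [δ]; field_simp

variable {Ω : Type*} [MetricSpace Ω]

/-- The squared distance from `o` has at `ζ`, in the coordinates `φ`, the second order expansion
with gradient `g o` and Hessian `B o`; its relative error is at most `R k o` on the ball of radius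
`r / (k + 1)`, and everything is controlled by `L o`. -/
structure HasExpansion (φ : OpenPartialHomeomorph Ω (EuclideanSpace ℝ (Fin p))) (ζ : Ω)
    (L : Ω → ℝ) (r : ℝ) (g : Ω → EuclideanSpace ℝ (Fin p)) (B : Ω → Fin p → Fin p → ℝ)
    (R : ℕ → Ω → ℝ) (o : Ω) : Prop where
  norm_grad_le : ‖g o‖ ≤ L o
  abs_hess_le : ∀ i j, |B o i j| ≤ L o
  nonneg : ∀ k, 0 ≤ R k o
  le : ∀ k, R k o ≤ 2 * L o
  tendsto : Tendsto (fun k => R k o) atTop (𝓝 0)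
  expansion : ∀ (k : ℕ) (h : EuclideanSpace ℝ (Fin p)), ‖h‖ < r / (k + 1) →
    |inCoords φ (fun w => dist o w ^ 2) (φ ζ + h) - inCoords φ (fun w => dist o w ^ 2) (φ ζ) -
      inner ℝ (g o) h - 2⁻¹ * quadForm (B o) h| ≤ R k o * ‖h‖ ^ 2

/-- The quadratic term and the remainder are both `O(‖h‖ ^ 2)`, hence `o(‖h‖)`. -/
lemma HasExpansion.hasGradientAt {φ : OpenPartialHomeomorph Ω (EuclideanSpace ℝ (Fin p))} {ζ : Ω}
    {L : Ω → ℝ} {r : ℝ} (hr : 0 < r) {g : Ω → EuclideanSpace ℝ (Fin p)} {B : Ω → Fin p → Fin p → ℝ}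
    {R : ℕ → Ω → ℝ} {o : Ω} (h : HasExpansion φ ζ L r g B R o) :
    HasGradientAt (inCoords φ fun w => dist o w ^ 2) (g o) (φ ζ) := by
  rw [hasGradientAt_iff_hasFDerivAt, hasFDerivAt_iff_isLittleO_nhds_zero]
  have hq : (fun h => quadForm (B o) h) =O[𝓝 0] fun h => ‖h‖ ^ 2 := by
    refine Asymptotics.IsBigO.of_bound (∑ i, ∑ j, |B o i j|) (Eventually.of_forall fun v => ?_)
    rw [Real.norm_eq_abs, quadForm, Finset.sum_mul]
    refine (Finset.abs_sum_le_sum_abs _ _).trans (Finset.sum_le_sum fun i _ => ?_)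
    rw [Finset.sum_mul]
    refine (Finset.abs_sum_le_sum_abs _ _).trans (Finset.sum_le_sum fun j _ => ?_)
    have h1 : ∀ i, |v i| ≤ ‖v‖ := fun i => PiLp.norm_apply_le v i
    rw [abs_mul, abs_mul, norm_pow, norm_norm, mul_comm]
    calc _ ≤ |B o i j| * (‖v‖ * ‖v‖) := by gcongr <;> exact h1 _
      _ = _ := by ring
  have hR : (fun h => inCoords φ (fun w => dist o w ^ 2) (φ ζ + h) -
      inCoords φ (fun w => dist o w ^ 2) (φ ζ) - inner ℝ (g o) h - 2⁻¹ * quadForm (B o) h)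
      =O[𝓝 0] fun h => ‖h‖ ^ 2 := by
    refine Asymptotics.IsBigO.of_bound (R 0 o) ?_
    filter_upwards [Metric.ball_mem_nhds 0 hr] with v hv
    have := h.expansion 0 v (by simpa using hv)
    simpa using this
  have hsum := hR.add (hq.const_mul_left 2⁻¹)
  have h2 : (fun h : EuclideanSpace ℝ (Fin p) => ‖h‖ ^ 2) =o[𝓝 0] fun h => h := by
    exact Asymptotics.isLittleO_norm_pow_id one_lt_two
  refine (hsum.trans_isLittleO h2).congr_left fun v => ?_
  simp

variable {𝒮 : Type*} [MeasurableSpace 𝒮] {P : Measure 𝒮}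
  [SecondCountableTopology Ω] [MeasurableSpace Ω] [BorelSpace Ω]

/-- Smoothness is assumed only for the first response. Expressing the expansion through measurable
`g`, `B`, `R` makes its essential bounds a measurable event in `Ω`, which identical distribution
transfers to every response. -/
lemma exists_hasExpansion {O : ℕ → 𝒮 → Ω} (hO : ∀ i, Measurable (O i))
    (hident : ∀ i, IdentDistrib (O i) (O 0) P P) {ζ : Ω}
    {φ : OpenPartialHomeomorph Ω (EuclideanSpace ℝ (Fin p))}
    {U : Set (EuclideanSpace ℝ (Fin p))} (hU : IsOpen U) (hζU : φ ζ ∈ U) (hUφ : U ⊆ φ.target)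
    {L : Ω → ℝ} (hL : Measurable L)
    (hsmooth : ∀ᵐ s ∂P, ContDiffOn ℝ 2 (inCoords φ fun w => dist (O 0 s) w ^ 2) U ∧
      ∀ u ∈ U, ‖fderiv ℝ (inCoords φ fun w => dist (O 0 s) w ^ 2) u‖ ≤ L (O 0 s) ∧
        ‖fderiv ℝ (fderiv ℝ (inCoords φ fun w => dist (O 0 s) w ^ 2)) u‖ ≤ L (O 0 s)) :
    ∃ (r : ℝ) (g : Ω → EuclideanSpace ℝ (Fin p)) (B : Ω → Fin p → Fin p → ℝ) (R : ℕ → Ω → ℝ),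
      0 < r ∧ Metric.ball (φ ζ) r ⊆ U ∧ Measurable g ∧ Measurable B ∧ (∀ k, Measurable (R k)) ∧
      (∀ i, ∀ᵐ s ∂P, HasExpansion φ ζ L r g B R (O i s)) ∧
      (∀ᵐ s ∂P, distGrad φ ζ (O 0 s) = g (O 0 s)) ∧
      ∀ᵐ s ∂P, ∀ i j, fderiv ℝ (fderiv ℝ (inCoords φ fun w => dist (O 0 s) w ^ 2)) (φ ζ)
        (EuclideanSpace.single i 1) (EuclideanSpace.single j 1) = B (O 0 s) i j := by
  set f : Ω → EuclideanSpace ℝ (Fin p) → ℝ := fun o => inCoords φ fun w => dist o w ^ 2 with hf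
  have hfm : ∀ u, Measurable fun o => f o u := fun u => by
    simp only [hf, inCoords]
    exact (measurable_id.dist measurable_const).pow_const 2
  have hfc : ∀ o, ContinuousOn (f o) φ.target := fun o =>
    ((continuous_const.dist continuous_id).comp_continuousOn φ.continuousOn_symm).pow 2
  obtain ⟨r, hr, hrU⟩ := Metric.isOpen_iff.1 hU _ hζU
  have hC2 : ∀ᵐ s ∂P, ContDiffAt ℝ 2 (f (O 0 s)) (φ ζ) := by
    filter_upwards [hsmooth] with s hs using hs.1.contDiffAt (hU.mem_nhds hζU)
  -- gradient
  obtain ⟨g, hgm, hg⟩ := exists_measurable_rep_of_tendsto (P := P) (hO 0)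
    (f := fun (k : ℕ) o => WithLp.toLp 2 fun j : Fin p => (k + 1 : ℝ) *
      (f o (φ ζ + (k + 1 : ℝ)⁻¹ • EuclideanSpace.single j (1 : ℝ)) - f o (φ ζ)))
    (l := fun s => distGrad φ ζ (O 0 s)) (fun k => by fun_prop) (by
      filter_upwards [hC2] with s hs
      have h1 : ∀ j, Tendsto (fun k : ℕ => (k + 1 : ℝ) *
          (f (O 0 s) (φ ζ + (k + 1 : ℝ)⁻¹ • EuclideanSpace.single j (1 : ℝ)) - f (O 0 s) (φ ζ)))
          atTop (𝓝 (distGrad φ ζ (O 0 s) j)) := by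
        intro j
        have h2 := (hs.differentiableAt two_ne_zero).hasFDerivAt.lim
          (EuclideanSpace.single j (1 : ℝ)) (c := fun k : ℕ => (k + 1 : ℝ)) (l := atTop)
          (tendsto_norm_atTop_atTop.comp (tendsto_atTop_add_const_right _ _
            tendsto_natCast_atTop_atTop))
        have h3 : distGrad φ ζ (O 0 s) j =
            fderiv ℝ (f (O 0 s)) (φ ζ) (EuclideanSpace.single j (1 : ℝ)) := by
          rw [← inner_gradient_left, EuclideanSpace.inner_single_right]
          simp [distGrad, hf]
        rw [h3]
        exact h2
      have h4 := (PiLp.continuous_toLp 2 (fun _ : Fin p => ℝ)).tendsto (distGrad φ ζ (O 0 s)).ofLp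
      exact h4.comp (tendsto_pi_nhds.2 h1))
  -- Hessian
  obtain ⟨B, hBm, hB⟩ := exists_measurable_rep_of_tendsto (P := P) (hO 0)
    (f := fun (k : ℕ) o => fun i j : Fin p =>
      -- Second differences approximate the quadratic form; polarization and symmetry of the second
      -- derivative recover the mixed entries.
      let Q : EuclideanSpace ℝ (Fin p) → ℝ := fun h => (k + 1 : ℝ) ^ 2 *
        (f o (φ ζ + (k + 1 : ℝ)⁻¹ • h) + f o (φ ζ + (k + 1 : ℝ)⁻¹ • (-h)) - 2 * f o (φ ζ))
      2⁻¹ * (Q (EuclideanSpace.single i (1 : ℝ) + EuclideanSpace.single j (1 : ℝ)) -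
        Q (EuclideanSpace.single i (1 : ℝ)) - Q (EuclideanSpace.single j (1 : ℝ))))
    (l := fun s => fun i j : Fin p => fderiv ℝ (fderiv ℝ (f (O 0 s))) (φ ζ)
        (EuclideanSpace.single i 1) (EuclideanSpace.single j 1)) (fun k => by fun_prop) (by
      filter_upwards [hC2] with s hs
      refine tendsto_pi_nhds.2 fun i => tendsto_pi_nhds.2 fun j => ?_
      have h1 := tendsto_second_difference hs
      have h2 := (((h1 (EuclideanSpace.single i (1 : ℝ) + EuclideanSpace.single j (1 : ℝ))).sub
        (h1 (EuclideanSpace.single i (1 : ℝ)))).sub (h1 (EuclideanSpace.single j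
            (1 : ℝ)))).const_mul
        (2⁻¹ : ℝ)
      have h3 := hs.isSymmSndFDerivAt (by simp) (EuclideanSpace.single i (1 : ℝ))
        (EuclideanSpace.single j (1 : ℝ))
      convert h2 using 2
      simp only [map_add, _root_.add_apply]
      rw [h3]
      ring)
  -- remainder
  let ρ : Ω → EuclideanSpace ℝ (Fin p) → ℝ := fun o h => f o (φ ζ + h) - f o (φ ζ) -
    inner ℝ (g o) h - 2⁻¹ * quadForm (B o) h
  have hρm : ∀ h, Measurable fun o => ρ o h := fun h => by
    have h1 : Measurable fun o => quadForm (B o) h := by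
      unfold quadForm
      fun_prop
    have h2 : Measurable fun o => inner ℝ (g o) h := hgm.inner_const
    exact (((hfm _).sub (hfm _)).sub h2).sub (h1.const_mul _)
  have hρc : ∀ o h, ‖h‖ < r → ContinuousAt (ρ o) h := fun o h hh => by
    have hmem : φ ζ + h ∈ φ.target := hUφ (hrU (by simpa using hh))
    have h1 : ContinuousAt (fun h => f o (φ ζ + h)) h :=
      ((hfc o).continuousAt (φ.open_target.mem_nhds hmem)).comp_of_eq (by fun_prop) rfl
    have h2 := (continuous_quadForm (B o)).continuousAt (x := h)
    exact ((h1.sub continuousAt_const).sub (by fun_prop)).sub (h2.const_mul _)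
  let d := TopologicalSpace.denseSeq (EuclideanSpace ℝ (Fin p))
  -- The best relative remainder is taken over a dense sequence so that it is measurable, and in
  -- `ENNReal` so that the supremum always exists. A zero term of the sequence contributes zero.
  let R' : ℕ → Ω → ENNReal := fun k o => ⨆ n, if ‖d n‖ < r / (k + 1) then
    ENNReal.ofReal (|ρ o (d n)| / ‖d n‖ ^ 2) else 0
  have hR'm : ∀ k, Measurable (R' k) := fun k => by
    refine Measurable.iSup fun n => ?_
    split_ifs
    · have := hρm (d n)
      fun_prop
    · exact measurable_const
  have hR'le : ∀ (k : ℕ) o (c : ℝ), (∀ h, ‖h‖ < r / (k + 1) → |ρ o h| ≤ c * ‖h‖ ^ 2) → 0 ≤ c →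
      R' k o ≤ ENNReal.ofReal c := by
    intro k o c hc hc0
    refine iSup_le fun n => ?_
    split_ifs with hn
    · refine ENNReal.ofReal_le_ofReal ?_
      exact div_le_of_le_mul₀ (by positivity) hc0 (hc _ hn)
    · exact zero_le
  have hrk : ∀ k : ℕ, r / (k + 1) ≤ r :=
      fun k => div_le_self hr.le (by linarith [k.cast_nonneg (α := ℝ)])
  have hR'exp : ∀ (k : ℕ) o, R' k o ≠ ⊤ → ∀ h, ‖h‖ < r / (k + 1) →
      |ρ o h| ≤ (R' k o).toReal * ‖h‖ ^ 2 := by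
    intro k o htop h hh
    rcases eq_or_ne h 0 with rfl | hne
    · simp [ρ, quadForm]
    have hpos : 0 < ‖h‖ := norm_pos_iff.2 hne
    rw [← div_le_iff₀ (by positivity)]
    -- A violation at `h ≠ 0` persists in a neighbourhood by continuity, so it would occur at a
    -- point of the dense sequence.
    by_contra! hlt
    have hc : ContinuousAt (fun h => |ρ o h| / ‖h‖ ^ 2) h :=
      ((hρc o h (hh.trans_le (hrk k))).abs).div (by fun_prop) (by positivity)
    have hev : ∀ᶠ h' in 𝓝 h, (R' k o).toReal < |ρ o h'| / ‖h'‖ ^ 2 ∧ ‖h'‖ < r / (k + 1) :=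
      (hc.eventually_const_lt hlt).and (continuous_norm.continuousAt.eventually_lt_const hh)
    obtain ⟨n, hn1, hn2⟩ := (TopologicalSpace.denseRange_denseSeq _).exists_mem_open
      isOpen_interior ⟨h, mem_interior_iff_mem_nhds.2 hev⟩ |>.imp fun n hn => interior_subset hn
    have h1 : ENNReal.ofReal (|ρ o (d n)| / ‖d n‖ ^ 2) ≤ R' k o := by
      have := le_iSup (fun n => if ‖d n‖ < r / (k + 1) then
        ENNReal.ofReal (|ρ o (d n)| / ‖d n‖ ^ 2) else 0) n
      simpa only [if_pos (show ‖d n‖ < r / (k + 1) from hn2)] using this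
    have h2 := ENNReal.toReal_mono htop h1
    rw [ENNReal.toReal_ofReal (by positivity)] at h2
    exact absurd hn1 (not_lt.2 h2)
  -- the good set
  let good : Set Ω := {o | ‖g o‖ ≤ L o} ∩ {o | ∀ i j, |B o i j| ≤ L o} ∩
    {o | ∀ k, R' k o ≤ ENNReal.ofReal (2 * L o)} ∩ {o | Tendsto (fun k => R' k o) atTop (𝓝 0)}
  have hgood : MeasurableSet good := by
    refine (((measurableSet_le hgm.norm hL).inter ?_).inter ?_).inter
      (measurableSet_tendsto _ hR'm)
    · simp only [Set.ofPred_forall]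
      refine MeasurableSet.iInter fun i => MeasurableSet.iInter fun j => ?_
      exact measurableSet_le (by fun_prop) hL
    · simp only [Set.ofPred_forall]
      refine MeasurableSet.iInter fun k => ?_
      exact measurableSet_le (hR'm k) (by fun_prop)
  have hmem0 : ∀ᵐ s ∂P, O 0 s ∈ good := by
    filter_upwards [hsmooth, hg, hB, hC2] with s hs hgs hBs hcs
    have hL0 : 0 ≤ L (O 0 s) := (norm_nonneg _).trans (hs.2 _ hζU).1
    have hinner : ∀ h, inner ℝ (g (O 0 s)) h = fderiv ℝ (f (O 0 s)) (φ ζ) h := fun h => by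
      rw [← hgs, distGrad, inner_gradient_left]
    have hquad : ∀ h, quadForm (B (O 0 s)) h = fderiv ℝ (fderiv ℝ (f (O 0 s))) (φ ζ) h h :=
      fun h => by rw [← hBs, quadForm_eq_of_bilin]
    have hconv : Convex ℝ (Metric.ball (φ ζ) r) := convex_ball _ _
    have hdd : ∀ u ∈ U, DifferentiableAt ℝ (fderiv ℝ (f (O 0 s))) u := fun u hu =>
      ((hs.1.contDiffAt (hU.mem_nhds hu)).fderiv_right (m := 1) (by norm_num)).differentiableAt
        one_ne_zero
    refine ⟨⟨⟨?_, ?_⟩, ?_⟩, ?_⟩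
    · change ‖g (O 0 s)‖ ≤ _
      rw [← hgs, distGrad, norm_gradient]
      exact (hs.2 _ hζU).1
    · intro i j
      rw [← hBs]
      have h1 := ContinuousLinearMap.le_opNorm₂ (fderiv ℝ (fderiv ℝ (f (O 0 s))) (φ ζ))
        (EuclideanSpace.single i 1) (EuclideanSpace.single j 1)
      simp only [PiLp.norm_single, norm_one, mul_one] at h1
      exact h1.trans (hs.2 _ hζU).2
    · intro k
      -- One `L` bounds the increment of the gradient by the mean value inequality, the other its
      -- linear approximation by the Hessian.
      refine hR'le k _ _ (fun h hh => ?_) (by positivity)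
      simp only [ρ, hinner, hquad]
      refine norm_taylor_two_le (r := r) (fun u hu => ?_) (fun u hu => ?_)
        (hh.trans_le (hrk k))
      · exact (hs.1.contDiffAt (hU.mem_nhds (hrU hu))).differentiableAt two_ne_zero
      · have h1 := hconv.norm_image_sub_le_of_norm_fderiv_le (𝕜 := ℝ) (f := fderiv ℝ (f (O 0 s)))
          (fun u hu => hdd u (hrU hu)) (fun u hu => (hs.2 u (hrU hu)).2)
          (Metric.mem_ball_self hr) hu
        calc _ ≤ ‖fderiv ℝ (f (O 0 s)) u - fderiv ℝ (f (O 0 s)) (φ ζ)‖ +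
              ‖fderiv ℝ (fderiv ℝ (f (O 0 s))) (φ ζ) (u - φ ζ)‖ := norm_sub_le _ _
          _ ≤ L (O 0 s) * ‖u - φ ζ‖ + L (O 0 s) * ‖u - φ ζ‖ := by
            refine add_le_add h1 ((ContinuousLinearMap.le_opNorm _ _).trans ?_)
            gcongr
            exact (hs.2 _ hζU).2
          _ = _ := by ring
    · change Tendsto (fun k => R' k (O 0 s)) atTop (𝓝 0)
      rw [ENNReal.tendsto_nhds_zero]
      intro ε hε
      obtain ⟨δ, hδ, hδε⟩ : ∃ δ : ℝ, 0 < δ ∧ ENNReal.ofReal δ ≤ ε := by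
        rcases eq_or_ne ε ⊤ with rfl | h
        · exact ⟨1, one_pos, le_top⟩
        · exact ⟨ε.toReal, ENNReal.toReal_pos hε.ne' h, (ENNReal.ofReal_toReal h).le⟩
      obtain ⟨r', hr', hT⟩ := eventually_taylor_two hcs hδ
      have hlim : Tendsto (fun k : ℕ => r / (k + 1 : ℝ)) atTop (𝓝 0) := by
        simpa [div_eq_mul_inv] using (tendsto_one_div_add_atTop_nhds_zero_nat (𝕜 := ℝ)).const_mul r
      filter_upwards [hlim.eventually_lt_const hr'] with k hk
      refine (hR'le k _ δ (fun h hh => ?_) hδ.le).trans hδε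
      simp only [ρ, hinner, hquad]
      exact hT h (hh.trans hk)
  have hmem : ∀ i, ∀ᵐ s ∂P, O i s ∈ good := fun i =>
    (hident i).symm.ae_mem_snd hgood hmem0
  refine ⟨r, g, B, fun k o => (R' k o).toReal, hr, hrU, hgm, hBm, fun k => (hR'm k).ennreal_toReal,
    fun i => ?_, hg, ?_⟩
  · filter_upwards [hmem i] with s hs
    have hL0 : 0 ≤ L (O i s) := (norm_nonneg _).trans hs.1.1.1
    have htop : ∀ k, R' k (O i s) ≠ ⊤ :=
        fun k => ne_top_of_le_ne_top ENNReal.ofReal_ne_top (hs.1.2 k)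
    refine ⟨hs.1.1.1, hs.1.1.2, fun k => ENNReal.toReal_nonneg, fun k => ?_, ?_, fun k h hh =>
      hR'exp k _ (htop k) h hh⟩
    · exact ENNReal.toReal_le_of_le_ofReal (by positivity) (hs.1.2 k)
    · exact (ENNReal.tendsto_toReal ENNReal.zero_ne_top).comp hs.2
  · filter_upwards [hB] with s hs i j
    rw [← hs]

end Expansion

/-! ### A law of large numbers uniform over the metric space. -/

section UniformLLN

variable {𝒮 𝒟 : Type*} [MeasurableSpace 𝒮] [MeasurableSpace 𝒟] {P : Measure 𝒮}

lemma ae_tendsto_mean_comp {W : Type*} [NormedAddCommGroup W] [NormedSpace ℝ W] [CompleteSpace W]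
    [MeasurableSpace W] [BorelSpace W] {D : ℕ → 𝒮 → 𝒟} (hindep : iIndepFun D P)
    (hident : ∀ i, IdentDistrib (D i) (D 0) P P) {q : 𝒟 → W} (hq : Measurable q)
    (hint : Integrable (fun s => q (D 0 s)) P) :
    ∀ᵐ s ∂P, Tendsto (fun n : ℕ => (n : ℝ)⁻¹ • ∑ i ∈ Finset.range n, q (D i s)) atTop
      (𝓝 (∫ s, q (D 0 s) ∂P)) :=
  ae_tendsto_mean (V := fun i s => q (D i s)) hint (hindep.comp (fun _ => q) fun _ => hq)
    fun i => (hident i).comp hq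

variable {Ω : Type*} [MetricSpace Ω]

/-- The bound does not depend on `v`; it is what replaces compactness in the uniform law. -/
lemma abs_dist_sq_sub_dist_sq_le {M : ℝ} (hM : ∀ o w : Ω, dist o w ^ 2 ≤ M) (o o' v : Ω) :
    |dist o v ^ 2 - dist o' v ^ 2| ≤ 2 * √M * dist o o' := by
  have h1 : ∀ o w : Ω, dist o w ≤ √M := fun o w => Real.le_sqrt_of_sq_le (hM o w)
  rw [sq_sub_sq, abs_mul]
  have h2 : |dist o v + dist o' v| ≤ 2 * √M := by
    rw [abs_of_nonneg (by positivity)]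
    linarith [h1 o v, h1 o' v]
  exact mul_le_mul h2 (abs_dist_sub_le o o' v) (abs_nonneg _) (by positivity)

variable [SecondCountableTopology Ω] [MeasurableSpace Ω] [BorelSpace Ω]

/-- A uniform strong law of large numbers for weighted squared distances. -/
lemma ae_uniform_mean_dist_sq [IsProbabilityMeasure P] [Nonempty Ω] {M : ℝ}
    (hM : ∀ o w : Ω, dist o w ^ 2 ≤ M) {D : ℕ → 𝒮 → 𝒟} (hD : ∀ i, Measurable (D i))
    (hindep : iIndepFun D P) (hident : ∀ i, IdentDistrib (D i) (D 0) P P)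
    {o : 𝒟 → Ω} (ho : Measurable o) {q : 𝒟 → ℝ} (hq : Measurable q)
    (hint : Integrable (fun s => q (D 0 s)) P) :
    ∀ᵐ s ∂P, ∀ ε > 0, ∀ᶠ n : ℕ in atTop, ∀ v : Ω,
      |(n : ℝ)⁻¹ * ∑ i ∈ Finset.range n, q (D i s) * dist (o (D i s)) v ^ 2 -
        ∫ s, q (D 0 s) * dist (o (D 0 s)) v ^ 2 ∂P| ≤ ε := by
  have hM0 : 0 ≤ M := (sq_nonneg _).trans (hM (Classical.arbitrary Ω) (Classical.arbitrary Ω))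
  let e := TopologicalSpace.denseSeq Ω
  -- `π N` sends a point to a nearest one among finitely many terms of a dense sequence.
  let π : ℕ → SimpleFunc Ω Ω := fun N => SimpleFunc.nearestPt e N
  have hπ : ∀ x, Tendsto (fun N => π N x) atTop (𝓝 x) := fun x =>
    SimpleFunc.tendsto_nearestPt (by simp [e,
        (TopologicalSpace.denseRange_denseSeq Ω).closure_range])
  -- the approximation error
  let err : ℕ → 𝒟 → ℝ := fun N d => |q d| * (2 * √M * dist (o d) (π N (o d)))
  have herrm : ∀ N, Measurable (err N) := fun N => by
    have h1 : Measurable fun d => π N (o d) := (π N).measurable.comp ho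
    exact hq.abs.mul ((ho.dist h1).const_mul _)
  have herrle : ∀ N d, |err N d| ≤ |q d| * (2 * √M * √M) := fun N d => by
    rw [abs_of_nonneg (by positivity)]
    have := Real.le_sqrt_of_sq_le (hM (o d) (π N (o d)))
    simp only [err]
    gcongr
  have hbound : Integrable (fun s => |q (D 0 s)| * (2 * √M * √M)) P := hint.abs.mul_const _
  have herri : ∀ N, Integrable (fun s => err N (D 0 s)) P := fun N =>
    hbound.mono' ((herrm N).comp (hD 0)).aestronglyMeasurable (ae_of_all _ fun s => herrle N _)
  have herr0 : Tendsto (fun N => ∫ s, err N (D 0 s) ∂P) atTop (𝓝 0) := by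
    have h1 := tendsto_integral_of_dominated_convergence (μ := P) (F := fun N s => err N (D 0 s))
      (f := fun _ => (0 : ℝ)) (fun s => |q (D 0 s)| * (2 * √M * √M))
      (fun N => (herri N).aestronglyMeasurable) hbound
      (fun N => ae_of_all _ fun s => herrle N _) (ae_of_all _ fun s => by
        have h2 : Tendsto (fun N => dist (o (D 0 s)) (π N (o (D 0 s)))) atTop (𝓝 0) := by
          simpa using (tendsto_const_nhds (x := o (D 0 s))).dist (hπ (o (D 0 s)))
        simpa using (h2.const_mul (2 * √M)).const_mul |q (D 0 s)|)
    simpa using h1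
  -- the cells
  let cell : ℕ → Ω → 𝒟 → ℝ := fun N x d => ((π N) ⁻¹' {x}).indicator (fun _ => q d) (o d)
  have hcelleq : ∀ N x, cell N x = (o ⁻¹' ((π N) ⁻¹' {x})).indicator q := fun N x => by
    ext d; simp only [cell, Set.indicator]; rfl
  have hcellset : ∀ N x, MeasurableSet (o ⁻¹' ((π N) ⁻¹' {x})) := fun N x =>
    ho ((π N).measurableSet_fiber x)
  have hcellm : ∀ N x, Measurable (cell N x) := fun N x => by
    rw [hcelleq]; exact hq.indicator (hcellset N x)
  have hcelli : ∀ N x, Integrable (fun s => cell N x (D 0 s)) P := fun N x => by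
    refine hint.mono ((hcellm N x).comp (hD 0)).aestronglyMeasurable (ae_of_all _ fun s => ?_)
    rw [hcelleq]
    exact norm_indicator_le_norm_self _ _
  -- After discretization the family indexed by `v` is spanned by finitely many functions of the
  -- data, with coefficients bounded by `M`.
  have hdecomp : ∀ N d v, q d * dist (π N (o d)) v ^ 2 =
      ∑ x ∈ (π N).range, dist x v ^ 2 * cell N x d := fun N d v => by
    rw [Finset.sum_eq_single (π N (o d))]
    · simp [cell, mul_comm]
    · intro x _ hx
      have : o d ∉ (π N) ⁻¹' {x} := fun h => hx (by simpa using h.symm)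
      simp [cell, Set.indicator_of_notMem this]
    · intro h
      exact absurd (SimpleFunc.mem_range_self _ _) h
  have h1 : ∀ᵐ s ∂P, ∀ N, Tendsto (fun n : ℕ => (n : ℝ)⁻¹ * ∑ i ∈ Finset.range n, err N (D i s))
      atTop (𝓝 (∫ s, err N (D 0 s) ∂P)) := ae_all_iff.2 fun N =>
    ae_tendsto_mean_comp hindep hident (herrm N) (herri N)
  have h2 : ∀ᵐ s ∂P, ∀ N, ∀ x ∈ (π N).range,
      Tendsto (fun n : ℕ => (n : ℝ)⁻¹ * ∑ i ∈ Finset.range n, cell N x (D i s))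
      atTop (𝓝 (∫ s, cell N x (D 0 s) ∂P)) := ae_all_iff.2 fun N =>
    (ae_ball_iff (π N).range.countable_toSet).2 fun x _ =>
      ae_tendsto_mean_comp hindep hident (hcellm N x) (hcelli N x)
  filter_upwards [h1, h2] with s hs1 hs2 ε hε
  -- The discretization is fixed before the sample size. Three errors of `ε / 4` arise: the
  -- empirical and population discretization errors and the finite-dimensional deviation.
  obtain ⟨N, hN⟩ := (herr0.eventually_lt_const (show 0 < ε / 4 by positivity)).exists
  have hsum : Tendsto (fun n : ℕ => ∑ x ∈ (π N).range, M * |(n : ℝ)⁻¹ *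
      ∑ i ∈ Finset.range n, cell N x (D i s) - ∫ s, cell N x (D 0 s) ∂P|) atTop (𝓝 0) := by
    have : Tendsto (fun n : ℕ => ∑ x ∈ (π N).range, M * |(n : ℝ)⁻¹ *
      ∑ i ∈ Finset.range n, cell N x (D i s) - ∫ s, cell N x (D 0 s) ∂P|) atTop
      (𝓝 (∑ x ∈ (π N).range, M * |∫ s, cell N x (D 0 s) ∂P - ∫ s, cell N x (D 0 s) ∂P|)) :=
      tendsto_finsetSum _ fun x hx => (((hs2 N x hx).sub_const _).abs).const_mul _
    simpa using this
  filter_upwards [(hs1 N).eventually_lt_const hN,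
    hsum.eventually_lt_const (show 0 < ε / 4 by positivity)] with n hn1 hn2 v
  have hq2 : Integrable (fun s => q (D 0 s) * dist (o (D 0 s)) v ^ 2) P := by
    refine (hint.abs.mul_const M).mono' ?_ (ae_of_all _ fun s => ?_)
    · have : Measurable fun d => q d * dist (o d) v ^ 2 :=
        hq.mul ((ho.dist measurable_const).pow_const 2)
      exact (this.comp (hD 0)).aestronglyMeasurable
    · rw [norm_mul, Real.norm_eq_abs, Real.norm_of_nonneg (by positivity)]
      have := hM (o (D 0 s)) v
      gcongr
  have hπi : Integrable (fun s => q (D 0 s) * dist (π N (o (D 0 s))) v ^ 2) P := by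
    simp only [hdecomp]
    exact integrable_finsetSum _ fun x _ => (hcelli N x).const_mul _
  have hdiff : ∀ d, |q d * dist (o d) v ^ 2 - q d * dist (π N (o d)) v ^ 2| ≤ err N d := fun d => by
    rw [← mul_sub, abs_mul]
    simp only [err]
    have := abs_dist_sq_sub_dist_sq_le hM (o d) (π N (o d)) v
    gcongr
  have e1 : |(n : ℝ)⁻¹ * ∑ i ∈ Finset.range n, q (D i s) * dist (o (D i s)) v ^ 2 -
      (n : ℝ)⁻¹ * ∑ i ∈ Finset.range n, q (D i s) * dist (π N (o (D i s))) v ^ 2| ≤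
      (n : ℝ)⁻¹ * ∑ i ∈ Finset.range n, err N (D i s) := by
    rw [← mul_sub, abs_mul, abs_of_nonneg (by positivity), ← Finset.sum_sub_distrib]
    gcongr
    exact (Finset.abs_sum_le_sum_abs _ _).trans (Finset.sum_le_sum fun i _ => hdiff _)
  have e2 : |∫ s, q (D 0 s) * dist (o (D 0 s)) v ^ 2 ∂P -
      ∫ s, q (D 0 s) * dist (π N (o (D 0 s))) v ^ 2 ∂P| ≤ ∫ s, err N (D 0 s) ∂P := by
    rw [← integral_sub hq2 hπi]
    exact (abs_integral_le_integral_abs).trans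
      (integral_mono (hq2.sub hπi).abs (herri N) fun s => hdiff _)
  have e3 : |(n : ℝ)⁻¹ * ∑ i ∈ Finset.range n, q (D i s) * dist (π N (o (D i s))) v ^ 2 -
      ∫ s, q (D 0 s) * dist (π N (o (D 0 s))) v ^ 2 ∂P| ≤ ε / 4 := by
    simp only [hdecomp]
    rw [integral_finsetSum _ fun x _ => (hcelli N x).const_mul _, Finset.sum_comm, Finset.mul_sum,
      ← Finset.sum_sub_distrib]
    refine (Finset.abs_sum_le_sum_abs _ _).trans ((Finset.sum_le_sum fun x _ => ?_).trans hn2.le)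
    rw [integral_const_mul, ← Finset.mul_sum, mul_left_comm, ← mul_sub, abs_mul,
      abs_of_nonneg (by positivity)]
    exact mul_le_mul_of_nonneg_right (hM x v) (abs_nonneg _)
  rw [abs_le] at e1 e2 e3 ⊢
  constructor <;> linarith [e1.1, e1.2, e2.1, e2.2, e3.1, e3.2]

end UniformLLN

/-! ### Consistency and linearization of minimizers, deterministic form. -/

section Argmin

/-- Uniform closeness within `δ / 3` gives the minimizer an `F`-value of at most `F ζ + 2 δ / 3`,
too small for a point at distance `ε` or more from `ζ`. -/
lemma tendsto_of_argmin {Ω : Type*} [MetricSpace Ω] {f : ℕ → Ω → ℝ} {F : Ω → ℝ} {ζ : Ω}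
    {ζhat : ℕ → Ω} (hunif : ∀ ε > 0, ∀ᶠ n in atTop, ∀ v, |f n v - F v| ≤ ε)
    (hsep : ∀ ε > 0, ∃ δ > 0, ∀ w, ε ≤ dist w ζ → F ζ + δ ≤ F w)
    (hmin : ∀ᶠ n in atTop, ∀ w, f n (ζhat n) ≤ f n w) : Tendsto ζhat atTop (𝓝 ζ) := by
  rw [Metric.tendsto_nhds]
  intro ε hε
  obtain ⟨δ, hδ, h⟩ := hsep ε hε
  filter_upwards [hunif (δ / 3) (by positivity), hmin] with n hn hm
  by_contra! hge
  have h1 := h _ hge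
  have h2 := abs_le.1 (hn (ζhat n))
  have h3 := abs_le.1 (hn ζ)
  linarith [hm ζ, h2.1, h2.2, h3.1, h3.2]

/-- If functions have uniform second order expansions with a positive definite Hessian, then their
minimizers are asymptotically the minimizers of the quadratic approximations. -/
lemma eventually_norm_argmin_sub_le {E : Type*} [NormedAddCommGroup E] [InnerProductSpace ℝ E]
    {f : ℕ → E → ℝ} {G : ℕ → E} {H K : E →L[ℝ] E} {c : ℝ} (hc : 0 < c)
    (hHc : ∀ h, c * ‖h‖ ^ 2 ≤ inner ℝ (H h) h) (hsymm : ∀ v w, inner ℝ (H v) w = inner ℝ v (H w))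
    (hHK : ∀ v, H (K v) = v)
    (hexp : ∀ ε > 0, ∃ δ > 0, ∀ᶠ n in atTop, ∀ h, ‖h‖ < δ →
      |f n h - f n 0 - inner ℝ (G n) h - 2⁻¹ * inner ℝ (H h) h| ≤ ε * ‖h‖ ^ 2)
    (hG : Tendsto G atTop (𝓝 0)) {x : ℕ → E} (hx : Tendsto x atTop (𝓝 0))
    {ρ : ℝ} (hρ : 0 < ρ) (hmin : ∀ᶠ n in atTop, ∀ h, ‖h‖ < ρ → f n (x n) ≤ f n h)
    {ε : ℝ} (hε : 0 < ε) : ∀ᶠ n in atTop, ‖x n + K (G n)‖ ≤ ε * ‖G n‖ := by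
  set C : ℝ := (4 / c) ^ 2 + ‖K‖ ^ 2
  have hC : 0 < C := by positivity
  -- The first bound lets coercivity absorb the remainder when comparing with `0`, giving `‖x n‖ ≤ 4
  -- / c * ‖G n‖`. The second makes `2 η C ≤ c ε²`, where `C * ‖G n‖ ^ 2` bounds the squared norms
  -- of the minimizer and of the comparison point `-K (G n)`.
  set η := min (c / 4) (ε ^ 2 * c / (2 * C))
  have hη : 0 < η := by positivity
  obtain ⟨δ, hδ, hev⟩ := hexp η hη
  have hx0 : Tendsto (fun n => ‖x n‖) atTop (𝓝 0) := by simpa using hx.norm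
  have hK0 : Tendsto (fun n => ‖-K (G n)‖) atTop (𝓝 0) := by
    simpa using ((K.continuous.tendsto 0).comp hG).norm
  filter_upwards [hev, hmin, hx0.eventually_lt_const hδ, hK0.eventually_lt_const hδ,
    hK0.eventually_lt_const hρ] with n h1 h2 h3 h4 h5
  set g := G n
  set y := x n
  set k := -K g
  have hy := h1 y h3
  have hk := h1 k h4
  have hm0 := h2 0 (by simpa using hρ)
  have hmk := h2 k h5
  have hyc := hHc y
  have hHk : H k = -g := by simp [k, hHK]
  have hgy : |inner ℝ g y| ≤ ‖g‖ * ‖y‖ := abs_real_inner_le_norm _ _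
  -- rate
  have hrate : ‖y‖ ≤ 4 / c * ‖g‖ := by
    rcases eq_or_lt_of_le (norm_nonneg y) with h0 | hpos
    · rw [← h0]; positivity
    have e1 := (abs_le.1 hy).1
    have e2 : η * ‖y‖ ^ 2 ≤ c / 4 * ‖y‖ ^ 2 := by gcongr; exact min_le_left _ _
    have e3 : c / 4 * ‖y‖ ^ 2 ≤ ‖g‖ * ‖y‖ := by
      linarith [(abs_le.1 hgy).1]
    have e4 : c / 4 * ‖y‖ ≤ ‖g‖ := by nlinarith
    rw [div_mul_eq_mul_div, le_div_iff₀ hc]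
    linarith
  have hkn : ‖k‖ ≤ ‖K‖ * ‖g‖ := by simpa [k] using K.le_opNorm g
  -- comparison with the minimizer of the quadratic
  have hquad : inner ℝ (H (y - k)) (y - k) =
      (2 * inner ℝ g y + inner ℝ (H y) y) - (2 * inner ℝ g k + inner ℝ (H k) k) := by
    simp only [map_sub, inner_sub_left, inner_sub_right]
    rw [hsymm y k, hHk]
    simp only [inner_neg_left, inner_neg_right, real_inner_comm g y]
    ring
  have e5 : c * ‖y - k‖ ^ 2 ≤ 2 * (η * (‖y‖ ^ 2 + ‖k‖ ^ 2)) := by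
    refine (hHc _).trans ?_
    rw [hquad]
    linarith [(abs_le.1 hy).1, (abs_le.1 hy).2, (abs_le.1 hk).1, (abs_le.1 hk).2]
  have e6 : ‖y‖ ^ 2 + ‖k‖ ^ 2 ≤ C * ‖g‖ ^ 2 := by
    have a1 : ‖y‖ ^ 2 ≤ (4 / c * ‖g‖) ^ 2 := by gcongr
    have a2 : ‖k‖ ^ 2 ≤ (‖K‖ * ‖g‖) ^ 2 := by gcongr
    calc _ ≤ (4 / c * ‖g‖) ^ 2 + (‖K‖ * ‖g‖) ^ 2 := add_le_add a1 a2
      _ = _ := by simp only [C]; ring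
  have e7 : c * ‖y - k‖ ^ 2 ≤ c * (ε * ‖g‖) ^ 2 := by
    calc _ ≤ 2 * (η * (C * ‖g‖ ^ 2)) := by refine e5.trans ?_; gcongr
      _ ≤ 2 * ((ε ^ 2 * c / (2 * C)) * (C * ‖g‖ ^ 2)) := by gcongr; exact min_le_right _ _
      _ = _ := by field_simp
  have e8 : ‖y - k‖ ≤ ε * ‖g‖ :=
    le_of_sq_le_sq (le_of_mul_le_mul_left e7 hc) (by positivity)
  simpa [k] using e8

end Argmin

/-! ### Covariance matrices as quadratic forms. -/

section CovarianceMatrix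

variable {𝒮 : Type*} [MeasurableSpace 𝒮] {P : Measure 𝒮} [IsProbabilityMeasure P] {p : ℕ}

lemma variance_inner_eq {ξ : 𝒮 → EuclideanSpace ℝ (Fin p)} (hξ : MemLp ξ 2 P)
    (t : EuclideanSpace ℝ (Fin p)) :
    Var[fun s => inner ℝ (ξ s) t; P] =
      t ⬝ᵥ (Matrix.of fun i j => cov[fun s => ξ s i, fun s => ξ s j; P]) *ᵥ t := by
  have hi : ∀ i, MemLp (fun s => ξ s i) 2 P := fun i => hξ.eval_piLp i
  have h1 : (fun s => inner ℝ (ξ s) t) = fun s => ∑ i, t i * ξ s i := by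
    ext s
    simp [PiLp.inner_apply]
  rw [h1, ← covariance_self (Finset.aemeasurable_fun_sum _ fun i _ =>
    ((hi i).aestronglyMeasurable.aemeasurable.const_mul _)),
    covariance_fun_sum_fun_sum (fun i => (hi i).const_mul _) fun i => (hi i).const_mul _]
  simp only [dotProduct, Matrix.mulVec, Matrix.of_apply, Finset.mul_sum]
  refine Finset.sum_congr rfl fun i _ => Finset.sum_congr rfl fun j _ => ?_
  rw [covariance_const_mul_left, covariance_const_mul_right]
  ring

lemma posSemidef_covariance {ξ : 𝒮 → EuclideanSpace ℝ (Fin p)} (hξ : MemLp ξ 2 P) :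
    (Matrix.of fun i j => cov[fun s => ξ s i, fun s => ξ s j; P] :
      Matrix (Fin p) (Fin p) ℝ).PosSemidef := by
  refine Matrix.PosSemidef.of_dotProduct_mulVec_nonneg ?_ fun x => ?_
  · ext i j
    simp [covariance_comm]
  · have := variance_inner_eq hξ (WithLp.toLp 2 x)
    simp only [star_trivial]
    rw [← this]
    exact variance_nonneg _ _

end CovarianceMatrix

/-! ### Quadratic forms and coercivity. -/

section QuadraticForm

variable {p : ℕ}

lemma quadForm_eq_inner (H : Matrix (Fin p) (Fin p) ℝ) (h : EuclideanSpace ℝ (Fin p)) :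
    quadForm H h = inner ℝ (Matrix.toEuclideanCLM (𝕜 := ℝ) H h) h := by
  simp only [quadForm, PiLp.inner_apply, Matrix.ofLp_toEuclideanCLM, Matrix.mulVec, dotProduct,
    RCLike.inner_apply, conj_trivial, Finset.mul_sum]
  refine Finset.sum_congr rfl fun i _ => Finset.sum_congr rfl fun j _ => by ring

lemma quadForm_sub (A B : Fin p → Fin p → ℝ) (h : EuclideanSpace ℝ (Fin p)) :
    quadForm A h - quadForm B h = quadForm (fun i j => A i j - B i j) h := by
  simp only [quadForm, ← Finset.sum_sub_distrib, mul_sub]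

lemma quadForm_sum {ι : Type*} (t : Finset ι) (c : ι → ℝ) (B : ι → Fin p → Fin p → ℝ)
    (h : EuclideanSpace ℝ (Fin p)) :
    quadForm (fun i j => ∑ k ∈ t, c k * B k i j) h = ∑ k ∈ t, c k * quadForm (B k) h := by
  simp only [quadForm, Finset.mul_sum]
  rw [Finset.sum_comm (s := t)]
  refine Finset.sum_congr rfl fun i _ => ?_
  rw [Finset.sum_comm (s := t)]
  exact Finset.sum_congr rfl fun j _ => Finset.sum_congr rfl fun k _ => by ring

lemma abs_quadForm_le (B : Fin p → Fin p → ℝ) (h : EuclideanSpace ℝ (Fin p)) :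
    |quadForm B h| ≤ (∑ i, ∑ j, |B i j|) * ‖h‖ ^ 2 := by
  rw [quadForm, Finset.sum_mul]
  refine (Finset.abs_sum_le_sum_abs _ _).trans (Finset.sum_le_sum fun i _ => ?_)
  rw [Finset.sum_mul]
  refine (Finset.abs_sum_le_sum_abs _ _).trans (Finset.sum_le_sum fun j _ => ?_)
  have h1 : ∀ i, |h i| ≤ ‖h‖ := fun i => PiLp.norm_apply_le h i
  rw [abs_mul, abs_mul, mul_comm]
  calc _ ≤ |B i j| * (‖h‖ * ‖h‖) := by gcongr <;> exact h1 _
    _ = _ := by ring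

/-- The constant is the minimum of the form on the compact unit sphere; the sphere is empty in
dimension zero, which is treated apart. -/
lemma exists_coercive_of_posDef {H : Matrix (Fin p) (Fin p) ℝ} (hH : H.PosDef) :
    ∃ c > 0, ∀ h : EuclideanSpace ℝ (Fin p),
      c * ‖h‖ ^ 2 ≤ inner ℝ (Matrix.toEuclideanCLM (𝕜 := ℝ) H h) h := by
  set T := Matrix.toEuclideanCLM (𝕜 := ℝ) H
  have hpos : ∀ h : EuclideanSpace ℝ (Fin p), h ≠ 0 → 0 < inner ℝ (T h) h := by
    intro h hh
    have h1 := hH.dotProduct_mulVec_pos (x :=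
        h.ofLp) (fun h0 => hh (by ext i; simpa using congrFun h0 i))
    rw [← quadForm_eq_inner]
    refine h1.trans_eq ?_
    simp only [quadForm, dotProduct, Matrix.mulVec, star_trivial, Finset.mul_sum]
    refine Finset.sum_congr rfl fun i _ => Finset.sum_congr rfl fun j _ => by ring
  rcases (Metric.sphere (0 : EuclideanSpace ℝ (Fin p)) 1).eq_empty_or_nonempty with he | hne
  · refine ⟨1, one_pos, fun h => ?_⟩
    rcases eq_or_ne h 0 with rfl | hh
    · simp
    · have : ‖h‖⁻¹ • h ∈ Metric.sphere (0 : EuclideanSpace ℝ (Fin p)) 1 := by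
        simp [norm_smul, norm_ne_zero_iff.2 hh]
      rw [he] at this
      exact this.elim
  · have hcont : Continuous fun h : EuclideanSpace ℝ (Fin p) => inner ℝ (T h) h := by fun_prop
    obtain ⟨x, hx, hmin⟩ := (isCompact_sphere _ _).exists_isMinOn hne hcont.continuousOn
    have hx0 : x ≠ 0 := by rintro rfl; simp at hx
    refine ⟨_, hpos x hx0, fun h => ?_⟩
    rcases eq_or_ne h 0 with rfl | hh
    · simp
    have hn : ‖h‖ ≠ 0 := norm_ne_zero_iff.2 hh
    have h1 : ‖h‖⁻¹ • h ∈ Metric.sphere (0 : EuclideanSpace ℝ (Fin p)) 1 := by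
      simp [norm_smul, hn]
    have h2 := hmin h1
    simp only [Set.mem_ofPred_eq, map_smul, real_inner_smul_left, real_inner_smul_right] at h2
    calc _ ≤ (‖h‖⁻¹ * (‖h‖⁻¹ * inner ℝ (T h) h)) * ‖h‖ ^ 2 := by gcongr
      _ = _ := by field_simp

end QuadraticForm

/-! ### Averages with estimated weights. -/

section WeightedMean

variable {ι : Type*} [Fintype ι]

/-- Weighted means with weights `∑ α, c n α * q i α`, in terms of the means of `q i α * a i`. -/
lemma mean_weight_mul (n : ℕ) (c : ι → ℝ) (q : ℕ → ι → ℝ) (a : ℕ → ℝ) :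
    (n : ℝ)⁻¹ * ∑ i ∈ Finset.range n, (∑ α, c α * q i α) * a i =
      ∑ α, c α * ((n : ℝ)⁻¹ * ∑ i ∈ Finset.range n, q i α * a i) := by
  simp only [Finset.sum_mul, Finset.mul_sum]
  rw [Finset.sum_comm]
  exact Finset.sum_congr rfl fun α _ => Finset.sum_congr rfl fun i _ => by ring

lemma mean_weight_smul {E : Type*} [AddCommGroup E] [Module ℝ E] (n : ℕ) (c : ι → ℝ)
    (q : ℕ → ι → ℝ) (a : ℕ → E) :
    (n : ℝ)⁻¹ • ∑ i ∈ Finset.range n, (∑ α, c α * q i α) • a i =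
      ∑ α, c α • ((n : ℝ)⁻¹ • ∑ i ∈ Finset.range n, q i α • a i) := by
  simp only [Finset.sum_smul, Finset.smul_sum, smul_smul]
  rw [Finset.sum_comm]
  refine Finset.sum_congr rfl fun α _ => Finset.sum_congr rfl fun i _ => ?_
  congr 1
  ring

/-- Convergent coefficients times uniformly convergent averages with bounded limits, summed over
finitely many indices. -/
lemma uniform_weighted_mean {V : Type*} {c : ℕ → ι → ℝ} {c₀ : ι → ℝ}
    (hc : ∀ α, Tendsto (fun n => c n α) atTop (𝓝 (c₀ α))) {q : ℕ → ι → ℝ} {a : ℕ → V → ℝ}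
    {e : ι → V → ℝ} {K : ℝ} (hK : ∀ α v, |e α v| ≤ K)
    (hunif : ∀ α, ∀ ε > 0, ∀ᶠ n : ℕ in atTop, ∀ v,
      |(n : ℝ)⁻¹ * ∑ i ∈ Finset.range n, q i α * a i v - e α v| ≤ ε) {ε : ℝ} (hε : 0 < ε) :
    ∀ᶠ n : ℕ in atTop, ∀ v, |(n : ℝ)⁻¹ * ∑ i ∈ Finset.range n, (∑ α, c n α * q i α) * a i v -
      ∑ α, c₀ α * e α v| ≤ ε := by
  rcases isEmpty_or_nonempty V with hV | ⟨⟨v₀⟩⟩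
  · exact Eventually.of_forall fun n v => hV.elim v
  rcases isEmpty_or_nonempty ι with hι | ⟨⟨α₀⟩⟩
  · simp [hε.le]
  have hK0 : 0 ≤ K := (abs_nonneg _).trans (hK α₀ v₀)
  set C := ∑ α, |c₀ α| + 1
  have hC : 0 < C := by positivity
  have h1 : Tendsto (fun n => ∑ α, |c n α - c₀ α| * K) atTop (𝓝 0) := by
    have : Tendsto (fun n => ∑ α, |c n α - c₀ α| * K) atTop (𝓝 (∑ α, |c₀ α - c₀ α| * K)) :=
      tendsto_finsetSum _ fun α _ => (((hc α).sub_const _).abs).mul_const _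
    simpa using this
  have h2 : Tendsto (fun n => ∑ α, |c n α|) atTop (𝓝 (∑ α, |c₀ α|)) :=
    tendsto_finsetSum _ fun α _ => (hc α).abs
  have h3 : ∀ᶠ n : ℕ in atTop, ∀ α, ∀ v,
      |(n : ℝ)⁻¹ * ∑ i ∈ Finset.range n, q i α * a i v - e α v| ≤ ε / (2 * C) :=
    eventually_all.2 fun α => hunif α _ (by positivity)
  filter_upwards [h1.eventually_lt_const (show 0 < ε / 2 by positivity),
    h2.eventually_lt_const (show _ < C from lt_add_one _), h3] with n hn1 hn2 hn3 v
  rw [mean_weight_mul, ← Finset.sum_sub_distrib]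
  calc |∑ α, (c n α * ((n : ℝ)⁻¹ * ∑ i ∈ Finset.range n, q i α * a i v) - c₀ α * e α v)|
      ≤ ∑ α, (|c n α| * (ε / (2 * C)) + |c n α - c₀ α| * K) := by
        refine (Finset.abs_sum_le_sum_abs _ _).trans (Finset.sum_le_sum fun α _ => ?_)
        have e1 : c n α * ((n : ℝ)⁻¹ * ∑ i ∈ Finset.range n, q i α * a i v) - c₀ α * e α v =
          c n α * ((n : ℝ)⁻¹ * ∑ i ∈ Finset.range n, q i α * a i v - e α v) +
            (c n α - c₀ α) * e α v := by ring
        rw [e1]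
        refine (abs_add_le _ _).trans ?_
        rw [abs_mul, abs_mul]
        gcongr
        · exact hn3 α v
        · exact hK α v
    _ = (∑ α, |c n α|) * (ε / (2 * C)) + ∑ α, |c n α - c₀ α| * K := by
        rw [Finset.sum_add_distrib, Finset.sum_mul]
    _ ≤ C * (ε / (2 * C)) + ε / 2 := by gcongr
    _ = ε := by field_simp; ring

variable {p : ℕ}

/-- Second order expansion of a weighted mean, uniform in the sample size. -/
lemma weighted_mean_expansion {c : ℕ → ι → ℝ} {c₀ : ι → ℝ}
    (hc : ∀ α, Tendsto (fun n => c n α) atTop (𝓝 (c₀ α))) {q : ℕ → ι → ℝ} {κ : ℕ → ℝ}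
    (hκ : ∀ i, 0 ≤ κ i) (hq : ∀ i α, |q i α| ≤ κ i) {a : ℕ → EuclideanSpace ℝ (Fin p) → ℝ}
    {g : ℕ → EuclideanSpace ℝ (Fin p)} {B : ℕ → Fin p → Fin p → ℝ} {R : ℕ → ℕ → ℝ} {r : ℝ}
    (hr : 0 < r) (hexp : ∀ i (k : ℕ) (h : EuclideanSpace ℝ (Fin p)),
      ‖h‖ < r / (k + 1) →
        |a i h - a i 0 - inner ℝ (g i) h - 2⁻¹ * quadForm (B i) h| ≤ R k i * ‖h‖ ^ 2)
    {b : ι → Fin p → Fin p → ℝ}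
    (hB : ∀ α j k, Tendsto (fun n : ℕ => (n : ℝ)⁻¹ * ∑ i ∈ Finset.range n, q i α * B i j k) atTop
      (𝓝 (b α j k)))
    {e : ℕ → ℝ} (hR : ∀ k, Tendsto (fun n : ℕ =>
        (n : ℝ)⁻¹ * ∑ i ∈ Finset.range n, κ i * R k i) atTop
      (𝓝 (e k))) (he : Tendsto e atTop (𝓝 0)) {ε : ℝ} (hε : 0 < ε) :
    ∃ δ > 0, ∀ᶠ n : ℕ in atTop, ∀ h : EuclideanSpace ℝ (Fin p), ‖h‖ < δ →
      |(n : ℝ)⁻¹ * ∑ i ∈ Finset.range n, (∑ α, c n α * q i α) * a i h -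
        (n : ℝ)⁻¹ * ∑ i ∈ Finset.range n, (∑ α, c n α * q i α) * a i 0 -
        inner ℝ ((n : ℝ)⁻¹ • ∑ i ∈ Finset.range n, (∑ α, c n α * q i α) • g i) h -
        2⁻¹ * quadForm (fun j k => ∑ α, c₀ α * b α j k) h| ≤ ε * ‖h‖ ^ 2 := by
  set C := ∑ α, |c₀ α| + 1
  have hC : 0 < C := by positivity
  have h2 : Tendsto (fun n => ∑ α, |c n α|) atTop (𝓝 (∑ α, |c₀ α|)) :=
    tendsto_finsetSum _ fun α _ => (hc α).abs
  -- The radius is chosen so that the limiting mean remainder is below `ε / (2 * C)`, and `C`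
  -- eventually bounds the coefficient sum. The remainder thus costs `ε / 2`; the error of the
  -- averaged Hessian costs the other half.
  obtain ⟨k, hk⟩ := (he.eventually_lt_const (show 0 < ε / (2 * C) by positivity)).exists
  have hH : Tendsto (fun n : ℕ => ∑ j, ∑ l, |(∑ α, c n α * ((n : ℝ)⁻¹ *
      ∑ i ∈ Finset.range n, q i α * B i j l)) - ∑ α, c₀ α * b α j l|) atTop (𝓝 0) := by
    have : Tendsto (fun n : ℕ => ∑ j, ∑ l, |(∑ α, c n α * ((n : ℝ)⁻¹ *
      ∑ i ∈ Finset.range n, q i α * B i j l)) - ∑ α, c₀ α * b α j l|) atTop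
      (𝓝 (∑ j, ∑ l, |(∑ α, c₀ α * b α j l) - ∑ α, c₀ α * b α j l|)) :=
      tendsto_finsetSum _ fun j _ => tendsto_finsetSum _ fun l _ =>
        ((tendsto_finsetSum _ fun α _ => (hc α).mul (hB α j l)).sub_const _).abs
    simpa using this
  refine ⟨r / (k + 1), by positivity, ?_⟩
  filter_upwards [h2.eventually_lt_const (show _ < C from lt_add_one _),
    (hR k).eventually_lt_const hk, hH.eventually_lt_const hε] with n hn1 hn2 hn3 h hh
  set w : ℕ → ℝ := fun i => ∑ α, c n α * q i α
  have hw : ∀ i, |w i| ≤ C * κ i := fun i => by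
    calc |w i| ≤ ∑ α, |c n α| * κ i := (Finset.abs_sum_le_sum_abs _ _).trans
          (Finset.sum_le_sum fun α _ => by rw [abs_mul]; gcongr; exact hq i α)
      _ = (∑ α, |c n α|) * κ i := by rw [Finset.sum_mul]
      _ ≤ C * κ i := mul_le_mul_of_nonneg_right hn1.le (hκ i)
  have e1 : (n : ℝ)⁻¹ * ∑ i ∈ Finset.range n, w i * a i h -
      (n : ℝ)⁻¹ * ∑ i ∈ Finset.range n, w i * a i 0 -
      inner ℝ ((n : ℝ)⁻¹ • ∑ i ∈ Finset.range n, w i • g i) h -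
      2⁻¹ * quadForm (fun j l => ∑ α, c₀ α * b α j l) h =
      (n : ℝ)⁻¹ * ∑ i ∈ Finset.range n, w i * (a i h - a i 0 - inner ℝ (g i) h -
        2⁻¹ * quadForm (B i) h) +
      2⁻¹ * quadForm (fun j l => (∑ α, c n α * ((n : ℝ)⁻¹ *
      ∑ i ∈ Finset.range n, q i α * B i j l)) - ∑ α, c₀ α * b α j l) h := by
    rw [← quadForm_sub]
    have e2 : quadForm (fun j l => ∑ α, c n α * ((n : ℝ)⁻¹ *
        ∑ i ∈ Finset.range n, q i α * B i j l)) h =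
        (n : ℝ)⁻¹ * ∑ i ∈ Finset.range n, w i * quadForm (B i) h := by
      rw [← quadForm_sum]
      simp only [← mean_weight_mul]
      simp only [quadForm, Finset.mul_sum]
      exact Finset.sum_congr rfl fun i _ => Finset.sum_congr rfl fun j _ =>
        Finset.sum_congr rfl fun k _ => by ring
    rw [e2, real_inner_smul_left, sum_inner]
    simp only [real_inner_smul_left, mul_sub, Finset.sum_sub_distrib]
    have e3 : ∑ i ∈ Finset.range n, w i * (2⁻¹ * quadForm (B i) h) =
        2⁻¹ * ∑ i ∈ Finset.range n, w i * quadForm (B i) h := by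
      rw [Finset.mul_sum]; exact Finset.sum_congr rfl fun i _ => by ring
    rw [e3]
    ring
  rw [e1]
  have e4 : |(n : ℝ)⁻¹ * ∑ i ∈ Finset.range n, w i * (a i h - a i 0 - inner ℝ (g i) h -
        2⁻¹ * quadForm (B i) h)| ≤ ε / 2 * ‖h‖ ^ 2 := by
    rw [abs_mul, abs_of_nonneg (by positivity)]
    calc _ ≤ (n : ℝ)⁻¹ * ∑ i ∈ Finset.range n, (C * κ i) * (R k i * ‖h‖ ^ 2) := by
          gcongr
          refine (Finset.abs_sum_le_sum_abs _ _).trans (Finset.sum_le_sum fun i _ => ?_)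
          rw [abs_mul]
          exact mul_le_mul (hw i) (hexp i k h hh) (abs_nonneg _) ((abs_nonneg _).trans (hw i))
      _ = C * ((n : ℝ)⁻¹ * ∑ i ∈ Finset.range n, κ i * R k i) * ‖h‖ ^ 2 := by
          simp only [Finset.mul_sum, Finset.sum_mul]
          exact Finset.sum_congr rfl fun i _ => by ring
      _ ≤ C * (ε / (2 * C)) * ‖h‖ ^ 2 := by gcongr
      _ = _ := by field_simp
  have e5 := abs_quadForm_le (fun j l => (∑ α, c n α * ((n : ℝ)⁻¹ *
      ∑ i ∈ Finset.range n, q i α * B i j l)) - ∑ α, c₀ α * b α j l) h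
  have e6 : (∑ j, ∑ l, |(∑ α, c n α * ((n : ℝ)⁻¹ *
      ∑ i ∈ Finset.range n, q i α * B i j l)) - ∑ α, c₀ α * b α j l|) * ‖h‖ ^ 2 ≤ ε * ‖h‖ ^ 2 := by
    gcongr
  refine (abs_add_le _ _).trans ?_
  rw [abs_mul (2⁻¹ : ℝ), abs_of_pos (by norm_num : (0 : ℝ) < 2⁻¹)]
  linarith

end WeightedMean

/-! ### Asymptotic normality of gradients and of linearized minimizers. -/

section AsymptoticNormality

variable {𝒮 : Type*} [MeasurableSpace 𝒮] {P : Measure 𝒮} {p : ℕ}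

/-- The delta method: asymptotic normality of a differentiable function of a mean. -/
lemma tendstoInDistribution_delta [IsProbabilityMeasure P] {W : Type*} [NormedAddCommGroup W] [NormedSpace ℝ W]
    [FiniteDimensional ℝ W] [MeasurableSpace W] [BorelSpace W] {V : ℕ → 𝒮 → W}
    (hL2 : MemLp (V 0) 2 P) (hindep : iIndepFun V P)
    (hident : ∀ i, IdentDistrib (V i) (V 0) P P) {Φ : W → EuclideanSpace ℝ (Fin p)}
    {A : W →L[ℝ] EuclideanSpace ℝ (Fin p)} (hΦ : HasFDerivAt Φ A P[V 0]) (hΦ0 : Φ P[V 0] = 0)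
    (hmeas : ∀ n : ℕ, AEMeasurable (fun s => Φ ((n : ℝ)⁻¹ • ∑ i ∈ Finset.range n, V i s)) P) :
    TendstoInDistribution
      (fun (n : ℕ) s => √(n : ℝ) • Φ ((n : ℝ)⁻¹ • ∑ i ∈ Finset.range n, V i s))
      atTop (id : EuclideanSpace ℝ (Fin p) → EuclideanSpace ℝ (Fin p)) (fun _ => P)
      (multivariateGaussian 0 (Matrix.of fun i j =>
        cov[fun s => A (V 0 s - P[V 0]) i, fun s => A (V 0 s - P[V 0]) j; P])) := by
  have := FiniteDimensional.proper ℝ W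
  set c : W := P[V 0] with hc
  set ξ : ℕ → 𝒮 → EuclideanSpace ℝ (Fin p) := fun i s => A (V i s - c)
  have hξ2 : MemLp (ξ 0) 2 P := A.comp_memLp' (hL2.sub (memLp_const _))
  have hm : Measurable fun v : W => A (v - c) := by fun_prop
  have hξ0 : P[ξ 0] = 0 := by
    have hi := hL2.integrable one_le_two
    have h1 := A.integral_comp_comm (φ := fun s => V 0 s - c) (hi.sub (integrable_const _))
    rw [integral_sub hi (integrable_const _)] at h1
    rw [h1, ← hc]
    simp
  have hclt := tendstoInDistribution_sqrt_smul_mean hξ2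
    (hindep.comp (fun _ v => A (v - c)) fun _ => hm) (fun i => (hident i).comp hm)
    (posSemidef_covariance hξ2) (variance_inner_eq hξ2)
  refine tendstoInDistribution_of_tendstoInMeasure_sub _ _ hclt ?_ fun n =>
      (hmeas n).const_smul (√(n : ℝ))
  have hdelta := tendstoInMeasure_delta hL2 hindep hident hΦ fun n => (hmeas n).aestronglyMeasurable
  refine hdelta.congr_left fun n => ae_of_all _ fun s => ?_
  rcases Nat.eq_zero_or_pos n with rfl | hn
  · simp
  have hn' : (n : ℝ) ≠ 0 := by positivity
  have h1 : A ((n : ℝ)⁻¹ • ∑ i ∈ Finset.range n, V i s - c) =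
      (n : ℝ)⁻¹ • ∑ i ∈ Finset.range n, ξ i s := by
    simp only [ξ]
    rw [← map_sum, ← map_smul, Finset.sum_sub_distrib, smul_sub]
    simp [← Nat.cast_smul_eq_nsmul ℝ, smul_smul, hn']
  simp only [Pi.sub_apply]
  rw [h1, hΦ0, sub_zero]
  simp only [hξ0, sub_zero]

/-- The gradient is dominated by the deviation of an i.i.d. mean, whose `√n` multiple is bounded in
probability; this controls the linearization error of the estimator. -/
lemma ae_eventually_norm_delta_le {W : Type*} [NormedAddCommGroup W] [NormedSpace ℝ W]
    [CompleteSpace W] [MeasurableSpace W] [BorelSpace W] {V : ℕ → 𝒮 → W}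
    (hint : Integrable (V 0) P) (hindep : iIndepFun V P)
    (hident : ∀ i, IdentDistrib (V i) (V 0) P P) {E : Type*} [NormedAddCommGroup E]
    [NormedSpace ℝ E] {Φ : W → E}
    {A : W →L[ℝ] E} (hΦ : HasFDerivAt Φ A P[V 0]) (hΦ0 : Φ P[V 0] = 0) :
    ∀ᵐ s ∂P, Tendsto (fun n : ℕ => Φ ((n : ℝ)⁻¹ • ∑ i ∈ Finset.range n, V i s)) atTop (𝓝 0) ∧
      ∀ᶠ n : ℕ in atTop, ‖Φ ((n : ℝ)⁻¹ • ∑ i ∈ Finset.range n, V i s)‖ ≤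
        (1 + ‖A‖) * ‖(n : ℝ)⁻¹ • ∑ i ∈ Finset.range n, V i s - P[V 0]‖ := by
  filter_upwards [ae_tendsto_mean hint hindep hident] with s hs
  refine ⟨?_, ?_⟩
  · rw [← hΦ0]
    exact hΦ.continuousAt.tendsto.comp hs
  · have h1 := (hasFDerivAt_iff_isLittleO.1 hΦ).def one_pos
    filter_upwards [hs.eventually h1] with n hn
    rw [hΦ0, sub_zero, one_mul] at hn
    have h2 := A.le_opNorm ((n : ℝ)⁻¹ • ∑ i ∈ Finset.range n, V i s - P[V 0])
    have h3 := norm_sub_norm_le (Φ ((n : ℝ)⁻¹ • ∑ i ∈ Finset.range n, V i s))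
      (A ((n : ℝ)⁻¹ • ∑ i ∈ Finset.range n, V i s - P[V 0]))
    linarith

/-- Asymptotic normality of a sequence that is asymptotically `-H⁻¹ G`. -/
lemma tendstoInDistribution_of_linearization [IsProbabilityMeasure P]
    {G x : ℕ → 𝒮 → EuclideanSpace ℝ (Fin p)}
    {S H : Matrix (Fin p) (Fin p) ℝ} (hS : S.PosSemidef) (hH : H.IsSymm)
    (hG : TendstoInDistribution (fun (n : ℕ) s => √(n : ℝ) • G n s) atTop
      (id : EuclideanSpace ℝ (Fin p) → EuclideanSpace ℝ (Fin p)) (fun _ => P)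
      (multivariateGaussian 0 S))
    (hx : ∀ n, AEMeasurable (x n) P) {a : ℕ → 𝒮 → ℝ} {K : ℝ} (hK : 0 < K) (ha0 : ∀ n s, 0 ≤ a n s)
    (ha : BddInProb P fun n s => √(n : ℝ) * a n s) (ham : ∀ n, AEMeasurable (a n) P)
    (hGa : ∀ᵐ s ∂P, ∀ᶠ n in atTop, ‖G n s‖ ≤ K * a n s)
    (hlin : ∀ᵐ s ∂P, ∀ ε > 0, ∀ᶠ n in atTop,
      ‖x n s + Matrix.toEuclideanCLM (𝕜 := ℝ) H⁻¹ (G n s)‖ ≤ ε * ‖G n s‖) :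
    TendstoInDistribution (fun (n : ℕ) s => √(n : ℝ) • x n s) atTop
      (id : EuclideanSpace ℝ (Fin p) → EuclideanSpace ℝ (Fin p)) (fun _ => P)
      (multivariateGaussian 0 (H⁻¹ * S * H⁻¹)) := by
  set T := Matrix.toEuclideanCLM (𝕜 := ℝ) (-H⁻¹)
  have hT : ∀ v, T v = -Matrix.toEuclideanCLM (𝕜 := ℝ) H⁻¹ v := fun v => by
    simp [T, map_neg]
  have h1 : TendstoInDistribution (fun (n : ℕ) s => T (√(n : ℝ) • G n s)) atTop
      (id : EuclideanSpace ℝ (Fin p) → EuclideanSpace ℝ (Fin p)) (fun _ => P)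
      (multivariateGaussian 0 (H⁻¹ * S * H⁻¹)) := by
    refine tendstoInDistribution_of_map_eq (hG.continuous_comp T.continuous) aemeasurable_id ?_
    rw [Function.comp_id, map_toEuclideanCLM_multivariateGaussian hS, Measure.map_id]
    -- Symmetry of `H` gives the sandwich form, and the sign of `-H⁻¹` appears twice and cancels.
    have : (H⁻¹)ᵀ = H⁻¹ := by rw [Matrix.transpose_nonsing_inv, hH.eq]
    rw [Matrix.transpose_neg, this]
    simp
  refine tendstoInDistribution_of_tendstoInMeasure_sub _ _ h1 ?_ fun n =>
      (hx n).const_smul (√(n : ℝ))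
  refine tendstoInMeasure_zero_of_ae_le ha (fun n => (ham n).const_mul _) (fun n => ?_) ?_
  · have e1 : AEMeasurable (fun s => √(n : ℝ) • x n s) P := (hx n).const_smul (√(n : ℝ))
    have e2 : AEMeasurable (fun s => T (√(n : ℝ) • G n s)) P := h1.forall_aemeasurable n
    exact (e1.sub e2).aestronglyMeasurable
  · filter_upwards [hGa, hlin] with s hs1 hs2 ε hε
    filter_upwards [hs1, hs2 (ε / K) (by positivity)] with n hn1 hn2
    simp only [Pi.sub_apply]
    rw [map_smul, hT, smul_neg, sub_neg_eq_add, ← smul_add, norm_smul, abs_mul,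
      abs_of_nonneg (ha0 n s), Real.norm_eq_abs]
    calc _ ≤ |√(n : ℝ)| * (ε / K * (K * a n s)) := by
          gcongr
          exact hn2.trans (by gcongr)
      _ = _ := by field_simp

end AsymptoticNormality

/-! ### Smoothness of the population objective and positivity of its Hessian. -/

section Population

variable {𝒮 : Type*} [MeasurableSpace 𝒮] {P : Measure 𝒮} {p : ℕ}
  {Ω : Type*} [MetricSpace Ω] [SecondCountableTopology Ω] [MeasurableSpace Ω] [BorelSpace Ω]

set_option maxSynthPendingDepth 3 in
lemma inCoords_integral_contDiff {O : 𝒮 → Ω} (hO : Measurable O) {w : 𝒮 → ℝ} (hw : Integrable w P)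
    {M : ℝ} (hM : ∀ o v : Ω, dist o v ^ 2 ≤ M) {L : Ω → ℝ}
    (hwL : Integrable (fun s => |w s| * L (O s)) P)
    {φ : OpenPartialHomeomorph Ω (EuclideanSpace ℝ (Fin p))}
    {U : Set (EuclideanSpace ℝ (Fin p))} (hU : IsOpen U)
    (hsmooth : ∀ᵐ s ∂P, ContDiffOn ℝ 2 (inCoords φ fun v => dist (O s) v ^ 2) U ∧
      ∀ u ∈ U, ‖fderiv ℝ (inCoords φ fun v => dist (O s) v ^ 2) u‖ ≤ L (O s) ∧
        ‖fderiv ℝ (fderiv ℝ (inCoords φ fun v => dist (O s) v ^ 2)) u‖ ≤ L (O s)) :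
    ContDiffOn ℝ 2 (inCoords φ fun v => ∫ s, w s * dist (O s) v ^ 2 ∂P) U ∧ ∀ u ∈ U,
      (∀ h, fderiv ℝ (inCoords φ fun v => ∫ s, w s * dist (O s) v ^ 2 ∂P) u h =
        ∫ s, w s * fderiv ℝ (inCoords φ fun v => dist (O s) v ^ 2) u h ∂P) ∧
      ∀ h k, fderiv ℝ (fderiv ℝ (inCoords φ fun v => ∫ s, w s * dist (O s) v ^ 2 ∂P)) u h k =
        ∫ s, w s * fderiv ℝ (fderiv ℝ (inCoords φ fun v => dist (O s) v ^ 2)) u h k ∂P := by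
  set f : 𝒮 → EuclideanSpace ℝ (Fin p) → ℝ := fun s => inCoords φ fun v => dist (O s) v ^ 2
  have hd : ∀ s, ContDiffOn ℝ 2 (f s) U → ∀ u ∈ U,
      fderiv ℝ (fun u => w s * f s u) u = w s • fderiv ℝ (f s) u := fun s hs u hu =>
    fderiv_const_mul ((hs.contDiffAt (hU.mem_nhds hu)).differentiableAt two_ne_zero) _
  have hdd : ∀ s, ContDiffOn ℝ 2 (f s) U → ∀ u ∈ U,
      fderiv ℝ (fderiv ℝ (fun u => w s * f s u)) u = w s • fderiv ℝ (fderiv ℝ (f s)) u := by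
    intro s hs u hu
    have h1 : fderiv ℝ (fun u => w s * f s u) =ᶠ[𝓝 u] fun u => w s • fderiv ℝ (f s) u := by
      filter_upwards [hU.mem_nhds hu] with v hv using hd s hs v hv
    rw [h1.fderiv_eq]
    have h2 : DifferentiableAt ℝ (fderiv ℝ (f s)) u :=
      ((hs.contDiffAt (hU.mem_nhds hu)).fderiv_right (m := 1) (by norm_num)).differentiableAt
        one_ne_zero
    exact (h2.hasFDerivAt.const_smul (w s)).fderiv
  have hmain := contDiffOn_two_integral (P := P) (F := fun u s => w s * f s u) hU
    (fun u _ => by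
      refine (hw.abs.mul_const M).mono' (hw.aestronglyMeasurable.mul ?_) (ae_of_all _ fun s => ?_)
      · exact ((hO.dist measurable_const).pow_const 2).aestronglyMeasurable
      · rw [norm_mul, Real.norm_eq_abs]
        have h1 : ‖f s u‖ ≤ M := by
          have h2 : 0 ≤ f s u := sq_nonneg (dist (O s) (φ.symm u))
          rw [Real.norm_of_nonneg h2]
          exact hM _ _
        gcongr)
    hwL (by
      filter_upwards [hsmooth] with s hs
      refine ⟨contDiffOn_const.mul hs.1, fun u hu => ?_⟩
      rw [hd s hs.1 u hu, hdd s hs.1 u hu, norm_smul, norm_smul, Real.norm_eq_abs]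
      exact ⟨mul_le_mul_of_nonneg_left (hs.2 u hu).1 (abs_nonneg _),
        mul_le_mul_of_nonneg_left (hs.2 u hu).2 (abs_nonneg _)⟩)
  refine ⟨hmain.1, fun u hu => ?_⟩
  obtain ⟨h1, h2, h3, h4⟩ := hmain.2 u hu
  refine ⟨fun h => ?_, fun h k => ?_⟩
  · change fderiv ℝ (fun u => ∫ s, w s * f s u ∂P) u h = _
    rw [h2, ContinuousLinearMap.integral_apply h1]
    refine integral_congr_ae ?_
    filter_upwards [hsmooth] with s hs
    rw [hd s hs.1 u hu]
    rfl
  · change fderiv ℝ (fderiv ℝ (fun u => ∫ s, w s * f s u ∂P)) u h k = _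
    rw [h4, ContinuousLinearMap.integral_apply h3,
      ContinuousLinearMap.integral_apply (h3.apply_continuousLinearMap h)]
    refine integral_congr_ae ?_
    filter_upwards [hsmooth] with s hs
    rw [hdd s hs.1 u hu]
    rfl

/-- Minimality makes the Hessian positive semidefinite, and a semidefinite invertible matrix is
definite. -/
lemma posDef_hessian_of_isLocalMin {f : EuclideanSpace ℝ (Fin p) → ℝ}
    {u : EuclideanSpace ℝ (Fin p)} (hf : ContDiffAt ℝ 2 f u) (hmin : IsLocalMin f u)
    (hH : IsUnit (hessian f u)) : (hessian f u).PosDef ∧ (hessian f u).IsSymm := by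
  have hsymm : (hessian f u).IsSymm := by
    ext i j
    exact hf.isSymmSndFDerivAt (by simp) _ _
  refine ⟨Matrix.PosSemidef.posDef_iff_isUnit
    (Matrix.PosSemidef.of_dotProduct_mulVec_nonneg ?_ fun x => ?_) |>.2 hH, hsymm⟩
  · rw [Matrix.IsHermitian, Matrix.conjTranspose_eq_transpose_of_trivial]
    exact hsymm
  · have h1 := fderiv_fderiv_nonneg_of_isLocalMin hf hmin (WithLp.toLp 2 x)
    rw [← quadForm_eq_of_bilin] at h1
    refine h1.trans_eq ?_
    simp only [quadForm, dotProduct, Matrix.mulVec, star_trivial, Finset.mul_sum, hessian,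
      Matrix.of_apply]
    refine Finset.sum_congr rfl fun i _ => Finset.sum_congr rfl fun j _ => by ring

end Population

/-! ### Measurability and moments of the data. -/

section Data

variable {m : ℕ}

lemma exists_norm_le_of_eq_id_or_const {η : (Fin m → ℝ) → (Fin m → ℝ)}
    (hη : η = id ∨ ∃ x : Fin m → ℝ, η = fun _ => x) :
    Measurable η ∧ ∃ c, 0 ≤ c ∧ ∀ x, ‖η x‖ ≤ ‖x‖ + c := by
  rcases hη with rfl | ⟨x, rfl⟩
  · exact ⟨measurable_id, 0, le_rfl, fun x => by simp⟩
  · exact ⟨measurable_const, ‖x‖, norm_nonneg _, fun y => by simp⟩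

lemma measurable_augment (j : Option (Fin m)) : Measurable fun x : Fin m → ℝ => augment x j := by
  cases j with
  | none => exact measurable_const
  | some j => exact measurable_pi_apply j

lemma measurable_weightMonomial {α : Type*} [MeasurableSpace α] {x z y : α → Fin m → ℝ}
    (hx : Measurable x) (hz : Measurable z) (hy : Measurable y)
    (k : Bool × Option (Fin m) × Option (Fin m)) :
    Measurable fun d => weightMonomial (x d) (z d) (y d) k := by
  have h1 : Measurable fun d => bif k.1 then z d else y d := by
    cases k.1
    · exact hy
    · exact hz
  exact ((measurable_augment _).comp hx).mul ((measurable_augment _).comp h1)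

lemma memLp_norm_sq {𝒮 E : Type*} [MeasurableSpace 𝒮] {P : Measure 𝒮} [NormedAddCommGroup E]
    {X : 𝒮 → E} (hX : MemLp X 4 P) : MemLp (fun s => ‖X s‖ ^ 2) 2 P := by
  have h1 := hX.norm_rpow_div 2
  have h2 : (4 : ENNReal) / 2 = 2 := by
    rw [show (4 : ENNReal) = 2 * 2 by norm_num]
    exact ENNReal.mul_div_cancel_right two_ne_zero ENNReal.ofNat_ne_top
  rw [h2] at h1
  simpa using h1

end Data

/-! ### The empirical gradient as a function of an i.i.d. mean. -/

section MeanScore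

variable {m p : ℕ}

/-- The gradient of the empirical objective as a function of the sample means of the moments and of
the weighted gradients. -/
def meanScore (v : MomentSpace m × (Bool × Option (Fin m) × Option (Fin m) →
    EuclideanSpace ℝ (Fin p))) : EuclideanSpace ℝ (Fin p) :=
  ∑ α, momentCoef v.1 α • v.2 α

lemma measurable_meanScore : Measurable (meanScore (m := m) (p := p)) := by
  unfold meanScore
  refine Finset.measurable_sum _ fun α _ => ?_
  have h1 : Measurable fun v : MomentSpace m × (Bool × Option (Fin m) × Option (Fin m) →
    EuclideanSpace ℝ (Fin p)) => momentCoef v.1 α := (measurable_momentCoef α).comp measurable_fst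
  have h2 : Measurable fun v : MomentSpace m × (Bool × Option (Fin m) × Option (Fin m) →
    EuclideanSpace ℝ (Fin p)) => v.2 α := (measurable_pi_apply α).comp measurable_snd
  exact h1.smul h2

lemma exists_hasFDerivAt_meanScore {v : MomentSpace m} (hS : IsUnit (momentCov v))
    (hC : IsUnit (momentCrossCov v))
    (T : Bool × Option (Fin m) × Option (Fin m) → EuclideanSpace ℝ (Fin p)) :
    ∃ A : (MomentSpace m × (Bool × Option (Fin m) × Option (Fin m) →
        EuclideanSpace ℝ (Fin p))) →L[ℝ] EuclideanSpace ℝ (Fin p),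
      HasFDerivAt meanScore A (v, T) ∧ ∀ dv dT, A (dv, dT) =
        ∑ α, (fderiv ℝ (fun v : MomentSpace m => momentCoef v α) v dv • T α +
          momentCoef v α • dT α) := by
  have h1 : ∀ α, HasFDerivAt (fun w : MomentSpace m × (Bool × Option (Fin m) × Option (Fin m) →
      EuclideanSpace ℝ (Fin p)) => momentCoef w.1 α)
      ((fderiv ℝ (fun v : MomentSpace m => momentCoef v α) v).comp
        (ContinuousLinearMap.fst ℝ _ _)) (v, T) := fun α =>
    HasFDerivAt.comp (v, T) (g := fun v : MomentSpace m => momentCoef v α)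
      (differentiableAt_momentCoef hS hC α).hasFDerivAt hasFDerivAt_fst
  have h2 : ∀ α, HasFDerivAt (fun w : MomentSpace m × (Bool × Option (Fin m) × Option (Fin m) →
      EuclideanSpace ℝ (Fin p)) => w.2 α)
      ((ContinuousLinearMap.proj (R := ℝ) (φ := fun _ => EuclideanSpace ℝ (Fin p)) α).comp
        (ContinuousLinearMap.snd ℝ _ _)) (v, T) := fun α =>
    HasFDerivAt.comp (v, T) (g := fun T : Bool × Option (Fin m) × Option (Fin m) →
      EuclideanSpace ℝ (Fin p) => T α) (hasFDerivAt_apply α T) hasFDerivAt_snd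
  have h3 := HasFDerivAt.fun_sum fun α (_ : α ∈ Finset.univ) => (h1 α).smul (h2 α)
  refine ⟨_, h3, fun dv dT => ?_⟩
  rw [_root_.sum_apply]
  refine Finset.sum_congr rfl fun α _ => ?_
  simp [add_comm]

variable {Ω : Type*} [MetricSpace Ω]

lemma weight_sample_eq_sum (n : ℕ) (x y : ℕ → Fin m → ℝ) (x' z' y' : Fin m → ℝ) :
    weight (sampleCov n x x) (sampleCov n x y) (sampleMean n x) (sampleMean n y) x' z' y' =
      ∑ α, momentCoef ((n : ℝ)⁻¹ • ∑ i ∈ Finset.range n, moments (x i) (y i)) α *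
        weightMonomial x' z' y' α := by
  rw [weight_eq_sum, momentCoef_mean]

lemma gradient_empObjective {η : (Fin m → ℝ) → (Fin m → ℝ)} (n : ℕ) (x y : ℕ → Fin m → ℝ)
    (o : ℕ → Ω) {φ : OpenPartialHomeomorph Ω (EuclideanSpace ℝ (Fin p))}
    {u : EuclideanSpace ℝ (Fin p)} {g : ℕ → EuclideanSpace ℝ (Fin p)}
    (hg : ∀ i, HasGradientAt (inCoords φ fun w => dist (o i) w ^ 2) (g i) u) :
    gradient (inCoords φ (empObjective η n x y o)) u = (n : ℝ)⁻¹ • ∑ i ∈ Finset.range n,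
      weight (sampleCov n x x) (sampleCov n x y)
        (sampleMean n x) (sampleMean n y) (x i) (η (x i)) (y i) • g i := by
  refine HasGradientAt.gradient ?_
  rw [hasGradientAt_iff_hasFDerivAt]
  have h2 := (HasFDerivAt.fun_sum fun i (_ : i ∈ Finset.range n) =>
    (hasGradientAt_iff_hasFDerivAt.1 (hg i)).const_mul (weight (sampleCov n x x) (sampleCov n x y)
      (sampleMean n x) (sampleMean n y) (x i) (η (x i)) (y i))).const_mul (n : ℝ)⁻¹
  refine h2.congr_fderiv ?_
  simp [map_sum, map_smul]

lemma gradient_empObjective_eq_meanScore {η : (Fin m → ℝ) → (Fin m → ℝ)} (n : ℕ)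
    (x y : ℕ → Fin m → ℝ) (o : ℕ → Ω) {φ : OpenPartialHomeomorph Ω (EuclideanSpace ℝ (Fin p))}
    {u : EuclideanSpace ℝ (Fin p)} {g : ℕ → EuclideanSpace ℝ (Fin p)}
    (hg : ∀ i, HasGradientAt (inCoords φ fun w => dist (o i) w ^ 2) (g i) u) :
    gradient (inCoords φ (empObjective η n x y o)) u = meanScore
      ((n : ℝ)⁻¹ • ∑ i ∈ Finset.range n, (moments (x i) (y i),
        fun α => weightMonomial (x i) (η (x i)) (y i) α • g i)) := by
  rw [gradient_empObjective n x y o hg]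
  simp only [weight_sample_eq_sum]
  rw [mean_weight_smul, meanScore]
  refine Finset.sum_congr rfl fun α _ => ?_
  congr 1
  · simp [Prod.fst_sum]
  · simp [Prod.snd_sum, Finset.sum_apply]

end MeanScore

/-! ### The score and the first order condition. -/

section Score

variable {𝒮 : Type*} [MeasurableSpace 𝒮] {P : Measure 𝒮} [IsProbabilityMeasure P] {m p : ℕ}
  {Ω : Type*} [MetricSpace Ω]

lemma popWeight_eq_sum {X Y : 𝒮 → Fin m → ℝ} (hX : MemLp X 2 P) (hY : MemLp Y 2 P)
    (x z y : Fin m → ℝ) :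
    popWeight P X Y x z y =
      ∑ α, momentCoef (∫ s, moments (X s) (Y s) ∂P) α * weightMonomial x z y α := by
  obtain ⟨-, h1, h2, h3, h4⟩ := momentCov_integral hX hY
  rw [popWeight, weight_eq_sum, ← h1, ← h2, ← h3, ← h4]
  rfl

/-- The score is the linearization of the gradient of the empirical objective. -/
lemma score_eq_linearization {X Y : 𝒮 → Fin m → ℝ} (hX : MemLp X 2 P) (hY : MemLp Y 2 P)
    (hS : IsUnit (popCov P X X)) (hC : IsUnit (popCov P X Y)) (η : (Fin m → ℝ) → (Fin m → ℝ))
    {O : 𝒮 → Ω} {φ : OpenPartialHomeomorph Ω (EuclideanSpace ℝ (Fin p))} {ζ : Ω}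
    {g : Ω → EuclideanSpace ℝ (Fin p)} (hg : ∀ᵐ s ∂P, distGrad φ ζ (O s) = g (O s))
    (hint : ∀ α, Integrable (fun s => weightMonomial (X s) (η (X s)) (Y s) α • g (O s)) P)
    (h0 : ∑ α, momentCoef (∫ s, moments (X s) (Y s) ∂P) α •
      ∫ s, weightMonomial (X s) (η (X s)) (Y s) α • g (O s) ∂P = 0) :
    score P η X Y O φ ζ =ᵐ[P] fun s =>
      ∑ α, (fderiv ℝ (fun v : MomentSpace m => momentCoef v α) (∫ s, moments (X s) (Y s) ∂P)
          (moments (X s) (Y s) - ∫ s, moments (X s) (Y s) ∂P) •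
          (∫ s, weightMonomial (X s) (η (X s)) (Y s) α • g (O s) ∂P) +
        momentCoef (∫ s, moments (X s) (Y s) ∂P) α •
          (weightMonomial (X s) (η (X s)) (Y s) α • g (O s) -
            ∫ s, weightMonomial (X s) (η (X s)) (Y s) α • g (O s) ∂P)) := by
  obtain ⟨-, h1, h2, h3, h4⟩ := momentCov_integral hX hY
  filter_upwards [hg] with s hs
  rw [score, popWeight_eq_sum hX hY, hs]
  set v := ∫ s, moments (X s) (Y s) ∂P
  set T := fun α => ∫ s, weightMonomial (X s) (η (X s)) (Y s) α • g (O s) ∂P with hT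
  have e1 : ∫ t, weightDeriv (popCov P X X) (popCov P X Y) (popMean P X) (popMean P Y)
        (vecMulVec (X s - popMean P X) (X s - popMean P X) - popCov P X X)
        (vecMulVec (X s - popMean P X) (Y s - popMean P Y) - popCov P X Y)
        (X s - popMean P X) (Y s - popMean P Y)
        (X t) (η (X t)) (Y t) • distGrad φ ζ (O t) ∂P =
      ∑ α, fderiv ℝ (fun v : MomentSpace m =>
          momentCoef v α) v (moments (X s) (Y s) - v) • T α := by
    simp only [hT]
    simp only [← integral_smul]
    refine Eq.trans (integral_congr_ae ?_) (integral_finsetSum _ fun α _ => (hint α).fun_smul _)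
    filter_upwards [hg] with t ht
    rw [ht, ← h1, ← h2, ← h3, ← h4, ← sum_fderiv_momentCoef (h1 ▸ hS) (h2 ▸ hC), Finset.sum_smul]
    simp only [smul_smul, v]
  rw [e1, Finset.sum_smul, Finset.sum_add_distrib]
  simp only [smul_sub, Finset.sum_sub_distrib]
  simp only [hT] at h0 ⊢
  -- The centering term is the population gradient at `ζ`, which vanishes; so the uncentered weight
  -- term of the score is the correct one.
  rw [h0, sub_zero, add_comm]
  simp only [smul_smul]


variable [SecondCountableTopology Ω] [MeasurableSpace Ω] [BorelSpace Ω]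

/-- Smoothness and first and second order conditions for the population objective. -/
lemma popObjective_contDiff {X Y : 𝒮 → Fin m → ℝ} (hX : MemLp X 2 P) (hY : MemLp Y 2 P)
    {η : (Fin m → ℝ) → (Fin m → ℝ)} {O : 𝒮 → Ω} (hO : Measurable O)
    {M : ℝ} (hM : ∀ o w : Ω, dist o w ^ 2 ≤ M) {ζ : Ω}
    (hζmin : ∀ w, popObjective P η X Y O ζ ≤ popObjective P η X Y O w)
    {φ : OpenPartialHomeomorph Ω (EuclideanSpace ℝ (Fin p))} (hζφ : ζ ∈ φ.source)
    {U : Set (EuclideanSpace ℝ (Fin p))} (hU : IsOpen U) (hζU : φ ζ ∈ U) {L : Ω → ℝ}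
    (hsmooth : ∀ᵐ s ∂P, ContDiffOn ℝ 2 (inCoords φ fun v => dist (O s) v ^ 2) U ∧
      ∀ u ∈ U, ‖fderiv ℝ (inCoords φ fun v => dist (O s) v ^ 2) u‖ ≤ L (O s) ∧
        ‖fderiv ℝ (fderiv ℝ (inCoords φ fun v => dist (O s) v ^ 2)) u‖ ≤ L (O s))
    (hq : ∀ α, Integrable (fun s => weightMonomial (X s) (η (X s)) (Y s) α) P)
    (hqL : ∀ α, Integrable (fun s => |weightMonomial (X s) (η (X s)) (Y s) α| * L (O s)) P)
    (hLm : AEStronglyMeasurable (fun s => L (O s)) P)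
    {g : Ω → EuclideanSpace ℝ (Fin p)} (hg : ∀ᵐ s ∂P, distGrad φ ζ (O s) = g (O s))
    (hqg : ∀ α, Integrable (fun s => weightMonomial (X s) (η (X s)) (Y s) α • g (O s)) P)
    {B : Ω → Fin p → Fin p → ℝ}
    (hB : ∀ᵐ s ∂P, ∀ i j, fderiv ℝ (fderiv ℝ (inCoords φ fun w => dist (O s) w ^ 2)) (φ ζ)
        (EuclideanSpace.single i 1) (EuclideanSpace.single j 1) = B (O s) i j)
    (hqB : ∀ α i j, Integrable (fun s => weightMonomial (X s) (η (X s)) (Y s) α * B (O s) i j) P) :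
    ContDiffAt ℝ 2 (inCoords φ (popObjective P η X Y O)) (φ ζ) ∧
    IsLocalMin (inCoords φ (popObjective P η X Y O)) (φ ζ) ∧
    ∑ α, momentCoef (∫ s, moments (X s) (Y s) ∂P) α •
      ∫ s, weightMonomial (X s) (η (X s)) (Y s) α • g (O s) ∂P = 0 ∧
    hessian (inCoords φ (popObjective P η X Y O)) (φ ζ) = fun i j =>
      ∑ α, momentCoef (∫ s, moments (X s) (Y s) ∂P) α *
        ∫ s, weightMonomial (X s) (η (X s)) (Y s) α * B (O s) i j ∂P := by
  set c₀ := fun α => momentCoef (∫ s, moments (X s) (Y s) ∂P) α with hc₀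
  set q := fun (s : 𝒮) α => weightMonomial (X s) (η (X s)) (Y s) α with hqdef
  have hw : ∀ s, popWeight P X Y (X s) (η (X s)) (Y s) = ∑ α, c₀ α * q s α := fun s =>
    popWeight_eq_sum hX hY _ _ _
  have hwi : Integrable (fun s => popWeight P X Y (X s) (η (X s)) (Y s)) P := by
    simp only [hw]
    exact integrable_finsetSum _ fun α _ => (hq α).const_mul _
  have hwL : Integrable (fun s => |popWeight P X Y (X s) (η (X s)) (Y s)| * L (O s)) P := by
    have h1 : Integrable (fun s => ∑ α, |c₀ α| * (|q s α| * L (O s))) P :=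
      integrable_finsetSum _ fun α _ => (hqL α).const_mul _
    refine h1.mono' (hwi.aestronglyMeasurable.norm.mul hLm) ?_
    filter_upwards [hsmooth] with s hs
    have hL0 : 0 ≤ L (O s) := (norm_nonneg _).trans (hs.2 _ hζU).1
    rw [norm_mul, Real.norm_of_nonneg hL0, Real.norm_eq_abs, abs_abs, hw]
    simp only [← mul_assoc, ← Finset.sum_mul, ← abs_mul]
    gcongr
    exact Finset.abs_sum_le_sum_abs _ _
  obtain ⟨h1, h2⟩ := inCoords_integral_contDiff hO hwi hM hwL hU hsmooth
  obtain ⟨h3, h4⟩ := h2 _ hζU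
  -- Minimality over all of `Ω` makes the inequality hold for every `u`, even outside the chart,
  -- where `φ.symm u` is still a point of `Ω`.
  have hmin : IsLocalMin (inCoords φ (popObjective P η X Y O)) (φ ζ) :=
    Eventually.of_forall fun u => by
      simp only [inCoords, φ.left_inv hζφ]
      exact hζmin _
  refine ⟨h1.contDiffAt (hU.mem_nhds hζU), hmin, ?_, ?_⟩
  · have h5 : ∫ s, popWeight P X Y (X s) (η (X s)) (Y s) • g (O s) ∂P =
        ∑ α, c₀ α • ∫ s, q s α • g (O s) ∂P := by
      simp only [hw, Finset.sum_smul, mul_smul]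
      rw [integral_finsetSum _ fun α _ => (hqg α).fun_smul (c₀ α)]
      simp only [integral_smul]
      rfl
    have h6 : Integrable (fun s => popWeight P X Y (X s) (η (X s)) (Y s) • g (O s)) P := by
      simp only [hw, Finset.sum_smul, mul_smul]
      exact integrable_finsetSum _ fun α _ => (hqg α).fun_smul (c₀ α)
    rw [← h5]
    refine ext_inner_right ℝ fun h => ?_
    rw [inner_zero_left, real_inner_comm, ← integral_inner h6]
    have h7 := h3 h
    have h8 : fderiv ℝ (inCoords φ fun v => ∫ s, popWeight P X Y (X s) (η (X s)) (Y s) *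
      dist (O s) v ^ 2 ∂P) (φ ζ) = 0 := hmin.fderiv_eq_zero
    rw [h8] at h7
    refine Eq.trans (integral_congr_ae ?_) h7.symm
    filter_upwards [hg] with s hs
    rw [← hs, real_inner_smul_right, real_inner_comm, distGrad, inner_gradient_left]
  · ext i j
    refine (h4 _ _).trans ?_
    have h5 : ∑ α, c₀ α * ∫ s, q s α * B (O s) i j ∂P =
        ∫ s, ∑ α, c₀ α * (q s α * B (O s) i j) ∂P := by
      rw [integral_finsetSum _ fun α _ => (hqB α i j).const_mul (c₀ α)]
      simp only [integral_const_mul]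
      rfl
    refine Eq.trans (integral_congr_ae ?_) h5.symm
    filter_upwards [hB] with s hs
    rw [hw, hs]
    simp only [← mul_assoc, Finset.sum_mul]

end Score

/-! ### Linearization of the estimator along a fixed sample. -/

section Estimator

variable {m p : ℕ} {Ω : Type*} [MetricSpace Ω]

/-- The minimizers of the empirical objective are asymptotically linear in the gradient at the
minimizer of the population objective. -/
lemma argmin_linearization {η : (Fin m → ℝ) → (Fin m → ℝ)} {x y : ℕ → Fin m → ℝ} {o : ℕ → Ω}
    {c₀ : Bool × Option (Fin m) × Option (Fin m) → ℝ}
    (hc : ∀ α, Tendsto (fun n : ℕ => momentCoef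
      ((n : ℝ)⁻¹ • ∑ i ∈ Finset.range n, moments (x i) (y i)) α) atTop (𝓝 (c₀ α)))
    {e : Bool × Option (Fin m) × Option (Fin m) → Ω → ℝ} {C : ℝ} (hC : ∀ α v, |e α v| ≤ C)
    (hunif : ∀ α, ∀ ε > 0, ∀ᶠ n : ℕ in atTop, ∀ v,
      |(n : ℝ)⁻¹ * ∑ i ∈ Finset.range n, weightMonomial (x i) (η (x i)) (y i) α *
        dist (o i) v ^ 2 - e α v| ≤ ε) {ζ : Ω}
    (hsep : ∀ ε > 0, ∃ δ > 0, ∀ w, ε ≤ dist w ζ → ∑ α, c₀ α * e α ζ + δ ≤ ∑ α, c₀ α * e α w)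
    {φ : OpenPartialHomeomorph Ω (EuclideanSpace ℝ (Fin p))} (hζφ : ζ ∈ φ.source)
    {L : Ω → ℝ} {r : ℝ} (hr : 0 < r) {g : Ω → EuclideanSpace ℝ (Fin p)}
    {B : Ω → Fin p → Fin p → ℝ} {R : ℕ → Ω → ℝ} (hexp : ∀ i, HasExpansion φ ζ L r g B R (o i))
    {κ : ℕ → ℝ} (hκ : ∀ i, 0 ≤ κ i)
    (hqκ : ∀ i α, |weightMonomial (x i) (η (x i)) (y i) α| ≤ κ i)
    {b : Bool × Option (Fin m) × Option (Fin m) → Fin p → Fin p → ℝ}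
    (hB : ∀ α j k, Tendsto (fun n : ℕ => (n : ℝ)⁻¹ * ∑ i ∈ Finset.range n,
      weightMonomial (x i) (η (x i)) (y i) α * B (o i) j k) atTop (𝓝 (b α j k)))
    {ρ : ℕ → ℝ} (hR : ∀ k, Tendsto (fun n : ℕ => (n : ℝ)⁻¹ * ∑ i ∈ Finset.range n,
      κ i * R k (o i)) atTop (𝓝 (ρ k))) (hρ : Tendsto ρ atTop (𝓝 0))
    {H : Matrix (Fin p) (Fin p) ℝ} (hH : H.PosDef)
    (hHb : H = fun j k => ∑ α, c₀ α * b α j k)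
    (hG : Tendsto (fun n => gradient (inCoords φ (empObjective η n x y o)) (φ ζ)) atTop (𝓝 0))
    {ζhat : ℕ → Ω} (hmin : ∀ᶠ n in atTop, ∀ w,
      empObjective η n x y o (ζhat n) ≤ empObjective η n x y o w) {ε : ℝ} (hε : 0 < ε) :
    ∀ᶠ n in atTop, ‖(φ (ζhat n) - φ ζ) + Matrix.toEuclideanCLM (𝕜 := ℝ) H⁻¹
        (gradient (inCoords φ (empObjective η n x y o)) (φ ζ))‖ ≤
      ε * ‖gradient (inCoords φ (empObjective η n x y o)) (φ ζ)‖ := by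
  have hζ : Tendsto ζhat atTop (𝓝 ζ) := by
    refine tendsto_of_argmin (f := fun n => empObjective η n x y o)
      (F := fun w => ∑ α, c₀ α * e α w) (fun ε hε => ?_) hsep hmin
    have h1 := uniform_weighted_mean hc hC hunif hε
    simp only [empObjective, weight_sample_eq_sum]
    exact h1
  have hsrc : ∀ᶠ n in atTop, ζhat n ∈ φ.source := hζ.eventually (φ.open_source.mem_nhds hζφ)
  have hφζ : Tendsto (fun n => φ (ζhat n) - φ ζ) atTop (𝓝 0) := by
    rw [← sub_self (φ ζ)]
    exact ((φ.continuousAt hζφ).tendsto.comp hζ).sub_const _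
  obtain ⟨c, hcpos, hcoer⟩ := exists_coercive_of_posDef hH
  -- Any radius would do, since the estimator minimizes over the whole space.
  refine eventually_norm_argmin_sub_le (ρ := 1)
    (f := fun n h => inCoords φ (empObjective η n x y o) (φ ζ + h))
    (H := Matrix.toEuclideanCLM (𝕜 := ℝ) H) hcpos hcoer (fun v w => ?_) (fun v => ?_) ?_ hG hφζ
    one_pos ?_ hε
  · have h1 : (Matrix.toEuclideanCLM (𝕜 := ℝ) H).adjoint = Matrix.toEuclideanCLM (𝕜 := ℝ) H := by
      have h2 := map_star (Matrix.toEuclideanCLM (𝕜 := ℝ) (n := Fin p)) H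
      rw [Matrix.star_eq_conjTranspose, hH.isHermitian.eq] at h2
      exact h2.symm
    conv_lhs => rw [← h1]
    rw [ContinuousLinearMap.adjoint_inner_left]
  · rw [← mul_apply_eq_comp, ← map_mul,
      Matrix.mul_nonsing_inv _ ((Matrix.isUnit_iff_isUnit_det _).1 hH.isUnit), map_one]
    rfl
  · intro ε hε
    obtain ⟨δ, hδ, h1⟩ := weighted_mean_expansion hc hκ hqκ
      (a := fun i h => inCoords φ (fun w => dist (o i) w ^ 2) (φ ζ + h)) (g := fun i => g (o i))
      (B := fun i => B (o i)) (R := fun k i => R k (o i)) hr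
      (fun i k h hh => by simpa only [add_zero] using (hexp i).expansion k h hh) hB hR hρ hε
    refine ⟨δ, hδ, ?_⟩
    filter_upwards [h1] with n hn h hh
    have h2 := hn h hh
    rw [← hHb, quadForm_eq_inner] at h2
    simp only [← weight_sample_eq_sum] at h2
    rw [gradient_empObjective n x y o fun i => (hexp i).hasGradientAt hr]
    exact h2
  · filter_upwards [hmin, hsrc] with n hn hs h _
    simp only [inCoords, add_sub_cancel, φ.left_inv hs]
    exact hn _

end Estimator

/-! ### Integrability of the moments and the derivative that gives the score. -/

section SampleSpace

variable {𝒮 : Type*} [MeasurableSpace 𝒮] {P : Measure 𝒮}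

lemma measurable_mean {W : Type*} [NormedAddCommGroup W] [NormedSpace ℝ W] [MeasurableSpace W]
    [BorelSpace W] [SecondCountableTopology W] {V : ℕ → 𝒮 → W} (hV : ∀ i, Measurable (V i))
    (n : ℕ) : Measurable fun s => (n : ℝ)⁻¹ • ∑ i ∈ Finset.range n, V i s :=
  (Finset.measurable_sum _ fun i _ => hV i).const_smul _

lemma covariance_congr_ae {f f' g g' : 𝒮 → ℝ} (hf : f =ᵐ[P] f') (hg : g =ᵐ[P] g') :
    cov[f, g; P] = cov[f', g'; P] := by
  simp only [covariance, integral_congr_ae hf, integral_congr_ae hg]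
  refine integral_congr_ae ?_
  filter_upwards [hf, hg] with s h1 h2
  rw [h1, h2]

variable [IsProbabilityMeasure P] {m p : ℕ}

lemma memLp_one_add_norm_sq {X Y : 𝒮 → Fin m → ℝ} (hX : MemLp X 4 P) (hY : MemLp Y 4 P) :
    MemLp (fun s => 1 + ‖X s‖ ^ 2 + ‖Y s‖ ^ 2) 2 P := by
  have h1 : MemLp (fun _ : 𝒮 => (1 : ℝ)) 2 P := memLp_const 1
  have h2 := memLp_norm_sq hX
  have h3 := memLp_norm_sq hY
  exact (h1.add h2).add h3

lemma norm_moments_le (x y : Fin m → ℝ) : ‖moments x y‖ ≤ 1 + ‖x‖ ^ 2 + ‖y‖ ^ 2 := by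
  have hx : ∀ j, ‖x j‖ ≤ ‖x‖ := norm_le_pi_norm x
  have hy : ∀ j, ‖y j‖ ≤ ‖y‖ := norm_le_pi_norm y
  have h0 : 0 ≤ 1 + ‖x‖ ^ 2 + ‖y‖ ^ 2 := by positivity
  refine max_le ?_ (max_le ?_ (max_le ?_ ?_))
  · refine (pi_norm_le_iff_of_nonneg h0).2 fun j => (pi_norm_le_iff_of_nonneg h0).2 fun k => ?_
    simp only [moments, norm_mul]
    nlinarith [mul_le_mul (hx j) (hx k) (norm_nonneg _) (norm_nonneg _), sq_nonneg ‖y‖]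
  · refine (pi_norm_le_iff_of_nonneg h0).2 fun j => (pi_norm_le_iff_of_nonneg h0).2 fun k => ?_
    simp only [moments, norm_mul]
    nlinarith [mul_le_mul (hx j) (hy k) (norm_nonneg _) (norm_nonneg _), sq_nonneg (‖x‖ - ‖y‖),
      sq_nonneg ‖x‖, sq_nonneg ‖y‖]
  · simp only [moments]
    nlinarith [sq_nonneg (‖x‖ - 1), sq_nonneg ‖y‖, sq_nonneg ‖x‖]
  · simp only [moments]
    nlinarith [sq_nonneg (‖y‖ - 1), sq_nonneg ‖y‖, sq_nonneg ‖x‖]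

lemma memLp_moments {X Y : 𝒮 → Fin m → ℝ} (hX : MemLp X 4 P) (hY : MemLp Y 4 P)
    (hXm : Measurable X) (hYm : Measurable Y) : MemLp (fun s => moments (X s) (Y s)) 2 P :=
  (memLp_one_add_norm_sq hX hY).mono'
    (measurable_moments.comp (hXm.prodMk hYm)).aestronglyMeasurable
    (ae_of_all _ fun _ => norm_moments_le _ _)

variable {Ω : Type*} [MetricSpace Ω]

/-- This gathers what the delta method needs: differentiability of `meanScore` at `E V`, the value
zero there, and the score as the linearized variable. -/
lemma exists_hasFDerivAt_score {X Y : 𝒮 → Fin m → ℝ} (hX : MemLp X 2 P) (hY : MemLp Y 2 P)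
    (hS : IsUnit (popCov P X X)) (hC : IsUnit (popCov P X Y)) (η : (Fin m → ℝ) → (Fin m → ℝ))
    {O : 𝒮 → Ω} {φ : OpenPartialHomeomorph Ω (EuclideanSpace ℝ (Fin p))} {ζ : Ω}
    {g : Ω → EuclideanSpace ℝ (Fin p)} (hg : ∀ᵐ s ∂P, distGrad φ ζ (O s) = g (O s))
    (hint : ∀ α, Integrable (fun s => weightMonomial (X s) (η (X s)) (Y s) α • g (O s)) P)
    (h0 : ∑ α, momentCoef (∫ s, moments (X s) (Y s) ∂P) α •
      ∫ s, weightMonomial (X s) (η (X s)) (Y s) α • g (O s) ∂P = 0) {V : 𝒮 → MomentSpace m ×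
        (Bool × Option (Fin m) × Option (Fin m) → EuclideanSpace ℝ (Fin p))}
    (hV : V = fun s => (moments (X s) (Y s),
      fun α => weightMonomial (X s) (η (X s)) (Y s) α • g (O s))) :
    ∃ A : (MomentSpace m × (Bool × Option (Fin m) × Option (Fin m) →
        EuclideanSpace ℝ (Fin p))) →L[ℝ] EuclideanSpace ℝ (Fin p),
      HasFDerivAt meanScore A P[V] ∧ meanScore P[V] = 0 ∧
      score P η X Y O φ ζ =ᵐ[P] fun s => A (V s - P[V]) := by
  obtain ⟨hi, h1, h2, -, -⟩ := momentCov_integral hX hY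
  have hEV : P[V] = (∫ s, moments (X s) (Y s) ∂P,
      fun α => ∫ s, weightMonomial (X s) (η (X s)) (Y s) α • g (O s) ∂P) := by
    rw [hV, integral_pair hi (Integrable.of_eval hint)]
    refine Prod.ext rfl (funext fun α => ?_)
    exact eval_integral hint α
  obtain ⟨A, hA, hA'⟩ := exists_hasFDerivAt_meanScore (h1 ▸ hS) (h2 ▸ hC)
    (fun α => ∫ s, weightMonomial (X s) (η (X s)) (Y s) α • g (O s) ∂P)
  rw [hEV]
  refine ⟨A, hA, h0, (score_eq_linearization hX hY hS hC η hg hint h0).trans ?_⟩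
  refine ae_of_all _ fun s => ?_
  rw [hV]
  exact (hA' _ _).symm

variable [SecondCountableTopology Ω] [MeasurableSpace Ω] [BorelSpace Ω]

lemma popObjective_eq_sum {X Y : 𝒮 → Fin m → ℝ} (hX : MemLp X 2 P) (hY : MemLp Y 2 P)
    {η : (Fin m → ℝ) → (Fin m → ℝ)} {O : 𝒮 → Ω} (hO : Measurable O)
    {M : ℝ} (hM : ∀ o w : Ω, dist o w ^ 2 ≤ M)
    (hq : ∀ α, Integrable (fun s => weightMonomial (X s) (η (X s)) (Y s) α) P) (w : Ω) :
    popObjective P η X Y O w = ∑ α, momentCoef (∫ s, moments (X s) (Y s) ∂P) α *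
      ∫ s, weightMonomial (X s) (η (X s)) (Y s) α * dist (O s) w ^ 2 ∂P := by
  have hi : ∀ α, Integrable
      (fun s => weightMonomial (X s) (η (X s)) (Y s) α * dist (O s) w ^ 2) P := fun α =>
    (hq α).mul_bdd (c := M)
      ((hO.dist measurable_const).pow_const 2).aestronglyMeasurable (ae_of_all _ fun s => by
        rw [Real.norm_of_nonneg (sq_nonneg _)]
        exact hM _ _)
  simp only [popObjective, popWeight_eq_sum hX hY, Finset.sum_mul, mul_assoc]
  rw [integral_finsetSum _ fun α _ => (hi α).const_mul _]
  simp only [integral_const_mul]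

end SampleSpace

end FrechetRegression

end

/-! ### The main theorem. -/

open FrechetRegression in
theorem lemma3
    {𝒮 : Type*} [MeasurableSpace 𝒮] (P : Measure 𝒮) [IsProbabilityMeasure P]
    {Ω : Type*} [MetricSpace Ω] [CompleteSpace Ω] [SecondCountableTopology Ω]
    [MeasurableSpace Ω] [BorelSpace Ω] {m p : ℕ}
    -- the data: i.i.d. predictors, response vectors and response objects
    (X Y : ℕ → 𝒮 → Fin m → ℝ) (O : ℕ → 𝒮 → Ω)
    (hX : ∀ i, Measurable (X i)) (hY : ∀ i, Measurable (Y i)) (hO : ∀ i, Measurable (O i))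
    (hindep : iIndepFun (fun i s => (X i s, Y i s, O i s)) P)
    (hident : ∀ i, IdentDistrib (fun s => (X i s, Y i s, O i s))
      (fun s => (X 0 s, Y 0 s, O 0 s)) P P)
    -- the point at which the first quadratic form of the weight is evaluated
    (η : (Fin m → ℝ) → (Fin m → ℝ)) (hη : η = id ∨ ∃ x : Fin m → ℝ, η = fun _ => x)
    -- moments and invertible covariance matrices
    (hX4 : MemLp (X 0) 4 P) (hY4 : MemLp (Y 0) 4 P)
    (hS : IsUnit (popCov P (X 0) (X 0))) (hC : IsUnit (popCov P (X 0) (Y 0)))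
    -- bounded squared distance
    (M : ℝ) (hM : ∀ o w : Ω, dist o w ^ 2 ≤ M)
    -- the true parameter: well-separated minimizer of the population objective
    (ζ : Ω) (hζmin : ∀ w, popObjective P η (X 0) (Y 0) (O 0) ζ ≤
      popObjective P η (X 0) (Y 0) (O 0) w)
    (hζsep : ∀ ε > 0, ∃ δ > 0, ∀ w, ε ≤ dist w ζ →
      popObjective P η (X 0) (Y 0) (O 0) ζ + δ ≤ popObjective P η (X 0) (Y 0) (O 0) w)
    -- coordinates around the true parameter
    (φ : OpenPartialHomeomorph Ω (EuclideanSpace ℝ (Fin p))) (hφ : Measurable φ)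
    (hζφ : ζ ∈ φ.source)
    -- smoothness of the squared distance near the true parameter
    (U : Set (EuclideanSpace ℝ (Fin p))) (hU : IsOpen U) (hζU : φ ζ ∈ U) (hUφ : U ⊆ φ.target)
    (L : Ω → ℝ) (hL : Measurable L)
    (hsmooth : ∀ᵐ s ∂P, ContDiffOn ℝ 2 (inCoords φ fun w => dist (O 0 s) w ^ 2) U ∧
      ∀ u ∈ U, ‖fderiv ℝ (inCoords φ fun w => dist (O 0 s) w ^ 2) u‖ ≤ L (O 0 s) ∧
        ‖fderiv ℝ (fderiv ℝ (inCoords φ fun w => dist (O 0 s) w ^ 2)) u‖ ≤ L (O 0 s))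
    (hLint : MemLp (fun s => (1 + ‖X 0 s‖ ^ 2 + ‖Y 0 s‖ ^ 2) * L (O 0 s)) 2 P)
    -- nonsingular Hessian at the true parameter
    (hH : IsUnit (hessian (inCoords φ (popObjective P η (X 0) (Y 0) (O 0))) (φ ζ)))
    -- the estimator: a measurable minimizer of the empirical objective
    (ζhat : ℕ → 𝒮 → Ω) (hζhat : ∀ n, Measurable (ζhat n))
    (hargmin : ∀ᶠ n in atTop, ∀ᵐ s ∂P, ∀ w,
      empObjective η n (fun i => X i s) (fun i => Y i s) (fun i => O i s) (ζhat n s) ≤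
        empObjective η n (fun i => X i s) (fun i => Y i s) (fun i => O i s) w) :
    -- the matrices `H` and `Σ_ζ` are well defined
    ContDiffAt ℝ 2 (inCoords φ (popObjective P η (X 0) (Y 0) (O 0))) (φ ζ) ∧
    (hessian (inCoords φ (popObjective P η (X 0) (Y 0) (O 0))) (φ ζ)).PosDef ∧
    MemLp (score P η (X 0) (Y 0) (O 0) φ ζ) 2 P ∧
    (scoreCov P η (X 0) (Y 0) (O 0) φ ζ).PosSemidef ∧
    -- `Σ_ζ` is the asymptotic covariance matrix of the gradient of the objective at `ζ`
    TendstoInDistribution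
      (fun (n : ℕ) (s : 𝒮) => √(n : ℝ) •
        gradient (inCoords φ
          (empObjective η n (fun i => X i s) (fun i => Y i s) (fun i => O i s))) (φ ζ))
      atTop (id : EuclideanSpace ℝ (Fin p) → EuclideanSpace ℝ (Fin p)) (fun _ => P)
      (multivariateGaussian 0 (scoreCov P η (X 0) (Y 0) (O 0) φ ζ)) ∧
    -- asymptotic normality of the estimator
    TendstoInDistribution
      (fun (n : ℕ) (s : 𝒮) => √(n : ℝ) • (φ (ζhat n s) - φ ζ))
      atTop (id : EuclideanSpace ℝ (Fin p) → EuclideanSpace ℝ (Fin p)) (fun _ => P)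
      (multivariateGaussian 0
        ((hessian (inCoords φ (popObjective P η (X 0) (Y 0) (O 0))) (φ ζ))⁻¹ *
          scoreCov P η (X 0) (Y 0) (O 0) φ ζ *
          (hessian (inCoords φ (popObjective P η (X 0) (Y 0) (O 0))) (φ ζ))⁻¹)) := by
  have hΩ : Nonempty Ω := ⟨ζ⟩
  set D : ℕ → 𝒮 → (Fin m → ℝ) × (Fin m → ℝ) × Ω := fun i s => (X i s, Y i s, O i s) with hDdef
  have hD : ∀ i, Measurable (D i) := fun i => (hX i).prodMk ((hY i).prodMk (hO i))
  have hOid : ∀ i, IdentDistrib (O i) (O 0) P P := fun i =>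
    (hident i).comp (measurable_snd.comp measurable_snd)
  have hX2 : MemLp (X 0) 2 P := hX4.mono_exponent (by norm_num)
  have hY2 : MemLp (Y 0) 2 P := hY4.mono_exponent (by norm_num)
  obtain ⟨hηm, c, hc0, hηc⟩ := exists_norm_le_of_eq_id_or_const hη
  obtain ⟨r, g, B, R, hr, -, hgm, hBm, hRm, hexp, hg, hB⟩ :=
    exists_hasExpansion hO hOid hU hζU hUφ hL hsmooth
  let q : Bool × Option (Fin m) × Option (Fin m) → (Fin m → ℝ) × (Fin m → ℝ) × Ω → ℝ :=
    fun α d => weightMonomial d.1 (η d.1) d.2.1 α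
  -- A common envelope of the monomials; its product with `L` is square integrable and dominates
  -- gradients, Hessian entries and, doubled, the remainders.
  let κ : (Fin m → ℝ) × (Fin m → ℝ) × Ω → ℝ :=
    fun d => 3 * (1 + c) * (1 + ‖d.1‖ ^ 2 + ‖d.2.1‖ ^ 2)
  have hqm : ∀ α, Measurable (q α) := fun α =>
    measurable_weightMonomial measurable_fst (hηm.comp measurable_fst)
      (measurable_fst.comp measurable_snd) α
  have hκm : Measurable κ := by fun_prop
  have hκ0 : ∀ d, 0 ≤ κ d := fun d => by positivity
  have hqκ : ∀ α d, |q α d| ≤ κ d := fun α d => abs_weightMonomial_le hc0 (hηc _) α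
  have hOm : Measurable fun d : (Fin m → ℝ) × (Fin m → ℝ) × Ω => d.2.2 :=
    measurable_snd.comp measurable_snd
  have hκ1 : Integrable (fun s => κ (D 0 s)) P :=
    ((memLp_one_add_norm_sq hX4 hY4).integrable one_le_two).const_mul _
  have hκL2 : MemLp (fun s => κ (D 0 s) * L (O 0 s)) 2 P := by
    refine (hLint.const_mul (3 * (1 + c))).ae_eq (ae_of_all _ fun s => ?_)
    simp only [κ, D]
    ring
  have hκL1 : Integrable (fun s => κ (D 0 s) * L (O 0 s)) P := hκL2.integrable one_le_two
  have hq1 : ∀ α, Integrable (fun s => q α (D 0 s)) P := fun α =>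
    hκ1.mono' ((hqm α).comp (hD 0)).aestronglyMeasurable (ae_of_all _ fun s => hqκ α _)
  have hL0 : ∀ᵐ s ∂P, 0 ≤ L (O 0 s) := by
    filter_upwards [hexp 0] with s hs using (norm_nonneg _).trans hs.norm_grad_le
  have hqL : ∀ α, Integrable (fun s => |q α (D 0 s)| * L (O 0 s)) P := fun α => by
    refine hκL1.mono' (((hqm α).abs.comp (hD 0)).mul (hL.comp (hO 0))).aestronglyMeasurable ?_
    filter_upwards [hL0] with s hs
    rw [norm_mul, Real.norm_eq_abs, abs_abs, Real.norm_of_nonneg hs]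
    exact mul_le_mul_of_nonneg_right (hqκ α _) hs
  have hqgm : ∀ α, Measurable fun d : (Fin m → ℝ) × (Fin m → ℝ) × Ω => q α d • g d.2.2 :=
    fun α => (hqm α).smul (hgm.comp hOm)
  have hqg2 : ∀ α, MemLp (fun s => q α (D 0 s) • g (O 0 s)) 2 P := fun α => by
    refine hκL2.mono' ((hqgm α).comp (hD 0)).aestronglyMeasurable ?_
    filter_upwards [hexp 0] with s hs
    rw [norm_smul]
    exact mul_le_mul (hqκ α _) hs.norm_grad_le (norm_nonneg _) (hκ0 _)
  have hBjm : ∀ j k, Measurable fun o => B o j k := fun j k => by fun_prop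
  have hqBm : ∀ α j k, Measurable fun d : (Fin m → ℝ) × (Fin m → ℝ) × Ω =>
    q α d * B d.2.2 j k := fun α j k => (hqm α).mul ((hBjm j k).comp hOm)
  have hqB : ∀ α j k, Integrable (fun s => q α (D 0 s) * B (O 0 s) j k) P := fun α j k => by
    refine hκL1.mono' ((hqBm α j k).comp (hD 0)).aestronglyMeasurable ?_
    filter_upwards [hexp 0] with s hs
    rw [norm_mul]
    exact mul_le_mul (hqκ α _) (hs.abs_hess_le j k) (norm_nonneg _) (hκ0 _)
  have hκRm : ∀ k, Measurable fun d : (Fin m → ℝ) × (Fin m → ℝ) × Ω => κ d * R k d.2.2 :=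
    fun k => hκm.mul ((hRm k).comp hOm)
  have hκRle : ∀ k, ∀ᵐ s ∂P, ‖κ (D 0 s) * R k (O 0 s)‖ ≤ 2 * (κ (D 0 s) * L (O 0 s)) :=
    fun k => by
    filter_upwards [hexp 0] with s hs
    rw [norm_mul, Real.norm_of_nonneg (hκ0 _), Real.norm_of_nonneg (hs.nonneg k)]
    calc _ ≤ κ (D 0 s) * (2 * L (O 0 s)) := mul_le_mul_of_nonneg_left (hs.le k) (hκ0 _)
      _ = _ := by ring
  have hκR : ∀ k, Integrable (fun s => κ (D 0 s) * R k (O 0 s)) P := fun k =>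
    (hκL1.const_mul 2).mono' ((hκRm k).comp (hD 0)).aestronglyMeasurable (hκRle k)
  have hρ : Tendsto (fun k => ∫ s, κ (D 0 s) * R k (O 0 s) ∂P) atTop (𝓝 0) := by
    have h1 := tendsto_integral_of_dominated_convergence (μ := P)
      (F := fun k s => κ (D 0 s) * R k (O 0 s)) (f := fun _ => (0 : ℝ))
      (fun s => 2 * (κ (D 0 s) * L (O 0 s))) (fun k => (hκR k).aestronglyMeasurable)
      (hκL1.const_mul 2) hκRle (by
        filter_upwards [hexp 0] with s hs
        simpa using hs.tendsto.const_mul (κ (D 0 s)))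
    simpa using h1
  -- the population objective
  obtain ⟨hsm, hlmin, hgrad0, hHess⟩ := popObjective_contDiff hX2 hY2 (hO 0) hM hζmin hζφ hU hζU
    hsmooth hq1 hqL (hL.comp (hO 0)).aestronglyMeasurable hg
    (fun α => (hqg2 α).integrable one_le_two) hB hqB
  obtain ⟨hpos, hsymm⟩ := posDef_hessian_of_isLocalMin hsm hlmin hH
  -- the score
  let Vf : (Fin m → ℝ) × (Fin m → ℝ) × Ω → MomentSpace m ×
      (Bool × Option (Fin m) × Option (Fin m) → EuclideanSpace ℝ (Fin p)) :=
    fun d => (moments d.1 d.2.1, fun α => q α d • g d.2.2)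
  have hVf : Measurable Vf :=
    (measurable_moments.comp (measurable_fst.prodMk (measurable_fst.comp measurable_snd))).prodMk
      (measurable_pi_lambda _ hqgm)
  set V : ℕ → 𝒮 → MomentSpace m ×
      (Bool × Option (Fin m) × Option (Fin m) → EuclideanSpace ℝ (Fin p)) :=
    fun i s => Vf (D i s) with hVdef
  have hV2 : MemLp (V 0) 2 P :=
    MemLp.of_fst_snd ⟨memLp_moments hX4 hY4 (hX 0) (hY 0), MemLp.of_eval hqg2⟩
  have hVindep : iIndepFun V P := hindep.comp (fun _ => Vf) fun _ => hVf
  have hVid : ∀ i, IdentDistrib (V i) (V 0) P P := fun i => (hident i).comp hVf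
  obtain ⟨A, hA, hA0, hscore⟩ := exists_hasFDerivAt_score hX2 hY2 hS hC η hg
    (fun α => (hqg2 α).integrable one_le_two) hgrad0 (V := V 0) rfl
  have hAV2 : MemLp (fun s => A (V 0 s - P[V 0])) 2 P :=
    A.comp_memLp' (hV2.sub (memLp_const _))
  have hcov : scoreCov P η (X 0) (Y 0) (O 0) φ ζ = Matrix.of fun i j =>
      cov[fun s => A (V 0 s - P[V 0]) i, fun s => A (V 0 s - P[V 0]) j; P] := by
    ext i j
    refine covariance_congr_ae ?_ ?_
    · filter_upwards [hscore] with s hs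
      rw [hs]
    · filter_upwards [hscore] with s hs
      rw [hs]
  have hpsd : (scoreCov P η (X 0) (Y 0) (O 0) φ ζ).PosSemidef := by
    rw [hcov]
    exact posSemidef_covariance hAV2
  -- the gradient of the empirical objective
  have hexp' : ∀ᵐ s ∂P, ∀ i, HasExpansion φ ζ L r g B R (O i s) := ae_all_iff.2 hexp
  -- Besides the delta method, this identity supplies measurability: the gradient is almost surely
  -- equal to a measurable function of the data.
  have hgradV : ∀ n : ℕ, (fun s => meanScore ((n : ℝ)⁻¹ • ∑ i ∈ Finset.range n, V i s)) =ᵐ[P]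
      fun s => gradient (inCoords φ
        (empObjective η n (fun i => X i s) (fun i => Y i s) (fun i => O i s))) (φ ζ) := by
    intro n
    filter_upwards [hexp'] with s hs
    exact (gradient_empObjective_eq_meanScore n _ _ _ fun i => (hs i).hasGradientAt hr).symm
  have hVm : ∀ n : ℕ, Measurable fun s => (n : ℝ)⁻¹ • ∑ i ∈ Finset.range n, V i s :=
    measurable_mean fun i => hVf.comp (hD i)
  have hgradlim := tendstoInDistribution_delta hV2 hVindep hVid hA hA0
    fun n => (measurable_meanScore.comp (hVm n)).aemeasurable
  rw [← hcov] at hgradlim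
  have hGlim : TendstoInDistribution
      (fun (n : ℕ) (s : 𝒮) => √(n : ℝ) • gradient (inCoords φ
        (empObjective η n (fun i => X i s) (fun i => Y i s) (fun i => O i s))) (φ ζ))
      atTop (id : EuclideanSpace ℝ (Fin p) → EuclideanSpace ℝ (Fin p)) (fun _ => P)
      (multivariateGaussian 0 (scoreCov P η (X 0) (Y 0) (O 0) φ ζ)) := by
    refine hgradlim.congr (fun n => ?_) (ae_eq_refl _)
    filter_upwards [hgradV n] with s hs
    rw [hs]
  refine ⟨hsm, hpos, hAV2.ae_eq hscore.symm, hpsd, hGlim, ?_⟩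
  -- the estimator
  have hgradV' := ae_all_iff.2 hgradV
  have hdelta := ae_eventually_norm_delta_le (hV2.integrable one_le_two) hVindep hVid hA hA0
  refine tendstoInDistribution_of_linearization hpsd hsymm hGlim
    (fun n => ((hφ.comp (hζhat n)).sub_const _).aemeasurable)
    (a := fun n s => ‖(n : ℝ)⁻¹ • ∑ i ∈ Finset.range n, V i s - P[V 0]‖) (K := 1 + ‖A‖)
    (by positivity) (fun n s => norm_nonneg _) ?_ ?_ ?_ ?_
  · refine (bddInProb_norm_sqrt_smul_mean hV2 hVindep hVid).mono fun n s => ?_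
    rw [norm_smul, Real.norm_of_nonneg (Real.sqrt_nonneg _)]
  · intro n
    have h1 : AEStronglyMeasurable
        (fun s => (n : ℝ)⁻¹ • ∑ i ∈ Finset.range n, V i s - P[V 0]) P :=
      (hVm n).aestronglyMeasurable.sub aestronglyMeasurable_const
    exact h1.norm.aemeasurable
  · filter_upwards [hgradV', hdelta] with s hs1 hs2
    filter_upwards [hs2.2] with n hn
    rw [← hs1 n]
    exact hn
  · have hcoef : ∀ᵐ s ∂P, ∀ α, Tendsto (fun n : ℕ => momentCoef
        ((n : ℝ)⁻¹ • ∑ i ∈ Finset.range n, moments (X i s) (Y i s)) α) atTop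
        (𝓝 (momentCoef (∫ s, moments (X 0 s) (Y 0 s) ∂P) α)) := by
      obtain ⟨hi, h1, h2, -, -⟩ := momentCov_integral hX2 hY2
      have h3 : Measurable fun d : (Fin m → ℝ) × (Fin m → ℝ) × Ω => moments d.1 d.2.1 :=
        measurable_moments.comp
          (measurable_fst.prodMk (measurable_fst.comp measurable_snd))
      filter_upwards [ae_tendsto_mean_comp hindep hident h3 hi] with s hs α
      exact (differentiableAt_momentCoef (h1 ▸ hS) (h2 ▸ hC) α).continuousAt.tendsto.comp hs
    have hunif := ae_all_iff.2 fun α => ae_uniform_mean_dist_sq hM hD hindep hident hOm (hqm α)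
      (hq1 α)
    have hmeanB := ae_all_iff.2 fun α => ae_all_iff.2 fun j => ae_all_iff.2 fun k =>
      ae_tendsto_mean_comp hindep hident (hqBm α j k) (hqB α j k)
    have hmeanR := ae_all_iff.2 fun k => ae_tendsto_mean_comp hindep hident (hκRm k) (hκR k)
    -- The exceptional null set may depend on `n`; countably many of them are united.
    have hmin : ∀ᵐ s ∂P, ∀ᶠ n in atTop, ∀ w,
        empObjective η n (fun i => X i s) (fun i => Y i s) (fun i => O i s) (ζhat n s) ≤
          empObjective η n (fun i => X i s) (fun i => Y i s) (fun i => O i s) w := by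
      obtain ⟨N, hN⟩ := eventually_atTop.1 hargmin
      have h1 : ∀ᵐ s ∂P, ∀ n, N ≤ n → ∀ w,
          empObjective η n (fun i => X i s) (fun i => Y i s) (fun i => O i s) (ζhat n s) ≤
            empObjective η n (fun i => X i s) (fun i => Y i s) (fun i => O i s) w := by
        refine ae_all_iff.2 fun n => ?_
        by_cases h : N ≤ n
        · filter_upwards [hN n h] with s hs _ using hs
        · exact ae_of_all _ fun s h' => absurd h' h
      filter_upwards [h1] with s hs using eventually_atTop.2 ⟨N, hs⟩
    filter_upwards [hgradV', hdelta, hexp', hcoef, hunif, hmeanB, hmeanR, hmin] with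
      s hs1 hs2 hs3 hs4 hs5 hs6 hs7 hs8 ε hε
    -- All almost sure limits now hold along one fixed sample, and the linearization is
    -- deterministic.
    refine argmin_linearization hs4
      (e := fun α v => ∫ s, q α (D 0 s) * dist (O 0 s) v ^ 2 ∂P)
      (C := ∫ s, κ (D 0 s) * M ∂P) (fun α v => ?_) hs5 ?_ hζφ hr hs3
      (κ := fun i => κ (D i s)) (fun i => hκ0 _) (fun i α => hqκ α (D i s)) hs6 hs7 hρ hpos hHess
      ?_ hs8 hε
    · rw [← Real.norm_eq_abs]
      refine norm_integral_le_of_norm_le (hκ1.mul_const M) (ae_of_all _ fun s => ?_)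
      rw [norm_mul, Real.norm_of_nonneg (sq_nonneg _)]
      exact mul_le_mul (hqκ α _) (hM _ _) (sq_nonneg _) (hκ0 _)
    · intro ε hε
      obtain ⟨δ, hδ, h⟩ := hζsep ε hε
      refine ⟨δ, hδ, fun w hw => ?_⟩
      have h1 := h w hw
      rw [popObjective_eq_sum hX2 hY2 (hO 0) hM hq1, popObjective_eq_sum hX2 hY2
          (hO 0) hM hq1] at h1
      exact h1
    · refine hs2.1.congr fun n => ?_
      exact hs1 n
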